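/- **Theorem.** There is a linear-time algorithm that, given a bipartite permutation graph as input, computes a maximum cardinality uniquely restricted matching in it. Here a graph on $n$ vertices (finite, simple, undirected) is a *permutation graph* if it is isomorphic to the graph $G_\pi$ of some permutation $\pi$ of $\{1,\dots,n\}$, where $V(G_\pi)=\{1,\dots,n\}$ and $E(G_\pi)=\{ij : (i-j)(\pi(i)-\pi(j))<0\}$; a *bipartite permutation graph* is a permutation graph that is bipartite. A matching $M$ in a graph $G$ is *uniquely restricted* if no other matching in $G$ matches the same set of vertices as $M$. *Linear time* means: there are a single program for a unit-cost random access machine (with addition, truncated subtraction, comparison, and indirect reading and writing of memory) and a constant $C$ such that, for every bipartite permutation graph $G$ with $n$ vertices $0,\dots,n-1$ and $m$ edges, given by adjacency lists whose entries are in arbitrary order, the program halts after at most $C(n+m+1)$ steps, computes only numbers smaller than $C(n+m+1)$ (so that words of $\log_2(n+m+1)+O(1)$ bits suffice), and outputs the list of the edges of a uniquely restricted matching of $G$ of maximum cardinality. -/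

import Mathlib

/-! ## Graph notions -/

/-- The graph `G_π` of a permutation `π`: distinct `i`, `j` are adjacent when `π` inverts them. -/
def permutationGraph {n : ℕ} (π : Equiv.Perm (Fin n)) : SimpleGraph (Fin n) where
  Adj i j := ((i : ℤ) - (j : ℤ)) * ((π i : ℤ) - (π j : ℤ)) < 0
  symm := ⟨fun i j h => by
    have e : ((j : ℤ) - (i : ℤ)) * ((π j : ℤ) - (π i : ℤ))
        = ((i : ℤ) - (j : ℤ)) * ((π i : ℤ) - (π j : ℤ)) := by ring
    rw [e]; exact h⟩
  loopless := ⟨fun i h => by simp at h⟩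

/-- A graph on `n` vertices is a permutation graph if it is isomorphic to some `G_π`. -/
def IsPermutationGraph {n : ℕ} (G : SimpleGraph (Fin n)) : Prop :=
  ∃ π : Equiv.Perm (Fin n), Nonempty (G ≃g permutationGraph π)

/-- A bipartite permutation graph. -/
def IsBipartitePermutationGraph {n : ℕ} (G : SimpleGraph (Fin n)) : Prop :=
  G.IsBipartite ∧ IsPermutationGraph G

/-- A uniquely restricted matching: no other matching of `G` matches the same set of vertices.
For a matching `M` in the sense of `Subgraph.IsMatching`, `M.verts` is exactly the set of matched
vertices, and `M` is determined by its set of edges. -/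
def IsUniquelyRestricted {V : Type*} {G : SimpleGraph V} (M : G.Subgraph) : Prop :=
  M.IsMatching ∧ ∀ M' : G.Subgraph, M'.IsMatching → M'.verts = M.verts → M' = M

/-- A uniquely restricted matching of maximum cardinality (number of edges). -/
def IsMaximumUniquelyRestricted {V : Type*} {G : SimpleGraph V} (M : G.Subgraph) : Prop :=
  IsUniquelyRestricted M ∧
    ∀ M' : G.Subgraph, IsUniquelyRestricted M' → M'.edgeSet.ncard ≤ M.edgeSet.ncard

/-! ## Random access machine

A word RAM with structured control flow. A program mentions finitely many registers and finitely
many memory arrays; array cells are accessed in one step at an address held in a register. -/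

namespace RAM

/-- The state of the machine: `reg r` is the content of register `r`, and `mem k i` is the
content of cell `i` of array `k`. -/
@[ext] structure State where
  reg : ℕ → ℕ
  mem : ℕ → ℕ → ℕ

/-- Overwrite register `r`. -/
def State.setReg (s : State) (r v : ℕ) : State :=
  { s with reg := Function.update s.reg r v }

/-- Overwrite cell `i` of array `k`. -/
def State.setMem (s : State) (k i v : ℕ) : State :=
  { s with mem := Function.update s.mem k (Function.update (s.mem k) i v) }

/-- Right-hand sides of register assignments; `a`, `b` name registers and `k` names an array. -/
inductive Rhs where
  | const (c : ℕ)
  | copy (a : ℕ)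
  | add (a b : ℕ)
  | sub (a b : ℕ)
  | load (k a : ℕ)

/-- The value of a right-hand side; subtraction is truncated at `0`. -/
def Rhs.value (s : State) : Rhs → ℕ
  | const c => c
  | copy a => s.reg a
  | add a b => s.reg a + s.reg b
  | sub a b => s.reg a - s.reg b
  | load k a => s.mem k (s.reg a)

/-- Programs. `assign r e` is `reg r := e`; `store k i a` is `mem k (reg i) := reg a`;
`ite a b p q` is `if reg a < reg b then p else q`; `loop a b p` is
`while reg a < reg b do p`. -/
inductive Prog where
  | skip
  | assign (r : ℕ) (e : Rhs)
  | store (k i a : ℕ)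
  | seq (p q : Prog)
  | ite (a b : ℕ) (p q : Prog)
  | loop (a b : ℕ) (p : Prog)

/-- `Exec W p s t s'`: on the machine whose words hold the numbers below `W`, program `p` started
in state `s` halts after exactly `t` steps in state `s'`. Every elementary instruction and every
evaluation of a test costs one step. A run in which a computed value does not fit into a word has
no outcome. -/
inductive Exec (W : ℕ) : Prog → State → ℕ → State → Prop
  | skip (s : State) : Exec W .skip s 1 s
  | assign (s : State) (r : ℕ) (e : Rhs) (fits : e.value s < W) :
      Exec W (.assign r e) s 1 (s.setReg r (e.value s))
  | store (s : State) (k i a : ℕ) :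
      Exec W (.store k i a) s 1 (s.setMem k (s.reg i) (s.reg a))
  | seq {p q : Prog} {s s' s'' : State} {t t' : ℕ}
      (hp : Exec W p s t s') (hq : Exec W q s' t' s'') : Exec W (.seq p q) s (t + t') s''
  | ite_true {a b : ℕ} {p q : Prog} {s s' : State} {t : ℕ} (test : s.reg a < s.reg b)
      (hp : Exec W p s t s') : Exec W (.ite a b p q) s (1 + t) s'
  | ite_false {a b : ℕ} {p q : Prog} {s s' : State} {t : ℕ} (test : ¬ s.reg a < s.reg b)
      (hq : Exec W q s t s') : Exec W (.ite a b p q) s (1 + t) s'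
  | loop_true {a b : ℕ} {p : Prog} {s s' s'' : State} {t t' : ℕ} (test : s.reg a < s.reg b)
      (hp : Exec W p s t s') (hloop : Exec W (.loop a b p) s' t' s'') :
      Exec W (.loop a b p) s (1 + t + t') s''
  | loop_false {a b : ℕ} {p : Prog} {s : State} (test : ¬ s.reg a < s.reg b) :
      Exec W (.loop a b p) s 1 s

/-- The machine is deterministic: a program has at most one outcome on a given state. -/
theorem Exec.deterministic {W : ℕ} {p : Prog} {s s₁ s₂ : State} {t₁ t₂ : ℕ}
    (h₁ : Exec W p s t₁ s₁) (h₂ : Exec W p s t₂ s₂) : t₁ = t₂ ∧ s₁ = s₂ := by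
  induction h₁ generalizing t₂ s₂ with
  | skip s => cases h₂; exact ⟨rfl, rfl⟩
  | assign s r e _ => cases h₂; exact ⟨rfl, rfl⟩
  | store s k i a => cases h₂; exact ⟨rfl, rfl⟩
  | seq _ _ ihp ihq =>
    cases h₂ with
    | seq hp hq =>
      obtain ⟨rfl, rfl⟩ := ihp hp
      obtain ⟨rfl, rfl⟩ := ihq hq
      exact ⟨rfl, rfl⟩
  | ite_true test _ ih =>
    cases h₂ with
    | ite_true _ hp => obtain ⟨rfl, rfl⟩ := ih hp; exact ⟨rfl, rfl⟩
    | ite_false test' _ => exact absurd test test'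
  | ite_false test _ ih =>
    cases h₂ with
    | ite_true test' _ => exact absurd test' test
    | ite_false _ hq => obtain ⟨rfl, rfl⟩ := ih hq; exact ⟨rfl, rfl⟩
  | loop_true test _ _ ihp ihl =>
    cases h₂ with
    | loop_true _ hp hl =>
      obtain ⟨rfl, rfl⟩ := ihp hp
      obtain ⟨rfl, rfl⟩ := ihl hl
      exact ⟨rfl, rfl⟩
    | loop_false test' => exact absurd test test'
  | loop_false test =>
    cases h₂ with
    | loop_true test' _ _ => exact absurd test' test
    | loop_false _ => exact ⟨rfl, rfl⟩

end RAM

/-! ## Input and output conventions -/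

/-- `adj` is an adjacency-list representation of `G`: `adj u` lists the neighbours of `u` without
repetition, in an arbitrary order. -/
def IsAdjacencyList {n : ℕ} (G : SimpleGraph (Fin n)) (adj : Fin n → List (Fin n)) : Prop :=
  ∀ u, (adj u).Nodup ∧ ∀ v, v ∈ adj u ↔ G.Adj u v

/-- The concatenation of the first `i` of the `n` lists. -/
def concatLists {n : ℕ} (adj : Fin n → List (Fin n)) (i : ℕ) : List (Fin n) :=
  ((List.finRange n).take i).flatMap adj

/-- The initial state for the input `adj`. Register `0` holds `n`; array `1` holds the
concatenation of all lists; for `i ≤ n`, cell `i` of array `0` holds the total length of the first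
`i` lists, so that the list of vertex `i` occupies the cells of array `1` from `mem 0 i` up to, but
not including, `mem 0 (i + 1)`. Everything else is `0`. -/
def inputState {n : ℕ} (adj : Fin n → List (Fin n)) : RAM.State where
  reg r := if r = 0 then n else 0
  mem k i :=
    if k = 0 then (if i ≤ n then (concatLists adj i).length else 0)
    else if k = 1 then ((concatLists adj n).map Fin.val).getD i 0
    else 0

/-- The state `s` contains `M` as output: register `0` holds the number of edges of `M`, and the
two ends of the `i`-th edge, in some enumeration without repetition of the edges of `M`, are in
cell `i` of array `0` and in cell `i` of array `1`. -/
def OutputsMatching {n : ℕ} {G : SimpleGraph (Fin n)} (s : RAM.State) (M : G.Subgraph) : Prop :=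
  ∃ L : List (Fin n × Fin n),
    (L.map fun p => s(p.1, p.2)).Nodup ∧
    (∀ e : Sym2 (Fin n), e ∈ M.edgeSet ↔ e ∈ L.map fun p => s(p.1, p.2)) ∧
    s.reg 0 = L.length ∧
    ∀ (i : ℕ) (hi : i < L.length), s.mem 0 i = (L[i].1 : ℕ) ∧ s.mem 1 i = (L[i].2 : ℕ)

/-! A permutation inverts no two vertices of one colour class of its graph. Hence, in the numbering
of the vertices, two edges that cross can be uncrossed in both ways (`cross_of_permutation`); such a
numbering is a strong order.

Say that the edge `e` precedes `f` if both ends of `e` come before the corresponding ends of `f` and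
the two edges span no four-cycle. Two edges of a uniquely restricted matching are comparable:
otherwise uncrossing produces a four-cycle, along which the partners can be exchanged
(`IsUniquelyRestricted.precedes`). Conversely, if another matching covered the vertices of a chain,
the least edge that it misses would span a four-cycle with a later edge
(`edgeSubgraph_isUniquelyRestricted`). So a longest chain is sought.

Longest chains are found greedily. An edge `f` follows `(a, b)` exactly if it passes `a` on one side
and the last neighbour of `a` on the other, or the same holds for `b` (`lt_of_precedes`). For each
alternative there is an edge with both ends least, and it depends on `a` alone or on `b` alone. Two
candidates per length therefore suffice: the least first end and the least second end among them
bound the last edge of every chain of that length (`card_le`), and going back through the candidates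
yields a chain (`backtrack_spec`).

The strong order is not part of the input and is recovered by breadth first search. If the search
starts at an end of the order, then along each layer the neighbourhoods in the previous layer shrink
and those in the next layer grow. Sorting by layer, and then by right degree minus left degree,
recovers the order up to vertices with equal neighbourhoods (`key_le`, `cross_key`). Both criteria
are packed into one key of size linear in `n`, so an array indexed by keys does the sorting. To find
an end, a first search starts anywhere: on each side of a component its labels first fall and then
rise, hence a vertex of largest key is an end of the order or of its reverse (`isEnd_or_isEnd_neg`).
A second search starts from there.

Running times are bounded by potentials that charge vertices, adjacency slots and keys. Numbers grow
by at most one per step, so the time bound also bounds the word size (`Exec.bounded`). -/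

/-! ## Strong orders and layerings -/

section Layers

variable {V : Type*} {H : SimpleGraph V}

/-- A strong order of a bipartite graph, one connected component at a time: `c` is a colouring and
crossing edges can be uncrossed in both ways. Distinct vertices may have equal positions. -/
structure StrongOrder (H : SimpleGraph V) (c : V → Bool) (p : V → ℤ) : Prop where
  color : ∀ {u v}, H.Adj u v → c u ≠ c v
  cross : ∀ {u u' v v'}, H.Reachable u u' → c u = c u' → p u ≤ p u' → p v ≤ p v' →
    H.Adj u v' → H.Adj u' v → H.Adj u v ∧ H.Adj u' v'

/-- `r` can play the role of the first vertex of its side of its component. -/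
def IsEnd (H : SimpleGraph V) (c : V → Bool) (p : V → ℤ) (r : V) : Prop :=
  ∀ {u v v'}, H.Reachable r u → c u = c r → p v ≤ p v' → H.Adj r v' → H.Adj u v →
    H.Adj r v ∧ H.Adj u v'

/-- The labels of a breadth first search: the layers of the components are the classes of equal
labels, and `root` holds for the starting vertices. -/
structure Layering (H : SimpleGraph V) (lab : V → ℕ) (root : V → Prop) : Prop where
  next : ∀ {u v w}, H.Adj u v → lab u < lab v → lab u < lab w → lab v ≤ lab w
  parent : ∀ {v w}, H.Adj v w → root v ∨ ∃ u, H.Adj u v ∧ lab u < lab v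
  root_closed : ∀ {r u v}, root r → H.Adj u v → lab u < lab r → lab v < lab r
  root_unique : ∀ {r w}, root r → lab w = lab r → w = r

theorem StrongOrder.neg {c : V → Bool} {p : V → ℤ} (h : StrongOrder H c p) :
    StrongOrder H c (fun v => - p v) where
  color := h.color
  cross := fun hr hc hu hv e e' => by
    have := h.cross hr.symm hc.symm (by simpa using hu) (by simpa using hv) e' e
    exact ⟨this.2, this.1⟩

theorem StrongOrder.color_of_adj {c : V → Bool} {p : V → ℤ} (h : StrongOrder H c p) {u u' v v' : V}
    (huv : H.Adj u v) (huv' : H.Adj u' v') : c u = c u' ↔ c v = c v' := by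
  have h1 := h.color huv
  have h2 := h.color huv'
  cases hu : c u <;> cases hu' : c u' <;> cases hv : c v <;> cases hv' : c v' <;> simp_all

namespace Layering

variable {lab : V → ℕ} {root : V → Prop} {c : V → Bool} {p : V → ℤ}

/-- `next` makes `lab u` the least label above `lab x`, so a label `lab y` strictly between `lab x`
and `lab u` is impossible. -/
theorem lab_parent_eq (hl : Layering H lab root) {u v x y : V} (hx : H.Adj x u) (hy : H.Adj y v)
    (hxu : lab x < lab u) (hyv : lab y < lab v) (h : lab u = lab v) : lab x = lab y := by
  rcases lt_trichotomy (lab x) (lab y) with h1 | h1 | h1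
  · have := hl.next hx hxu h1; omega
  · exact h1
  · have := hl.next hy hyv h1; omega

theorem lab_parent_lt (hl : Layering H lab root) {u v x y : V} (hxu : lab x < lab u)
    (hy : H.Adj y v) (hyv : lab y < lab v) (h : lab u < lab v) : lab x < lab y := by
  by_contra h1
  have := hl.next hy hyv (show lab y < lab u by omega); omega

/-- Parents of vertices with equal labels have equal labels again, and going down this way ends at a
root, which is alone in its layer. -/
theorem same_layer (hl : Layering H lab root) (hs : StrongOrder H c p) :
    ∀ (k : ℕ) {u v u' v' : V}, lab u = k → H.Adj u u' → H.Adj v v' → lab u = lab v →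
      H.Reachable u v ∧ c u = c v := by
  intro k
  induction k using Nat.strong_induction_on with
  | _ k ih =>
  intro u v u' v' hk hu hv huv
  rcases hl.parent hu with hr | ⟨x, hx, hxu⟩
  · obtain rfl := hl.root_unique hr huv.symm; exact ⟨.refl _, rfl⟩
  rcases hl.parent hv with hr | ⟨y, hy, hyv⟩
  · obtain rfl := hl.root_unique hr huv; exact ⟨.refl _, rfl⟩
  have hxy := hl.lab_parent_eq hx hy hxu hyv huv
  obtain ⟨h1, h2⟩ := ih (lab x) (by omega) rfl hx hy hxy
  exact ⟨hx.symm.reachable.trans (h1.trans hy.reachable), (hs.color_of_adj hx hy).1 h2⟩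

theorem lab_ne (hl : Layering H lab root) (hs : StrongOrder H c p) {u v : V} (h : H.Adj u v) :
    lab u ≠ lab v := fun e => hs.color h (hl.same_layer hs _ rfl h h.symm e).2

theorem root_le (hl : Layering H lab root) {r w : V} (hr : root r) (h : H.Reachable r w) :
    lab r ≤ lab w := by
  obtain ⟨q⟩ := h
  suffices ∀ {a b : V} (q : H.Walk a b), lab r ≤ lab a → lab r ≤ lab b from this q le_rfl
  intro a b q
  induction q with
  | nil => exact id
  | cons e _ ih =>
    intro ha
    refine ih ?_
    by_contra h1
    have := hl.root_closed hr e.symm (by omega)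
    omega

theorem root_lt (hl : Layering H lab root) {r u w : V} (hr : root r) (h : H.Reachable u w)
    (hu : lab u < lab r) : lab w < lab r := by
  obtain ⟨q⟩ := h
  induction q with
  | nil => exact hu
  | cons e _ ih => exact ih (hl.root_closed hr e hu)

theorem exists_root (hl : Layering H lab root) {v w : V} (h : H.Adj v w) :
    ∃ r, root r ∧ H.Reachable r v := by
  induction hk : lab v using Nat.strong_induction_on generalizing v w with
  | _ k ih =>
  rcases hl.parent h with hr | ⟨u, hu, huv⟩
  · exact ⟨v, hr, .refl _⟩
  · obtain ⟨r, hr, hru⟩ := ih _ (by omega) hu rfl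
    exact ⟨r, hr, hru.trans hu.reachable⟩

theorem root_eq (hl : Layering H lab root) {r r' : V} (hr : root r) (hr' : root r')
    (h : H.Reachable r r') : r = r' :=
  hl.root_unique hr' (le_antisymm (hl.root_le hr h) (hl.root_le hr' h.symm))

/-- Different components have disjoint ranges of labels. -/
theorem lt_of_not_reachable (hl : Layering H lab root) {u u' v v' : V} (huv : H.Adj u v)
    (huv' : H.Adj u' v') (h : ¬ H.Reachable u u') (hle : lab u ≤ lab u') : lab v < lab v' := by
  obtain ⟨r, hr, hru⟩ := hl.exists_root huv
  obtain ⟨r', hr', hru'⟩ := hl.exists_root huv'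
  have hne : lab r ≠ lab r' := fun e => by
    obtain rfl := hl.root_unique hr' e
    exact h (hru.symm.trans hru')
  have hlt : lab r < lab r' := by
    by_contra h1
    have h2 : lab r' < lab r := by omega
    have := hl.root_lt hr hru' h2
    have := hl.root_le hr hru
    omega
  exact (hl.root_lt hr' (hru.trans huv.reachable) hlt).trans_le
    (hl.root_le hr' (hru'.trans huv'.reachable))

/-- If a later layer contained a vertex `u'` placed before `u`, the edges from both to their parents
would cross. Uncrossing them joins `u'` to the parent of `u`, which forces the label of `u'` down to
that of `u`. The parents are in the right order by induction, unless the first one is a root; then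
`IsEnd` replaces the comparison of positions. -/
theorem pos_le (hl : Layering H lab root) (hs : StrongOrder H c p)
    (he : ∀ r, root r → IsEnd H c p r) :
    ∀ (k : ℕ) {u u' v v' : V}, lab u = k → H.Adj u v → H.Adj u' v' → H.Reachable u u' → c u = c u' →
      lab u < lab u' → ¬ root u → p u ≤ p u' := by
  intro k
  induction k using Nat.strong_induction_on with
  | _ k ih =>
  intro u u' v v' hk hu hu' hreach hc hlt hroot
  obtain ⟨x, hx, hxu⟩ := (hl.parent hu).resolve_left hroot
  obtain ⟨y, hy, hyu⟩ := (hl.parent hu').resolve_left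
    (fun hr => by have := hl.root_le hr hreach.symm; omega)
  have hxy := hl.lab_parent_lt hxu hy hyu hlt
  by_contra hp
  have hcxy : c x = c y := (hs.color_of_adj hx hy).2 hc
  have hre : H.Reachable x y := hx.reachable.trans (hreach.trans hy.symm.reachable)
  have key : H.Adj u' x := by
    by_cases hrx : root x
    · exact (he x hrx hre hcxy.symm (by omega : p u' ≤ p u) hx hy).1.symm
    · have := ih (lab x) (by omega) rfl hx hy hre hcxy hxy hrx
      exact (hs.cross hreach.symm hc.symm (by omega) this hy.symm hx.symm).1
  have := hl.next key.symm (by omega) hxu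
  omega

theorem cross_of_lab_lt (hl : Layering H lab root) (hs : StrongOrder H c p)
    (he : ∀ r, root r → IsEnd H c p r) {x y v v' : V} (hreach : H.Reachable x y) (hc : c x = c y)
    (hlt : lab x < lab y) (hp : p v ≤ p v') (h1 : H.Adj x v') (h2 : H.Adj y v) :
    H.Adj x v ∧ H.Adj y v' := by
  by_cases hrx : root x
  · exact he x hrx hreach hc.symm hp h1 h2
  · exact hs.cross hreach hc (hl.pos_le hs he _ rfl h1 h2 hreach hc hlt hrx) hp h1 h2

/-- The neighbour `x` of `u'` is compared with the parent `y` of `u`. If `x` is not after `y`, the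
edges at `u` and `u'` cross. Otherwise the edge from `x` to its own parent, which lies in an earlier
layer than `u`, crosses the edge `u y`. -/
theorem left_subset (hl : Layering H lab root) (hs : StrongOrder H c p)
    (he : ∀ r, root r → IsEnd H c p r) {u u' w x : V} (hu : H.Adj u w) (hlab : lab u = lab u')
    (hp : p u ≤ p u') (hx : H.Adj u' x) (hxu : lab x < lab u') : H.Adj u x := by
  obtain ⟨hre, hc⟩ := hl.same_layer hs _ rfl hu hx hlab
  rcases hl.parent hu with hr | ⟨y, hy, hyu⟩
  · obtain rfl := hl.root_unique hr hlab.symm; exact hx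
  have hxy : lab x = lab y := hl.lab_parent_eq hx.symm hy hxu hyu hlab.symm
  by_cases hpxy : p x ≤ p y
  · exact (hs.cross hre hc hp hpxy hy.symm hx).1
  rcases hl.parent hx.symm with hr | ⟨z, hz, hzx⟩
  · obtain rfl := hl.root_unique hr hxy.symm; exact hy.symm
  · exact (hl.cross_of_lab_lt hs he
      (hz.reachable.trans (hx.symm.reachable.trans hre.symm))
      ((hs.color_of_adj hz hy.symm).2 (hl.same_layer hs _ rfl hz.symm hy hxy).2)
      (by omega) (by omega : p y ≤ p x) hz hy.symm).2

/-- The edge from `u'` to its parent crosses `u x`, because the parent lies in an earlier layer than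
`x`. -/
theorem right_subset (hl : Layering H lab root) (hs : StrongOrder H c p)
    (he : ∀ r, root r → IsEnd H c p r) {u u' w x : V} (hu' : H.Adj u' w) (hlab : lab u = lab u')
    (hp : p u ≤ p u') (hx : H.Adj u x) (hxu : lab u < lab x) : H.Adj u' x := by
  obtain ⟨hre, hc⟩ := hl.same_layer hs _ rfl hx hu' hlab
  rcases hl.parent hu' with hr | ⟨z, hz, hzu⟩
  · obtain rfl := hl.root_unique hr hlab; exact hx
  exact (hl.cross_of_lab_lt hs he (hz.reachable.trans (hre.symm.trans hx.reachable))
    ((hs.color_of_adj hz hx.symm).2 hc.symm) (by omega) hp hz hx.symm).2.symm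

end Layering

end Layers

/-! ### Sorting by layer and by degree difference; ends of the order -/

section Keys

variable {V : Type*} {H : SimpleGraph V}

open Classical in
/-- The keys computed from the labels of a breadth first search. -/
structure LayerKey (H : SimpleGraph V) (S : Finset V) (lab key : V → ℕ) : Prop where
  mem : ∀ {u v}, H.Adj u v → u ∈ S
  lab_pos : ∀ {u v}, H.Adj u v → lab u ≠ 0
  card_lt : ∀ {u v}, H.Adj u v → lab u = 1 + (S.filter fun w => lab w ≠ 0 ∧ lab w < lab u).card
  key_eq : ∀ {u v}, H.Adj u v → key u =
    2 * (lab u + (1 + (S.filter fun w => lab w ≠ 0 ∧ lab w ≤ lab u).card)) +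
      (S.filter fun v => H.Adj u v ∧ lab u < lab v).card -
      (S.filter fun v => H.Adj u v ∧ lab v < lab u).card

namespace Layering

variable {lab key : V → ℕ} {root : V → Prop} {c : V → Bool} {p : V → ℤ} {S : Finset V}

open Classical in
-- The lower neighbours of `u` and the vertices with labels below `m` are disjoint and all lie
-- before the layer of `u`. With `m = 0` this shows that the subtraction in `key_eq` is never
-- truncated.
theorem _root_.LayerKey.left_bound (hk : LayerKey H S lab key) {u v : V} (hu : H.Adj u v)
    (m : ℕ) (hm : m ≤ lab u) (hm' : ∀ x, H.Adj u x → lab x < lab u → m ≤ lab x) :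
    (S.filter fun w => lab w ≠ 0 ∧ lab w < m).card +
      (S.filter fun v => H.Adj u v ∧ lab v < lab u).card + 1 ≤ lab u := by
  have e := hk.card_lt hu
  suffices h : (S.filter fun w => lab w ≠ 0 ∧ lab w < m).card +
      (S.filter fun v => H.Adj u v ∧ lab v < lab u).card ≤
      (S.filter fun w => lab w ≠ 0 ∧ lab w < lab u).card by omega
  rw [← Finset.card_union_of_disjoint]
  · apply Finset.card_le_card
    intro w
    simp only [Finset.mem_union, Finset.mem_filter]
    rintro (⟨h1, h2, h3⟩ | ⟨h1, h2, h3⟩)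
    · exact ⟨h1, h2, by omega⟩
    · exact ⟨h1, hk.lab_pos h2.symm, h3⟩
  · rw [Finset.disjoint_left]
    simp only [Finset.mem_filter]
    rintro w ⟨h1, h2, h3⟩ ⟨h4, h5, h6⟩
    have := hm' w h5 h6
    omega

open Classical in
-- The upper neighbours of `u` lie in layers after its own, up to that of `u'`, and the lower
-- neighbours of `u'` lie in the layers from that of `u` up to the one before its own. So these
-- degrees are at most the differences of the layer ends and of the labels, respectively. The factor
-- `2` in the key makes the comparison strict.
theorem key_lt (hl : Layering H lab root) (hk : LayerKey H S lab key) {u u' v v' : V}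
    (hu : H.Adj u v) (hu' : H.Adj u' v') (h : lab u < lab u') : key u < key u' := by
  have e1 := hk.key_eq hu
  have e2 := hk.key_eq hu'
  have l1 := hk.card_lt hu
  have l2 := hk.card_lt hu'
  have h1 : (S.filter fun w => lab w ≠ 0 ∧ lab w ≤ lab u).card ≤
      (S.filter fun w => lab w ≠ 0 ∧ lab w < lab u').card := by
    apply Finset.card_le_card
    intro w
    simp only [Finset.mem_filter]
    rintro ⟨h1, h2, h3⟩
    exact ⟨h1, h2, by omega⟩
  have h2 : (S.filter fun w => lab w ≠ 0 ∧ lab w < lab u).card <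
      (S.filter fun w => lab w ≠ 0 ∧ lab w ≤ lab u).card := by
    apply Finset.card_lt_card
    rw [Finset.ssubset_iff_of_subset]
    · exact ⟨u, by simp [hk.mem hu, hk.lab_pos hu], by simp⟩
    · intro w
      simp only [Finset.mem_filter]
      rintro ⟨h1, h2, h3⟩
      exact ⟨h1, h2, by omega⟩
  have h3 : (S.filter fun w => lab w ≠ 0 ∧ lab w ≤ lab u).card +
      (S.filter fun v => H.Adj u v ∧ lab u < lab v).card ≤
      (S.filter fun w => lab w ≠ 0 ∧ lab w ≤ lab u').card := by
    rw [← Finset.card_union_of_disjoint]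
    · apply Finset.card_le_card
      intro w
      simp only [Finset.mem_union, Finset.mem_filter]
      rintro (⟨h1, h2, h3⟩ | ⟨h1, h2, h3⟩)
      · exact ⟨h1, h2, by omega⟩
      · exact ⟨h1, hk.lab_pos h2.symm, hl.next h2 h3 h⟩
    · rw [Finset.disjoint_left]
      simp only [Finset.mem_filter]
      rintro w ⟨h1, h2, h3⟩ ⟨h4, h5, h6⟩
      omega
  have h4 := hk.left_bound hu' (lab u) h.le (fun x hx hxu => by
    by_contra h5
    have := hl.next hx.symm hxu (show lab x < lab u by omega)
    omega)
  have h5 := hk.left_bound hu 0 (by omega) (by simp)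
  omega

open Classical in
-- Inside a layer only right degree minus left degree varies. By the nested neighbourhoods both
-- terms raise the key along the order, so equal keys turn both inclusions into equalities.
theorem key_le (hl : Layering H lab root) (hk : LayerKey H S lab key) (hs : StrongOrder H c p)
    (he : ∀ r, root r → IsEnd H c p r) {u u' v v' : V}
    (hu : H.Adj u v) (hu' : H.Adj u' v') (h : lab u = lab u') (hp : p u ≤ p u') :
    key u ≤ key u' ∧ (key u = key u' → ∀ x, H.Adj u x ↔ H.Adj u' x) := by
  have e1 := hk.key_eq hu
  have e2 := hk.key_eq hu'
  have sl : (S.filter fun v => H.Adj u' v ∧ lab v < lab u') ⊆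
      (S.filter fun v => H.Adj u v ∧ lab v < lab u) := by
    intro w
    simp only [Finset.mem_filter]
    rintro ⟨h1, h2, h3⟩
    exact ⟨h1, hl.left_subset hs he hu h hp h2 h3, by omega⟩
  have sr : (S.filter fun v => H.Adj u v ∧ lab u < lab v) ⊆
      (S.filter fun v => H.Adj u' v ∧ lab u' < lab v) := by
    intro w
    simp only [Finset.mem_filter]
    rintro ⟨h1, h2, h3⟩
    exact ⟨h1, hl.right_subset hs he hu' h hp h2 h3, by omega⟩
  have cl := Finset.card_le_card sl
  have cr := Finset.card_le_card sr
  have h5 := hk.left_bound hu 0 (by omega) (by simp)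
  have h6 := hk.left_bound hu' 0 (by omega) (by simp)
  rw [← h] at e2 cl cr h6
  rw [← h] at sl sr
  refine ⟨by omega, fun hkey x => ?_⟩
  have el := Finset.eq_of_subset_of_card_le sl (by omega)
  have er := Finset.eq_of_subset_of_card_le sr (by omega)
  simp only [Finset.ext_iff, Finset.mem_filter] at el er
  constructor
  · intro hx
    rcases lt_or_gt_of_ne (hl.lab_ne hs hx) with h1 | h1
    · exact ((er x).1 ⟨hk.mem hx.symm, hx, h1⟩).2.1
    · exact ((el x).2 ⟨hk.mem hx.symm, hx, h1⟩).2.1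
  · intro hx
    rcases lt_or_gt_of_ne (hl.lab_ne hs hx) with h1 | h1
    · exact ((er x).2 ⟨hk.mem hx.symm, hx, by omega⟩).2.1
    · exact ((el x).1 ⟨hk.mem hx.symm, hx, by omega⟩).2.1

theorem lab_eq_of_key_eq (hl : Layering H lab root) (hk : LayerKey H S lab key) {u u' v v' : V}
    (hu : H.Adj u v) (hu' : H.Adj u' v') (h : key u = key u') : lab u = lab u' := by
  rcases lt_trichotomy (lab u) (lab u') with h1 | h1 | h1
  · have := hl.key_lt hk hu hu' h1; omega
  · exact h1
  · have := hl.key_lt hk hu' hu h1; omega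

theorem adj_iff_of_key_eq (hl : Layering H lab root) (hk : LayerKey H S lab key)
    (hs : StrongOrder H c p) (he : ∀ r, root r → IsEnd H c p r) {u u' v v' : V}
    (hu : H.Adj u v) (hu' : H.Adj u' v') (h : key u = key u') (x : V) :
    H.Adj u x ↔ H.Adj u' x := by
  have hlab := hl.lab_eq_of_key_eq hk hu hu' h
  rcases le_total (p u) (p u') with hp | hp
  · exact (hl.key_le hk hs he hu hu' hlab hp).2 h x
  · exact ((hl.key_le hk hs he hu' hu hlab.symm hp).2 h.symm x).symm

/-- The keys of a breadth first search that starts at end vertices are a strong order. -/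
theorem cross_key (hl : Layering H lab root) (hk : LayerKey H S lab key)
    (hs : StrongOrder H c p) (he : ∀ r, root r → IsEnd H c p r) {u u' v v' : V}
    (hc : H.Reachable u u' → c u = c u') (hu : key u ≤ key u') (hv : key v ≤ key v')
    (h1 : H.Adj u v') (h2 : H.Adj u' v) : H.Adj u v ∧ H.Adj u' v' := by
  have labs : ∀ {a b a' b'}, H.Adj a a' → H.Adj b b' → key a ≤ key b → lab a ≤ lab b :=
    fun ha hb hab => by
      by_contra h3
      have := hl.key_lt hk hb ha (by omega)
      omega
  have pos : ∀ {a b a' b'}, H.Adj a a' → H.Adj b b' → H.Reachable a b → c a = c b →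
      key a < key b → ¬ root a → p a ≤ p b := fun ha hb hre hcol hab hra => by
    rcases (labs ha hb hab.le).lt_or_eq with h3 | h3
    · exact hl.pos_le hs he _ rfl ha hb hre hcol h3 hra
    · by_contra h4
      have := (hl.key_le hk hs he hb ha h3.symm (by omega)).1
      omega
  by_cases hre : H.Reachable u u'
  · have hc := hc hre
    have hcv : c v = c v' := ((hs.color_of_adj h1 h2).1 hc).symm
    have hrev : H.Reachable v v' := h2.symm.reachable.trans (hre.symm.trans h1.reachable)
    rcases hu.eq_or_lt with hu | hu
    · have := hl.adj_iff_of_key_eq hk hs he h1 h2 hu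
      exact ⟨(this v).2 h2, (this v').1 h1⟩
    rcases hv.eq_or_lt with hv | hv
    · have := hl.adj_iff_of_key_eq hk hs he h2.symm h1.symm hv
      exact ⟨((this u).2 h1.symm).symm, ((this u').1 h2.symm).symm⟩
    by_cases hru : root u
    · by_cases hpv : p v ≤ p v'
      · exact he u hru hre hc.symm hpv h1 h2
      -- Positions of non-roots agree with the keys, so a disagreement makes `v` a root too. A
      -- component has one root, and `u`, `v` differ in colour.
      · have hrv : root v := by
          by_contra hrv
          exact hpv (pos h2.symm h1.symm hrev hcv hv hrv)
        have := hl.root_eq hru hrv (hre.trans h2.reachable)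
        subst this
        exact absurd hc.symm (hs.color h2)
    · have hpu := pos h1 h2 hre hc hu hru
      by_cases hrv : root v
      · have := he v hrv hrev hcv.symm hpu h2.symm h1.symm
        exact ⟨this.1.symm, this.2.symm⟩
      · exact hs.cross hre hc hpu (pos h2.symm h1.symm hrev hcv hv hrv) h1 h2
  -- Components occupy disjoint ranges of labels, so edges of different components never cross.
  · have h3 := hl.lt_of_not_reachable h1 h2 hre (labs h1 h2 hu)
    have := hl.key_lt hk h1.symm h2.symm h3
    omega

/-- For a non-root the parent will do. The neighbours of a root form the next layer, which comes
before the layer of any other vertex of the colour of the root. -/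
theorem exists_low_neighbor (hl : Layering H lab root) (hs : StrongOrder H c p) {u z u' z' : V}
    (hu : H.Adj u u') (hz : H.Adj z z') (hre : H.Reachable u z) (hc : c u = c z) (hne : u ≠ z) :
    ∃ x, H.Adj u x ∧ lab x < max (lab u) (lab z) := by
  rcases hl.parent hu with hr | ⟨x, hx, hxu⟩
  · refine ⟨u', hu, lt_max_of_lt_right ?_⟩
    have h1 : lab u ≠ lab z := fun e => hne (hl.root_unique hr e.symm).symm
    have h2 := hl.root_le hr hre
    have h3 := hl.root_le hr hu.reachable
    have h4 := hl.lab_ne hs hu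
    have h5 := hl.next hu (by omega) (show lab u < lab z by omega)
    refine h5.lt_of_ne fun e => ?_
    have := (hl.same_layer hs _ rfl hu.symm hz e).2
    exact hs.color hu (hc.trans this.symm)
  · exact ⟨x, hx.symm, lt_max_of_lt_left hxu⟩

/-- Along a strong order, the labels of each side of a component first fall and then rise. -/
theorem lab_le_max (hl : Layering H lab root) (hs : StrongOrder H c p) (hinj : p.Injective) :
    ∀ (k : ℕ) {u x z u' x' z' : V}, max (lab u) (lab z) ≤ k → H.Adj u u' → H.Adj x x' →
      H.Adj z z' → H.Reachable u x → H.Reachable x z → c u = c x → c x = c z → p u ≤ p x →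
      p x ≤ p z → lab x ≤ max (lab u) (lab z) := by
  intro k
  induction k using Nat.strong_induction_on with
  | _ k ih =>
  intro u x z u' x' z' hk hu hx hz hux hxz cux cxz pux pxz
  by_cases hne : u = z
  · subst hne
    obtain rfl := hinj (le_antisymm pux pxz)
    exact le_max_left _ _
  obtain ⟨a, ha, hau⟩ := hl.exists_low_neighbor hs hu hz (hux.trans hxz) (cux.trans cxz) hne
  obtain ⟨b, hb, hbz⟩ := hl.exists_low_neighbor hs hz hu (hux.trans hxz).symm (cux.trans cxz).symm
    (Ne.symm hne)
  rw [max_comm] at hbz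
  by_contra hlt
  push Not at hlt
  -- A neighbour `w` of `x` with such a small label would, by `next`, keep the label of `x` below
  -- the supposed value.
  have done : ∀ {w}, H.Adj w x → lab w < max (lab u) (lab z) → False := fun {w} hw h => by
    rcases lt_max_iff.1 h with h1 | h1
    · have := hl.next hw (by omega) h1
      have := le_max_left (lab u) (lab z)
      omega
    · have := hl.next hw (by omega) h1
      have := le_max_right (lab u) (lab z)
      omega
  have hxr : ¬ root x := fun hr => by
    have := hl.root_le hr hxz
    have := le_max_right (lab u) (lab z)
    omega
  obtain ⟨y, hy, hyx⟩ := (hl.parent hx).resolve_left hxr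
  have cya : c a = c y := (hs.color_of_adj ha hy.symm).1 cux
  have cyb : c y = c b := (hs.color_of_adj hy.symm hb).1 cxz
  have ray : H.Reachable a y := ha.symm.reachable.trans (hux.trans hy.symm.reachable)
  have ryb : H.Reachable y b := hy.reachable.trans (hxz.trans hb.reachable)
  -- The parent `y` of `x` is compared with the low neighbours `a` of `u` and `b` of `z`. Outside
  -- the interval from `a` to `b` an uncrossing joins `x` to `a` or to `b`; inside it the induction
  -- hypothesis applies to `a`, `y`, `b`.
  by_cases h1 : p y ≤ p a
  · exact done (hs.cross hux cux pux h1 ha hy.symm).2.symm hau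
  by_cases h2 : p b ≤ p y
  · exact done (hs.cross hxz cxz pxz h2 hy.symm hb).1.symm hbz
  have := ih (max (lab a) (lab b)) (by omega) le_rfl ha.symm hy hb.symm ray ryb cya cyb
    (by omega) (by omega)
  exact done hy (by omega)

open Classical in
/-- A vertex of largest key among the vertices of its component is an end of the order, if its
layer covers the vertices before it. -/
theorem isEnd_of_left (hl : Layering H lab root) (hk : LayerKey H S lab key)
    (hs : StrongOrder H c p) {r r' : V} (hr : H.Adj r r')
    (hmax : ∀ {u u'}, H.Adj u u' → H.Reachable r u → key u ≤ key r)
    (hleft : ∀ {u u'}, H.Adj u u' → H.Reachable r u → c u = c r → p u ≤ p r → lab r ≤ lab u) :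
    IsEnd H c p r := by
  intro u v v' hre hc hp h1 h2
  by_cases hpu : p r ≤ p u
  · exact hs.cross hre hc.symm hpu hp h1 h2
  -- The largest key lies in the last layer of the component, so a competitor `u` placed before `r`
  -- lies in the layer of `r`.
  have top : ∀ {x x'}, H.Adj x x' → H.Reachable r x → lab x ≤ lab r := fun hx hrx => by
    by_contra h3
    have := hl.key_lt hk hr hx (by omega)
    have := hmax hx hrx
    omega
  have hlab : lab u = lab r := le_antisymm (top h2 hre) (hleft h2 hre hc (by omega))
  have low : ∀ {x}, H.Adj r x → lab x < lab r := fun hx => by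
    have := top hx.symm hx.reachable
    have := hl.lab_ne hs hx
    omega
  have lowu : ∀ {x}, H.Adj u x → lab x < lab u := fun hx => by
    have := top hx.symm (hre.trans hx.reachable)
    have := hl.lab_ne hs hx
    omega
  have sub : ∀ {x}, H.Adj u x → H.Adj r x := fun {x} hx => by
    by_cases hpx : p v' ≤ p x
    · exact (hs.cross hre.symm hc (by omega) hpx hx h1).2
    have hxv := hl.lab_parent_eq h1.symm hx.symm (low h1) (lowu hx) hlab.symm
    rcases hl.parent hx.symm with hrx | ⟨z, hz, hzx⟩
    · obtain rfl := hl.root_unique hrx hxv; exact h1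
    have hcz : c z = c r := ((hs.color_of_adj hz hx).2 rfl).trans hc
    have hrz : H.Reachable r z := hre.trans (hx.reachable.trans hz.symm.reachable)
    have hpz : p r ≤ p z := by
      by_contra h3
      have := hleft hz hrz hcz (by omega)
      have := lowu hx
      omega
    exact (hs.cross hrz hcz.symm hpz (by omega : p x ≤ p v') h1 hz).1
  have e1 := hk.key_eq hr
  have e2 := hk.key_eq h2
  have hke := hmax h2 hre
  have z1 : (S.filter fun v => H.Adj r v ∧ lab r < lab v).card = 0 := by
    rw [Finset.card_eq_zero, Finset.filter_eq_empty_iff]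
    rintro x - ⟨h3, h4⟩
    have := low h3
    omega
  have z2 : (S.filter fun v => H.Adj u v ∧ lab u < lab v).card = 0 := by
    rw [Finset.card_eq_zero, Finset.filter_eq_empty_iff]
    rintro x - ⟨h3, h4⟩
    have := lowu h3
    omega
  have h5 := hk.left_bound hr 0 (by omega) (by simp)
  have h6 := hk.left_bound h2 0 (by omega) (by simp)
  have ss : (S.filter fun v => H.Adj u v ∧ lab v < lab u) ⊆
      (S.filter fun v => H.Adj r v ∧ lab v < lab r) := by
    intro w
    simp only [Finset.mem_filter]
    rintro ⟨h1, h2, h3⟩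
    exact ⟨h1, sub h2, by omega⟩
  rw [hlab] at e2 z2 h6 ss
  -- In the last layer there are no upper neighbours and a larger key means a smaller degree. Hence
  -- `r` has at most as many neighbours as `u`, and the inclusion of neighbourhoods is an equality.
  have ee := Finset.eq_of_subset_of_card_le ss (by omega)
  have := (Finset.ext_iff.1 ee v').2 (by simp [h1, hk.mem h1.symm, low h1])
  exact ⟨sub h2, (Finset.mem_filter.1 this).2.1⟩

/-- A vertex of largest key in its component is an end of the order or of its reverse. -/
theorem isEnd_or_isEnd_neg (hl : Layering H lab root) (hk : LayerKey H S lab key)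
    (hs : StrongOrder H c p) (hinj : p.Injective) {r r' : V} (hr : H.Adj r r')
    (hmax : ∀ {u u'}, H.Adj u u' → H.Reachable r u → key u ≤ key r) :
    IsEnd H c p r ∨ IsEnd H c (fun v => - p v) r := by
  by_cases hleft : ∀ {u u'}, H.Adj u u' → H.Reachable r u → c u = c r → p u ≤ p r → lab r ≤ lab u
  · exact .inl (hl.isEnd_of_left hk hs hr hmax hleft)
  -- Some vertex `u` before `r` has a smaller label. Since labels first fall and then rise, no
  -- vertex after `r` can have one as well.
  · refine .inr (hl.isEnd_of_left hk hs.neg hr hmax fun {z z'} hz hrz hcz hpz => ?_)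
    push Not at hleft
    obtain ⟨u, u', hu, hru, hcu, hpu, hlt⟩ := hleft
    have := hl.lab_le_max hs hinj _ le_rfl hu hr hz hru.symm hrz hcu hcz.symm hpu (by simpa using hpz)
    omega

end Layering

/-- Reversing a strong order in some of the components. -/
theorem StrongOrder.flip {c : V → Bool} {p : V → ℤ} (h : StrongOrder H c p)
    (f : H.ConnectedComponent → ℤ) (hf : ∀ K, f K = 1 ∨ f K = -1) :
    StrongOrder H c (fun v => f (H.connectedComponentMk v) * p v) where
  color := h.color
  cross := fun {u u' v v'} hr hc hu hv e e' => by
    have h1 : H.connectedComponentMk u' = H.connectedComponentMk u :=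
      SimpleGraph.ConnectedComponent.sound hr.symm
    have h2 : H.connectedComponentMk v' = H.connectedComponentMk u :=
      SimpleGraph.ConnectedComponent.sound e.symm.reachable
    have h3 : H.connectedComponentMk v = H.connectedComponentMk u :=
      SimpleGraph.ConnectedComponent.sound (e'.symm.reachable.trans hr.symm)
    simp only [h1, h2, h3] at hu hv
    rcases hf (H.connectedComponentMk u) with h4 | h4 <;> simp only [h4] at hu hv
    · exact h.cross hr hc (by omega) (by omega) e e'
    · exact h.neg.cross hr hc (by omega) (by omega) e e'

/-- If every root is an end of a strong order or of its reverse, then there is a strong order of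
which all roots are ends. -/
theorem StrongOrder.exists_isEnd {lab : V → ℕ} {root : V → Prop} {c : V → Bool} {p : V → ℤ}
    (hl : Layering H lab root) (h : StrongOrder H c p)
    (he : ∀ r, root r → IsEnd H c p r ∨ IsEnd H c (fun v => - p v) r) :
    ∃ p', StrongOrder H c p' ∧ ∀ r, root r → IsEnd H c p' r := by
  classical
  refine ⟨_, h.flip (fun K => if ∃ r, root r ∧ H.connectedComponentMk r = K ∧ IsEnd H c p r
    then 1 else -1) (fun K => by split_ifs <;> simp), fun r hr u v v' hre hc hp h1 h2 => ?_⟩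
  have e1 : H.connectedComponentMk v' = H.connectedComponentMk r :=
    SimpleGraph.ConnectedComponent.sound h1.symm.reachable
  have e2 : H.connectedComponentMk v = H.connectedComponentMk r :=
    SimpleGraph.ConnectedComponent.sound (h2.symm.reachable.trans hre.symm)
  simp only [e1, e2] at hp
  by_cases hE : IsEnd H c p r
  · rw [if_pos ⟨r, hr, rfl, hE⟩] at hp
    exact hE hre hc (by omega) h1 h2
  · rw [if_neg] at hp
    · have hp' : -p v ≤ -p v' := by omega
      exact (he r hr).resolve_left hE hre hc hp' h1 h2
    · rintro ⟨r', hr', e, hE'⟩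
      obtain rfl := hl.root_eq hr' hr (SimpleGraph.ConnectedComponent.exact e)
      exact hE hE'

end Keys

/-! ### The strong order given by a permutation -/

section PermutationOrder

/-- The graph `G` with its vertices regarded as natural numbers. -/
def natGraph {n : ℕ} (G : SimpleGraph (Fin n)) : SimpleGraph ℕ where
  Adj u v := ∃ (hu : u < n) (hv : v < n), G.Adj ⟨u, hu⟩ ⟨v, hv⟩
  symm := ⟨fun _ _ ⟨hu, hv, h⟩ => ⟨hv, hu, h.symm⟩⟩
  loopless := ⟨fun _ ⟨_, _, h⟩ => h.ne rfl⟩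

theorem natGraph_adj {n : ℕ} {G : SimpleGraph (Fin n)} {u v : ℕ} :
    (natGraph G).Adj u v ↔ ∃ (hu : u < n) (hv : v < n), G.Adj ⟨u, hu⟩ ⟨v, hv⟩ := Iff.rfl

/-- Since `a`, `a'` are not inverted and neither are `b`, `b'`, the permutation preserves both
orders. What remains is a statement about inequalities between eight numbers. -/
theorem cross_of_permutation {n : ℕ} {π : Equiv.Perm (Fin n)} {a a' b b' : Fin n}
    (ha : ¬ (permutationGraph π).Adj a a') (hb : ¬ (permutationGraph π).Adj b b')
    (haa : a ≤ a') (hbb : b ≤ b') (h1 : (permutationGraph π).Adj a b')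
    (h2 : (permutationGraph π).Adj a' b) :
    (permutationGraph π).Adj a b ∧ (permutationGraph π).Adj a' b' := by
  rcases haa.eq_or_lt with rfl | haa
  · exact ⟨h2, h1⟩
  rcases hbb.eq_or_lt with rfl | hbb
  · exact ⟨h1, h2⟩
  simp only [permutationGraph, mul_neg_iff] at *
  have e1 : (π a : ℕ) ≠ π a' := fun e => haa.ne (π.injective (Fin.ext e))
  have e2 : (π b : ℕ) ≠ π b' := fun e => hbb.ne (π.injective (Fin.ext e))
  have h3 : (a : ℕ) < a' := haa
  have h4 : (b : ℕ) < b' := hbb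
  omega

theorem exists_strongOrder {n : ℕ} {G : SimpleGraph (Fin n)} (h : IsBipartitePermutationGraph G) :
    ∃ (c : ℕ → Bool) (p : ℕ → ℤ), StrongOrder (natGraph G) c p ∧ p.Injective := by
  obtain ⟨⟨C⟩, π, ⟨φ⟩⟩ := h
  let c : ℕ → Bool := fun v => if h : v < n then decide (C ⟨v, h⟩ = 0) else true
  -- Outside the graph the identity serves only to make `p` injective on all of `ℕ`.
  let p : ℕ → ℤ := fun v => if h : v < n then (φ ⟨v, h⟩ : ℕ) else v
  have hcol : ∀ {u v}, (natGraph G).Adj u v → c u ≠ c v := by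
    intro u v h
    obtain ⟨hu, hv, h⟩ := natGraph_adj.1 h
    have := C.valid h
    simp only [c, hu, hv, dif_pos]
    generalize C ⟨u, hu⟩ = x at *
    generalize C ⟨v, hv⟩ = y at *
    revert x y
    decide
  refine ⟨c, p, ⟨hcol, ?_⟩, ?_⟩
  · intro u u' v v' _ hc hu hv h1 h2
    have hcv : c v = c v' := by
      have := hcol h1
      have := hcol h2
      cases h1 : c u <;> cases h2 : c u' <;> cases h3 : c v <;> cases h4 : c v' <;> simp_all
    have nu : ¬ (natGraph G).Adj u u' := fun h => hcol h hc
    have nv : ¬ (natGraph G).Adj v v' := fun h => hcol h hcv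
    obtain ⟨lu, lv', h1⟩ := natGraph_adj.1 h1
    obtain ⟨lu', lv, h2⟩ := natGraph_adj.1 h2
    simp only [natGraph_adj, lu, lv, lu', lv', exists_true_left, ← φ.map_adj_iff] at h1 h2 nu nv ⊢
    simp only [p, lu, lv, lu', lv', dif_pos] at hu hv
    exact cross_of_permutation nu nv (by exact_mod_cast hu) (by exact_mod_cast hv) h1 h2
  · intro u v h
    simp only [p] at h
    split_ifs at h with h1 h2 h2
    · have : φ ⟨u, h1⟩ = φ ⟨v, h2⟩ := Fin.ext (by exact_mod_cast h)
      simpa using φ.injective this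
    · have := (φ ⟨u, h1⟩).2; omega
    · have := (φ ⟨v, h2⟩).2; omega
    · exact_mod_cast h

end PermutationOrder

/-! ### Uniquely restricted matchings as chains of edges -/

section Chains

/-- Keys and sides such that crossing edges can be uncrossed in the whole graph. -/
structure KeyOrder {V : Type*} (H : SimpleGraph V) (side key : V → ℕ) : Prop where
  side_add : ∀ {u v}, H.Adj u v → side u + side v = 1
  cross : ∀ {u u' v v'}, side u = side u' → key u ≤ key u' → key v ≤ key v' →
    H.Adj u v' → H.Adj u' v → H.Adj u v ∧ H.Adj u' v'

/-- The edge `e` lies before the edge `f`, and the two do not span a cycle of length four. -/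
def Precedes {V : Type*} (H : SimpleGraph V) (key : V → ℕ) (e f : V × V) : Prop :=
  key e.1 < key f.1 ∧ key e.2 < key f.2 ∧ ¬ (H.Adj e.1 f.2 ∧ H.Adj f.1 e.2)

/-- The subgraph formed by a set of edges. -/
def edgeSubgraph {V : Type*} (G : SimpleGraph V) (S : Set (V × V))
    (hS : ∀ e ∈ S, G.Adj e.1 e.2) : G.Subgraph where
  verts := {x | ∃ e ∈ S, x = e.1 ∨ x = e.2}
  Adj x y := (x, y) ∈ S ∨ (y, x) ∈ S
  adj_sub := by
    rintro x y (h | h)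
    · exact hS _ h
    · exact (hS _ h).symm
  edge_vert := by
    rintro x y (h | h)
    · exact ⟨_, h, .inl rfl⟩
    · exact ⟨_, h, .inr rfl⟩
  symm := ⟨fun _ _ h => h.symm⟩

/-- Two matchings that agree on their vertices are equal if one contains the other. -/
theorem SimpleGraph.Subgraph.IsMatching.eq_of_adj {V : Type*} {G : SimpleGraph V}
    {M M' : G.Subgraph} (h : M.IsMatching) (h' : M'.IsMatching) (hv : M'.verts = M.verts)
    (hadj : ∀ {x y}, M.Adj x y → M'.Adj x y) : M' = M := by
  ext x y
  · rw [hv]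
  · refine ⟨fun hxy => ?_, hadj⟩
    obtain ⟨z, hz, -⟩ := h (hv ▸ M'.edge_vert hxy)
    rwa [h'.eq_of_adj_left hxy (hadj hz)]

variable {V : Type*} {G : SimpleGraph V} {side key : V → ℕ} {S : Set (V × V)}

theorem edgeSubgraph_isMatching (hS : ∀ e ∈ S, G.Adj e.1 e.2) (hk : KeyOrder G side key)
    (hs : ∀ e ∈ S, side e.1 = 0)
    (hc : ∀ e ∈ S, ∀ f ∈ S, e ≠ f → Precedes G key e f ∨ Precedes G key f e) :
    (edgeSubgraph G S hS).IsMatching := by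
  have inj1 : ∀ e ∈ S, ∀ f ∈ S, e.1 = f.1 → e = f := fun e he f hf h => by
    by_contra hne
    rcases hc e he f hf hne with h1 | h1
    · have := h1.1; rw [h] at this; omega
    · have := h1.1; rw [h] at this; omega
  have inj2 : ∀ e ∈ S, ∀ f ∈ S, e.2 = f.2 → e = f := fun e he f hf h => by
    by_contra hne
    rcases hc e he f hf hne with h1 | h1
    · have := h1.2.1; rw [h] at this; omega
    · have := h1.2.1; rw [h] at this; omega
  have hs2 : ∀ e ∈ S, side e.2 = 1 := fun e he => by
    have := hk.side_add (hS e he); have := hs e he; omega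
  rintro x ⟨e, he, rfl | rfl⟩
  · refine ⟨e.2, .inl he, ?_⟩
    rintro y (h | h)
    · exact congrArg Prod.snd (inj1 _ h _ he rfl)
    · have h1 := hs2 _ h
      have h2 := hs _ he
      simp only at h1
      omega
  · refine ⟨e.1, .inr he, ?_⟩
    rintro y (h | h)
    · have h1 := hs2 _ he
      have h2 := hs _ h
      simp only at h2
      omega
    · exact congrArg Prod.fst (inj2 _ h _ he rfl)

/-- A chain of edges is a uniquely restricted matching. -/
theorem edgeSubgraph_isUniquelyRestricted (hS : ∀ e ∈ S, G.Adj e.1 e.2) (hk : KeyOrder G side key)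
    (hs : ∀ e ∈ S, side e.1 = 0)
    (hc : ∀ e ∈ S, ∀ f ∈ S, e ≠ f → Precedes G key e f ∨ Precedes G key f e) :
    IsUniquelyRestricted (edgeSubgraph G S hS) := by
  have hm := edgeSubgraph_isMatching hS hk hs hc
  refine ⟨hm, fun M' hM' hv => hm.eq_of_adj hM' hv ?_⟩
  have hs2 : ∀ e ∈ S, side e.2 = 1 := fun e he => by
    have := hk.side_add (hS e he); have := hs e he; omega
  -- Induction along the chain: once all earlier edges are known to belong to `M'`, the partners of
  -- `e.1` and `e.2` in `M'` are ends of edges `f`, `g` that are not before `e`.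
  suffices ∀ (k : ℕ) (e : V × V), key e.1 = k → e ∈ S → M'.Adj e.1 e.2 by
    rintro x y (h | h)
    · exact this _ _ rfl h
    · exact (this _ _ rfl h).symm
  intro k
  induction k using Nat.strong_induction_on with
  | _ k ih =>
  intro e hek he
  obtain ⟨w, hw, -⟩ := hM' (show e.1 ∈ M'.verts from hv ▸ ⟨e, he, .inl rfl⟩)
  obtain ⟨x, hx, -⟩ := hM' (show e.2 ∈ M'.verts from hv ▸ ⟨e, he, .inr rfl⟩)
  have sw := hk.side_add hw.adj_sub
  have sx := hk.side_add hx.adj_sub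
  have s1 := hs e he
  have s2 := hs2 e he
  obtain ⟨f, hf, hfw⟩ : ∃ f ∈ S, w = f.2 := by
    obtain ⟨f, hf, rfl | rfl⟩ := hv ▸ M'.edge_vert hw.symm
    · have := hs f hf; omega
    · exact ⟨f, hf, rfl⟩
  obtain ⟨g, hg, hgx⟩ : ∃ g ∈ S, x = g.1 := by
    obtain ⟨g, hg, rfl | rfl⟩ := hv ▸ M'.edge_vert hx.symm
    · exact ⟨g, hg, rfl⟩
    · have := hs2 g hg; omega
  subst hfw hgx
  by_cases hfe : f = e
  · rwa [hfe] at hw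
  by_cases hge : g = e
  · rw [hge] at hx; exact hx.symm
  exfalso
  have hef : Precedes G key e f := by
    refine (hc f hf e he hfe).resolve_left fun h => hfe ?_
    have h1 := ih _ (by have := h.1; omega) f rfl hf
    have h2 := hM'.eq_of_adj_right h1 hw
    by_contra hne
    have := h.1
    rw [h2] at this
    omega
  have heg : Precedes G key e g := by
    refine (hc g hg e he hge).resolve_left fun h => hge ?_
    have h1 := ih _ (by have := h.1; omega) g rfl hg
    have h2 := hM'.eq_of_adj_left h1 hx.symm
    have := h.2.1
    rw [h2] at this
    omega
  have aef := hw.adj_sub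
  have age := hx.adj_sub.symm
  -- Whichever of `f`, `g` is earlier spans a four-cycle with `e`: the missing fourth edge arises by
  -- uncrossing that earlier edge with the `M'`-edge that joins `e` to the other one.
  by_cases hfg : key f.1 ≤ key g.1
  · exact hef.2.2 ⟨aef, (hk.cross ((hs f hf).trans (hs g hg).symm) hfg hef.2.1.le (hS f hf) age).1⟩
  · refine heg.2.2 ⟨(hk.cross (s1.trans (hs g hg).symm) heg.1.le ?_ aef (hS g hg)).1, age⟩
    rcases hc f hf g hg (fun h => hfg (by rw [h])) with h | h
    · exact absurd h.1.le hfg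
    · exact h.2.1.le

/-- Exchanging the partners in two edges of a matching. -/
theorem IsUniquelyRestricted.not_swap {M : G.Subgraph} (h : IsUniquelyRestricted M) {a b a' b' : V}
    (h1 : M.Adj a b) (h2 : M.Adj a' b') (hne : a ≠ a') (hne' : a ≠ b') (e1 : G.Adj a b')
    (e2 : G.Adj a' b) : False := by
  classical
  have hm := h.1
  have n1 : b ≠ b' := fun e => hne (hm.eq_of_adj_right h1 (e ▸ h2))
  have n2 : a' ≠ b := fun e => hne' (hm.eq_of_adj_right h1 (e ▸ h2.symm))
  have n3 := h1.ne
  have n4 := h2.ne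
  let M' : G.Subgraph :=
    { verts := M.verts
      Adj := fun x y => (x = a ∧ y = b') ∨ (x = b' ∧ y = a) ∨ (x = a' ∧ y = b) ∨
        (x = b ∧ y = a') ∨ (M.Adj x y ∧ x ≠ a ∧ x ≠ b ∧ x ≠ a' ∧ x ≠ b')
      adj_sub := by
        rintro x y (⟨rfl, rfl⟩ | ⟨rfl, rfl⟩ | ⟨rfl, rfl⟩ | ⟨rfl, rfl⟩ | ⟨h, -⟩)
        exacts [e1, e1.symm, e2, e2.symm, h.adj_sub]
      edge_vert := by
        rintro x y (⟨rfl, rfl⟩ | ⟨rfl, rfl⟩ | ⟨rfl, rfl⟩ | ⟨rfl, rfl⟩ | ⟨h, -⟩)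
        exacts [M.edge_vert h1, M.edge_vert h2.symm, M.edge_vert h2, M.edge_vert h1.symm,
          M.edge_vert h]
      symm := ⟨by
        rintro x y (h | h | h | h | ⟨h, hx1, hx2, hx3, hx4⟩)
        · exact .inr (.inl h.symm)
        · exact .inl h.symm
        · exact .inr (.inr (.inr (.inl h.symm)))
        · exact .inr (.inr (.inl h.symm))
        · refine .inr (.inr (.inr (.inr ⟨h.symm, ?_, ?_, ?_, ?_⟩))) <;> rintro rfl
          · exact hx2 (hm.eq_of_adj_left h.symm h1)
          · exact hx1 (hm.eq_of_adj_left h.symm h1.symm)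
          · exact hx4 (hm.eq_of_adj_left h.symm h2)
          · exact hx3 (hm.eq_of_adj_left h.symm h2.symm)⟩ }
  have hM' : M'.IsMatching := by
    intro x hx
    by_cases hxa : x = a
    · subst hxa
      refine ⟨b', .inl ⟨rfl, rfl⟩, ?_⟩
      rintro y (h | h | h | h | h) <;> simp_all
    by_cases hxb : x = b
    · subst hxb
      refine ⟨a', .inr (.inr (.inr (.inl ⟨rfl, rfl⟩))), ?_⟩
      rintro y (h | h | h | h | h) <;> simp_all
    by_cases hxa' : x = a'
    · subst hxa'
      refine ⟨b, .inr (.inr (.inl ⟨rfl, rfl⟩)), ?_⟩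
      rintro y (h | h | h | h | h) <;> simp_all
    by_cases hxb' : x = b'
    · subst hxb'
      refine ⟨a, .inr (.inl ⟨rfl, rfl⟩), ?_⟩
      rintro y (h | h | h | h | h) <;> simp_all
    obtain ⟨y, hy, -⟩ := hm hx
    refine ⟨y, .inr (.inr (.inr (.inr ⟨hy, hxa, hxb, hxa', hxb'⟩))), ?_⟩
    rintro z (⟨h, -⟩ | ⟨h, -⟩ | ⟨h, -⟩ | ⟨h, -⟩ | ⟨h, -⟩)
    exacts [absurd h hxa, absurd h hxb', absurd h hxa', absurd h hxb, hm.eq_of_adj_left h hy]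
  have := h.2 M' hM' rfl
  have h3 : M.Adj a b' := this ▸ .inl ⟨rfl, rfl⟩
  exact n1 (hm.eq_of_adj_left h1 h3)

/-- Two edges of a uniquely restricted matching are comparable. -/
theorem IsUniquelyRestricted.precedes {M : G.Subgraph} (h : IsUniquelyRestricted M)
    (hk : KeyOrder G side key) {e f : V × V} (he : M.Adj e.1 e.2) (hf : M.Adj f.1 f.2)
    (hse : side e.1 = 0) (hsf : side f.1 = 0) (hne : e ≠ f) :
    Precedes G key e f ∨ Precedes G key f e := by
  have s1 := hk.side_add he.adj_sub
  have s2 := hk.side_add hf.adj_sub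
  have hne1 : e.1 ≠ f.1 := fun h1 => hne (Prod.ext h1 (h.1.eq_of_adj_left he (h1 ▸ hf)))
  have hne2 : e.1 ≠ f.2 := fun h1 => by rw [h1] at hse; omega
  have hsw : ¬ (G.Adj e.1 f.2 ∧ G.Adj f.1 e.2) := fun ⟨h1, h2⟩ =>
    h.not_swap he hf hne1 hne2 h1 h2
  by_cases c1 : key e.1 ≤ key f.1
  · by_cases c2 : key f.2 ≤ key e.2
    · have := hk.cross (hse.trans hsf.symm) c1 c2 he.adj_sub hf.adj_sub
      exact absurd this hsw
    · refine .inl ⟨c1.lt_of_ne fun h1 => hsw ?_, by omega, hsw⟩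
      have := hk.cross (hsf.trans hse.symm) h1.ge (by omega) hf.adj_sub he.adj_sub
      exact ⟨this.2, this.1⟩
  · by_cases c2 : key e.2 ≤ key f.2
    · have := hk.cross (hsf.trans hse.symm) (by omega) c2 hf.adj_sub he.adj_sub
      exact absurd ⟨this.2, this.1⟩ hsw
    · exact .inr ⟨by omega, by omega, fun h1 => hsw ⟨h1.2, h1.1⟩⟩

/-- Uncrossing the two cross edges of a four-cycle on `e`, `g` against the middle edge `f` gives a
four-cycle on `e`, `f`. -/
theorem Precedes.trans (hk : KeyOrder G side key) {e f g : V × V} (he : side e.1 = 0)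
    (hf : side f.1 = 0) (hg : side g.1 = 0) (hfa : G.Adj f.1 f.2) (h1 : Precedes G key e f)
    (h2 : Precedes G key f g) : Precedes G key e g := by
  refine ⟨h1.1.trans h2.1, h1.2.1.trans h2.2.1, fun ⟨h3, h4⟩ => h1.2.2 ⟨?_, ?_⟩⟩
  · exact (hk.cross (he.trans hf.symm) h1.1.le h2.2.1.le h3 hfa).1
  · exact (hk.cross (hf.trans hg.symm) h2.1.le h1.2.1.le hfa h4).1

end Chains

/-! ### Longest chains by a greedy search with two candidates -/

section Fronts

/-- What the scan computes: for each key with a neighbour its extreme neighbours `hi` and `lo`, the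
next key `suc` on the same side, and the next key `nw` on the same side with a larger `hi`. The
number `K` stands for a missing key. -/
structure Tables (E : SimpleGraph ℕ) (sd : ℕ → ℕ) (K : ℕ) (hi lo suc nw : ℕ → ℕ) : Prop where
  order : KeyOrder E sd id
  lt : ∀ {k l}, E.Adj k l → k < K
  hi_adj : ∀ {k l}, E.Adj k l → E.Adj k (hi k)
  le_hi : ∀ {k l}, E.Adj k l → l ≤ hi k
  lo_adj : ∀ {k l}, E.Adj k l → E.Adj k (lo k)
  lo_le : ∀ {k l}, E.Adj k l → lo k ≤ l
  suc_cases : ∀ {k l}, E.Adj k l →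
    suc k = K ∨ k < suc k ∧ sd (suc k) = sd k ∧ ∃ l', E.Adj (suc k) l'
  suc_le : ∀ {k l k' l'}, E.Adj k l → E.Adj k' l' → sd k' = sd k → k < k' → suc k ≤ k'
  nw_cases : ∀ {k l}, E.Adj k l →
    nw k = K ∨ k < nw k ∧ sd (nw k) = sd k ∧ hi k < hi (nw k) ∧ ∃ l', E.Adj (nw k) l'
  nw_le : ∀ {k l k' l'}, E.Adj k l → E.Adj k' l' → sd k' = sd k → k < k' → hi k < hi k' → nw k ≤ k'
  lo_top : lo K = K

/-- The partner of `nw k` in the least edge above `k` and `hi k`. -/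
def partner (hi lo suc nw : ℕ → ℕ) (k : ℕ) : ℕ :=
  if hi k < lo (nw k) then lo (nw k) else suc (hi k)

/-- Two candidates for the last edge of a chain: `(pa, pb)` and `(qa, qb)`. -/
structure Front where
  pa : ℕ
  pb : ℕ
  qa : ℕ
  qb : ℕ

/-- The least first end of a candidate. -/
def Front.al (s : Front) : ℕ := min s.pa s.qa

/-- The least second end of a candidate. -/
def Front.be (s : Front) : ℕ := min s.pb s.qb

/-- The candidates for chains with one more edge. -/
def Front.next (nw pt : ℕ → ℕ) (s : Front) : Front := ⟨nw s.al, pt s.al, pt s.be, nw s.be⟩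

/-- The candidates for chains with `t + 1` edges. -/
def front (nw pt : ℕ → ℕ) (a b : ℕ) : ℕ → Front
  | 0 => ⟨a, b, a, b⟩
  | t + 1 => (front nw pt a b t).next nw pt

/-- The candidate with the least first end if `f = 0`, and with the least second end otherwise. -/
def Front.pick (s : Front) (f : ℕ) : ℕ × ℕ :=
  if f = 0 then (if s.qa < s.pa then (s.qa, s.qb) else (s.pa, s.pb))
  else (if s.pb < s.qb then (s.pa, s.pb) else (s.qa, s.qb))

/-- Which end of the previous edge matters for the chosen candidate. -/
def Front.turn (s : Front) (f : ℕ) : ℕ :=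
  if f = 0 then (if s.qa < s.pa then 1 else 0) else (if s.pb < s.qb then 0 else 1)

/-- The chain with `t` edges found by going back through the candidates, last edge first. -/
def backtrack (F : ℕ → Front) : ℕ → ℕ → List (ℕ × ℕ)
  | 0, _ => []
  | t + 1, f => (F t).pick f :: backtrack F t ((F t).turn f)

theorem length_backtrack (F : ℕ → Front) (t f : ℕ) : (backtrack F t f).length = t := by
  induction t generalizing f with
  | zero => rfl
  | succ t ih => simp [backtrack, ih]

namespace Tables

variable {E : SimpleGraph ℕ} {sd : ℕ → ℕ} {K : ℕ} {hi lo suc nw : ℕ → ℕ}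

theorem hi_mono (h : Tables E sd K hi lo suc nw) {k l k' l' : ℕ} (hk : E.Adj k l)
    (hk' : E.Adj k' l') (hs : sd k = sd k') (hle : k ≤ k') : hi k ≤ hi k' := by
  by_contra hlt
  have := (h.order.cross hs hle (by simp only [id]; omega : id (hi k') ≤ id (hi k)) (h.hi_adj hk)
    (h.hi_adj hk')).2
  have := h.le_hi this
  omega

theorem lo_mono (h : Tables E sd K hi lo suc nw) {k l k' l' : ℕ} (hk : E.Adj k l)
    (hk' : E.Adj k' l') (hs : sd k = sd k') (hle : k ≤ k') : lo k ≤ lo k' := by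
  by_contra hlt
  have := (h.order.cross hs hle (by simp only [id]; omega : id (lo k') ≤ id (lo k)) (h.lo_adj hk)
    (h.lo_adj hk')).1
  have := h.lo_le this
  omega

/-- The neighbours of a key are consecutive on their side. -/
theorem adj_of_between (h : Tables E sd K hi lo suc nw) {k l z y : ℕ} (hk : E.Adj k l)
    (hz : E.Adj z y) (hs : sd z + sd k = 1) (h1 : lo k ≤ z) (h2 : z ≤ hi k) : E.Adj k z := by
  have := h.order.side_add hz
  rcases le_total y k with hy | hy
  · exact (h.order.cross (by omega : sd y = sd k) hy h1 hz.symm (h.lo_adj hk)).2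
  · exact (h.order.cross (by omega : sd k = sd y) hy h2 (h.hi_adj hk) hz.symm).1

/-- Since `y` exceeds `hi k`, so does `hi x`, which gives `nw k ≤ x`. The end `y` is at least `suc
(hi k)` and, as `lo` is monotone, at least `lo (nw k)`. -/
theorem partner_min (h : Tables E sd K hi lo suc nw) {k l x y : ℕ} (hk : E.Adj k l)
    (hxy : E.Adj x y) (hs : sd x = sd k) (hx : k < x) (hy : hi k < y) :
    nw k ≤ x ∧ partner hi lo suc nw k ≤ y := by
  have h1 : nw k ≤ x := h.nw_le hk hxy hs hx (hy.trans_le (h.le_hi hxy))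
  refine ⟨h1, ?_⟩
  have a1 := h.order.side_add (h.hi_adj hk)
  have a2 := h.order.side_add hxy
  rw [partner]
  split_ifs with h2
  · rcases h.nw_cases hk with h3 | ⟨-, h3, -, l', h4⟩
    · have := h.lt hxy; omega
    · exact (h.lo_mono h4 hxy (h3.trans hs.symm) h1).trans (h.lo_le hxy)
  · exact h.suc_le (h.hi_adj hk).symm hxy.symm (by omega) hy

/-- If `lo (nw k)` does not exceed `hi k`, then `suc (hi k)` lies between `lo (nw k)` and `hi (nw
k)`, hence is a neighbour because neighbourhoods are intervals of a side. The value `lo K = K` gives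
a missing key the missing partner. -/
theorem partner_cases (h : Tables E sd K hi lo suc nw) {k l : ℕ} (hk : E.Adj k l) :
    (nw k = K ∧ partner hi lo suc nw k = K) ∨
      E.Adj (nw k) (partner hi lo suc nw k) ∧ sd (nw k) = sd k ∧ k < nw k ∧
        hi k < partner hi lo suc nw k := by
  rcases h.nw_cases hk with h1 | ⟨h1, h2, h3, l', h4⟩
  · refine .inl ⟨h1, ?_⟩
    rw [partner, h1, h.lo_top, if_pos (h.lt (h.hi_adj hk).symm)]
  · refine .inr ⟨?_, h2, h1, ?_⟩
    · rw [partner]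
      split_ifs with h5
      · exact h.lo_adj h4
      · have a1 := h.order.side_add (h.hi_adj hk)
        have a2 := h.order.side_add (h.hi_adj h4)
        have h6 := h.suc_le (h.hi_adj hk).symm (h.hi_adj h4).symm (by omega) h3
        rcases h.suc_cases (h.hi_adj hk).symm with h7 | ⟨h7, h8, y, h9⟩
        · have := h.lt (h.hi_adj h4).symm; omega
        · exact h.adj_of_between h4 h9 (by omega) (by omega) h6
    · rw [partner]
      split_ifs with h5
      · exact h5
      · rcases h.suc_cases (h.hi_adj hk).symm with h7 | h7
        · rw [h7]; exact h.lt (h.hi_adj hk).symm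
        · exact h7.1

/-- The edge with the least ends, or `(K, K)` if there is no edge. -/
structure IsLeastEdge (E : SimpleGraph ℕ) (sd : ℕ → ℕ) (K a b : ℕ) : Prop where
  cases : (a = K ∧ b = K) ∨ E.Adj a b ∧ sd a = 0
  le : ∀ {x y}, E.Adj x y → sd x = 0 → a ≤ x ∧ b ≤ y

variable {a b : ℕ}

local notation "F" => front nw (partner hi lo suc nw) a b

/-- The two minima may come from different candidates and need not be adjacent; each is still a
non-isolated key of its side, which is all that the next level needs. -/
theorem classes_of_lt (h : Tables E sd K hi lo suc nw) {s : Front}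
    (hp : (s.pa = K ∧ s.pb = K) ∨ E.Adj s.pa s.pb ∧ sd s.pa = 0)
    (hq : (s.qa = K ∧ s.qb = K) ∨ E.Adj s.qa s.qb ∧ sd s.qa = 0) (hs : s.al < K) :
    (∃ y, E.Adj s.al y) ∧ (∃ x, E.Adj s.be x) ∧ sd s.al = 0 ∧ sd s.be = 1 := by
  simp only [Front.al, Front.be] at *
  have c : ∀ {x y}, E.Adj x y → x < K ∧ y < K ∧ sd x + sd y = 1 :=
    fun e => ⟨h.lt e, h.lt e.symm, h.order.side_add e⟩
  have good : ∀ {x y}, E.Adj x y → sd x = 0 →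
      (∃ y, E.Adj x y) ∧ (∃ x, E.Adj y x) ∧ sd x = 0 ∧ sd y = 1 :=
    fun e hx => ⟨⟨_, e⟩, ⟨_, e.symm⟩, hx, by have := c e; omega⟩
  rcases hp with ⟨p1, p2⟩ | ⟨p1, p2⟩ <;> rcases hq with ⟨q1, q2⟩ | ⟨q1, q2⟩
  · omega
  · have := c q1
    rw [min_eq_right (by omega), min_eq_right (by omega)]
    exact good q1 q2
  · have := c p1
    rw [min_eq_left (by omega), min_eq_left (by omega)]
    exact good p1 p2
  · have gp := good p1 p2
    have gq := good q1 q2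
    rcases min_choice s.pa s.qa with e1 | e1 <;> rcases min_choice s.pb s.qb with e2 | e2 <;>
      rw [e1, e2]
    exacts [gp, ⟨gp.1, gq.2.1, gp.2.2.1, gq.2.2.2⟩, ⟨gq.1, gp.2.1, gq.2.2.1, gp.2.2.2⟩, gq]

theorem front_cases (h : Tables E sd K hi lo suc nw) (h0 : IsLeastEdge E sd K a b) :
    ∀ t, (∀ i < t, (F i).al < K) →
      (((F t).pa = K ∧ (F t).pb = K) ∨ E.Adj (F t).pa (F t).pb ∧ sd (F t).pa = 0) ∧
      (((F t).qa = K ∧ (F t).qb = K) ∨ E.Adj (F t).qa (F t).qb ∧ sd (F t).qa = 0)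
  | 0, _ => ⟨h0.cases, h0.cases⟩
  | t + 1, ht => by
    obtain ⟨hp, hq⟩ := h.front_cases h0 t (fun i hi => ht i (by omega))
    obtain ⟨⟨y, hy⟩, ⟨x, hx⟩, s1, s2⟩ := h.classes_of_lt hp hq (ht t (by omega))
    refine ⟨?_, ?_⟩
    · rcases h.partner_cases hy with h1 | h1
      · exact .inl h1
      · exact .inr ⟨h1.1, h1.2.1.trans s1⟩
    · rcases h.partner_cases hx with h1 | h1
      · exact .inl ⟨h1.2, h1.1⟩
      · have := h.order.side_add h1.1
        exact .inr ⟨h1.1.symm, by change sd (partner hi lo suc nw (F t).be) = 0; omega⟩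

theorem pick_spec {s : Front} (hp : (s.pa = K ∧ s.pb = K) ∨ E.Adj s.pa s.pb ∧ sd s.pa = 0)
    (hq : (s.qa = K ∧ s.qb = K) ∨ E.Adj s.qa s.qb ∧ sd s.qa = 0)
    (h : Tables E sd K hi lo suc nw) (hs : s.al < K) (f : ℕ) :
    E.Adj (s.pick f).1 (s.pick f).2 ∧ sd (s.pick f).1 = 0 ∧ (f = 0 → (s.pick f).1 = s.al) ∧
      (f ≠ 0 → (s.pick f).2 = s.be) ∧
      ((s.turn f = 0 ∧ s.pick f = (s.pa, s.pb)) ∨ (s.turn f ≠ 0 ∧ s.pick f = (s.qa, s.qb))) := by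
  have c1 : E.Adj s.pa s.pb → s.pa < K ∧ s.pb < K := fun e => ⟨h.lt e, h.lt e.symm⟩
  have c2 : E.Adj s.qa s.qb → s.qa < K ∧ s.qb < K := fun e => ⟨h.lt e, h.lt e.symm⟩
  simp only [Front.al, Front.be, Front.pick, Front.turn] at *
  split_ifs with h1 h2 h2
  all_goals
    simp only [h1, not_true_eq_false, not_false_eq_true, true_and, ne_eq, one_ne_zero, false_and,
      or_false, false_or, true_implies, false_implies, and_true]
  · rcases hq with hq | hq
    · rcases hp with hp | hp
      · omega
      · have := c1 hp.1; omega
    · exact ⟨hq.1, hq.2, by omega⟩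
  · rcases hp with hp | hp
    · omega
    · exact ⟨hp.1, hp.2, by omega⟩
  · rcases hp with hp | hp
    · rcases hq with hq | hq
      · omega
      · have := c2 hq.1; omega
    · exact ⟨hp.1, hp.2, by omega⟩
  · rcases hq with hq | hq
    · rcases hp with hp | hp
      · omega
      · have := c1 hp.1; omega
    · exact ⟨hq.1, hq.2, by omega⟩

theorem precedes_of_lt (h : Tables E sd K hi lo suc nw) {e f : ℕ × ℕ} (he : E.Adj e.1 e.2)
    (h1 : e.1 < f.1) (h2 : hi e.1 < f.2) : Precedes E id e f :=
  ⟨h1, (h.le_hi he).trans_lt h2, fun h3 => by have := h.le_hi h3.1; omega⟩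

theorem precedes_of_lt' (h : Tables E sd K hi lo suc nw) {e f : ℕ × ℕ} (he : E.Adj e.1 e.2)
    (h1 : e.2 < f.2) (h2 : hi e.2 < f.1) : Precedes E id e f :=
  ⟨(h.le_hi he.symm).trans_lt h2, h1, fun h3 => by have := h.le_hi h3.2.symm; omega⟩

/-- If `f.2 ≤ hi e.1` and `f.1 ≤ hi e.2`, then uncrossing `f` with the edges to these extreme
neighbours gives both remaining edges of a four-cycle. This dichotomy is why two candidates are
kept. -/
theorem lt_of_precedes (h : Tables E sd K hi lo suc nw) {e f : ℕ × ℕ} (he : E.Adj e.1 e.2)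
    (hf : E.Adj f.1 f.2) (hs : sd e.1 = sd f.1) (hp : Precedes E id e f) :
    (e.1 < f.1 ∧ hi e.1 < f.2) ∨ (e.2 < f.2 ∧ hi e.2 < f.1) := by
  by_contra hcon
  have h1 : e.1 < f.1 := hp.1
  have h2 : e.2 < f.2 := hp.2.1
  have s1 := h.order.side_add he
  have s2 := h.order.side_add hf
  refine hp.2.2 ⟨?_, ?_⟩
  · exact (h.order.cross hs h1.le (by simp only [id]; omega : id f.2 ≤ id (hi e.1))
      (h.hi_adj he) hf).1
  · exact (h.order.cross (by omega : sd e.2 = sd f.2) h2.le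
      (by simp only [id]; omega : id f.1 ≤ id (hi e.2)) (h.hi_adj he.symm) hf.symm).1.symm

theorem backtrack_spec (h : Tables E sd K hi lo suc nw) (h0 : IsLeastEdge E sd K a b) :
    ∀ t f, (∀ i < t, (F i).al < K) →
      (∀ e ∈ backtrack F t f, E.Adj e.1 e.2 ∧ sd e.1 = 0) ∧
      (backtrack F t f).Pairwise (fun e e' => Precedes E id e' e)
  | 0, _, _ => by simp [backtrack]
  | t + 1, f, ht => by
    have ht' : ∀ i < t, (F i).al < K := fun i hi => ht i (by omega)
    obtain ⟨hp, hq⟩ := h.front_cases h0 t ht'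
    obtain ⟨p1, p2, p3, p4, p5⟩ := pick_spec hp hq h (ht t (by omega)) f
    obtain ⟨h1, h2⟩ := h.backtrack_spec h0 t ((F t).turn f) ht'
    simp only [backtrack, List.mem_cons, List.pairwise_cons, forall_eq_or_imp]
    refine ⟨⟨⟨p1, p2⟩, h1⟩, ?_, h2⟩
    cases t with
    | zero => simp [backtrack]
    | succ t =>
      simp only [backtrack, List.mem_cons, List.pairwise_cons, forall_eq_or_imp] at h1 h2 ⊢
      obtain ⟨hp', hq'⟩ := h.front_cases h0 t (fun i hi => ht i (by omega))
      obtain ⟨q1, q2, q3, q4, -⟩ := pick_spec hp' hq' h (ht t (by omega)) ((F (t + 1)).turn f)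
      obtain ⟨⟨y, hy⟩, ⟨x, hx⟩, s1, s2⟩ := h.classes_of_lt hp' hq' (ht t (by omega))
      -- `turn` records which end of the previous edge produced the chosen candidate, and the
      -- previous `pick` minimizes exactly that end.
      have first : Precedes E id ((F t).pick ((F (t + 1)).turn f)) ((F (t + 1)).pick f) := by
        rcases p5 with ⟨e1, e2⟩ | ⟨e1, e2⟩
        · have e3 := q3 e1
          have hc := h.partner_cases hy
          rw [e2] at p1 ⊢
          refine h.precedes_of_lt q1 ?_ ?_ <;> rw [e3]
          · exact (hc.resolve_left fun hc => absurd (h.lt p1) (by simp [front, Front.next, hc.1])).2.2.1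
          · exact (hc.resolve_left fun hc => absurd (h.lt p1) (by simp [front, Front.next, hc.1])).2.2.2
        · have e3 := q4 e1
          have hc := h.partner_cases hx
          rw [e2] at p1 ⊢
          refine h.precedes_of_lt' q1 ?_ ?_ <;> rw [e3]
          · exact (hc.resolve_left fun hc => absurd (h.lt p1.symm)
              (by simp [front, Front.next, hc.1])).2.2.1
          · exact (hc.resolve_left fun hc => absurd (h.lt p1.symm)
              (by simp [front, Front.next, hc.1])).2.2.2
      exact ⟨first, fun e he => Precedes.trans h.order (h1.2 e he).2 h1.1.2 p2 h1.1.1 (h2.1 e he) first⟩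

/-- The greedy search stays ahead: by induction both ends of the last edge of a chain with `k + 1`
edges are bounded below by `al` and `be` at level `k`. The two bounds are separate, so they survive
even if no single candidate attains both. -/
theorem card_le (h : Tables E sd K hi lo suc nw) (h0 : IsLeastEdge E sd K a b) {N : ℕ}
    (hN : ∀ i < N, (F i).al < K) (hN' : K ≤ (F N).al) :
    ∀ (k : ℕ) (T : Finset (ℕ × ℕ)), T.card = k + 1 → (∀ e ∈ T, E.Adj e.1 e.2 ∧ sd e.1 = 0) →
      (∀ e ∈ T, ∀ f ∈ T, e ≠ f → Precedes E id e f ∨ Precedes E id f e) →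
      k < N ∧ ∃ e ∈ T, (∀ f ∈ T, f.1 ≤ e.1) ∧ (F k).al ≤ e.1 ∧ (F k).be ≤ e.2
  | 0, T, hT, hE, hC => by
    obtain ⟨e, rfl⟩ := Finset.card_eq_one.1 hT
    obtain ⟨h1, h2⟩ := hE e (by simp)
    have := h0.le h1 h2
    refine ⟨?_, e, by simp, by simp, by simpa [front, Front.al] using this.1,
      by simpa [front, Front.be] using this.2⟩
    by_contra hlt
    obtain rfl : N = 0 := by omega
    have := h.lt h1
    simp only [front, Front.al, min_self] at hN'
    omega
  | k + 1, T, hT, hE, hC => by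
    classical
    obtain ⟨e, he, hmax⟩ := T.exists_max_image Prod.fst (Finset.card_pos.1 (by omega))
    obtain ⟨hk, e', he', -, h1, h2⟩ := h.card_le h0 hN hN' k (T.erase e)
      (by rw [Finset.card_erase_of_mem he]; omega)
      (fun f hf => hE f (Finset.mem_of_mem_erase hf))
      (fun f hf g hg => hC f (Finset.mem_of_mem_erase hf) g (Finset.mem_of_mem_erase hg))
    have hne := Finset.ne_of_mem_erase he'
    have he' := Finset.mem_of_mem_erase he'
    have hp : Precedes E id e' e := (hC e' he' e he hne).resolve_right fun h3 => by
      have := h3.1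
      have := hmax e' he'
      simp only [id] at *
      omega
    obtain ⟨a1, a2⟩ := hE e' he'
    obtain ⟨b1, b2⟩ := hE e he
    have s1 := h.order.side_add a1
    have s2 := h.order.side_add b1
    obtain ⟨hp1, hq1⟩ := h.front_cases h0 k (fun i hi => hN i (by omega))
    obtain ⟨⟨y, hy⟩, ⟨x, hx⟩, s3, s4⟩ := h.classes_of_lt hp1 hq1 (hN k hk)
    -- Monotonicity of `hi` replaces the relevant end of `e'` by the smaller `al` or `be`, so that
    -- `e` competes with the least edge beyond it.
    have hle : (F (k + 1)).al ≤ e.1 ∧ (F (k + 1)).be ≤ e.2 := by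
      rcases h.lt_of_precedes a1 b1 (a2.trans b2.symm) hp with ⟨h3, h4⟩ | ⟨h3, h4⟩
      · have := h.partner_min hy b1 (by omega) (h1.trans_lt h3)
          ((h.hi_mono hy a1 (by omega) h1).trans_lt h4)
        exact ⟨(min_le_left _ _).trans this.1, (min_le_left _ _).trans this.2⟩
      · have := h.partner_min hx b1.symm (by omega) (h2.trans_lt h3)
          ((h.hi_mono hx a1.symm (by omega) h2).trans_lt h4)
        exact ⟨(min_le_right _ _).trans this.2, (min_le_right _ _).trans this.1⟩
    refine ⟨?_, e, he, hmax, hle⟩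
    by_contra hlt
    obtain rfl : N = k + 1 := by omega
    have := h.lt b1
    have := hle.1
    omega

end Tables

end Fronts

/-! ## Reasoning about programs -/

namespace RAM

theorem State.setReg_reg (s : State) (r v r' : ℕ) :
    (s.setReg r v).reg r' = if r' = r then v else s.reg r' := Function.update_apply ..

theorem State.setReg_mem (s : State) (r v : ℕ) : (s.setReg r v).mem = s.mem := rfl

theorem State.setMem_reg (s : State) (k i v : ℕ) : (s.setMem k i v).reg = s.reg := rfl

theorem State.setMem_mem (s : State) (k i v k' : ℕ) :
    (s.setMem k i v).mem k' = if k' = k then Function.update (s.mem k) i v else s.mem k' :=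
  Function.update_apply ..

theorem Exec.mono {W W' : ℕ} (hW : W ≤ W') {p : Prog} {s s' : State} {t : ℕ}
    (h : Exec W p s t s') : Exec W' p s t s' := by
  induction h with
  | skip s => exact .skip s
  | assign s r e hf => exact .assign s r e (hf.trans_le hW)
  | store s k i a => exact .store s k i a
  | seq _ _ h1 h2 => exact .seq h1 h2
  | ite_true ht _ h => exact .ite_true ht h
  | ite_false ht _ h => exact .ite_false ht h
  | loop_true ht _ _ h1 h2 => exact .loop_true ht h1 h2
  | loop_false ht => exact .loop_false ht

/-- With words that are long enough, `p` started in `s` halts with a running time and a final state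
that satisfy `Q`. -/
def Runs (p : Prog) (s : State) (Q : ℕ → State → Prop) : Prop :=
  ∃ W t s', Exec W p s t s' ∧ Q t s'

theorem Runs.mono {p : Prog} {s : State} {Q Q' : ℕ → State → Prop} (h : Runs p s Q)
    (hQ : ∀ t s', Q t s' → Q' t s') : Runs p s Q' := by
  obtain ⟨W, t, s', he, hq⟩ := h
  exact ⟨W, t, s', he, hQ _ _ hq⟩

theorem runs_skip {s : State} {Q : ℕ → State → Prop} : Runs .skip s Q ↔ Q 1 s := by
  constructor
  · rintro ⟨W, t, s', he, hq⟩; cases he; exact hq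
  · exact fun h => ⟨0, 1, s, .skip s, h⟩

theorem runs_assign {r : ℕ} {e : Rhs} {s : State} {Q : ℕ → State → Prop} :
    Runs (.assign r e) s Q ↔ Q 1 (s.setReg r (e.value s)) := by
  constructor
  · rintro ⟨W, t, s', he, hq⟩; cases he; exact hq
  · exact fun h => ⟨_, 1, _, .assign s r e (Nat.lt_succ_self _), h⟩

theorem runs_store {k i a : ℕ} {s : State} {Q : ℕ → State → Prop} :
    Runs (.store k i a) s Q ↔ Q 1 (s.setMem k (s.reg i) (s.reg a)) := by
  constructor
  · rintro ⟨W, t, s', he, hq⟩; cases he; exact hq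
  · exact fun h => ⟨0, 1, _, .store s k i a, h⟩

theorem runs_seq {p q : Prog} {s : State} {Q : ℕ → State → Prop} :
    Runs (.seq p q) s Q ↔ Runs p s fun t s' => Runs q s' fun t' s'' => Q (t + t') s'' := by
  constructor
  · rintro ⟨W, t, s', he, hq⟩
    cases he with
    | seq h1 h2 => exact ⟨W, _, _, h1, W, _, _, h2, hq⟩
  · rintro ⟨W, t, s', h1, W', t', s'', h2, hq⟩
    exact ⟨max W W', _, _, .seq (h1.mono (le_max_left _ _)) (h2.mono (le_max_right _ _)), hq⟩

theorem runs_ite {a b : ℕ} {p q : Prog} {s : State} {Q : ℕ → State → Prop} :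
    Runs (.ite a b p q) s Q ↔ (s.reg a < s.reg b → Runs p s fun t => Q (1 + t)) ∧
      (¬ s.reg a < s.reg b → Runs q s fun t => Q (1 + t)) := by
  constructor
  · rintro ⟨W, t, s', he, hq⟩
    cases he with
    | ite_true h h1 => exact ⟨fun _ => ⟨W, _, _, h1, hq⟩, fun h2 => absurd h h2⟩
    | ite_false h h1 => exact ⟨fun h2 => absurd h2 h, fun _ => ⟨W, _, _, h1, hq⟩⟩
  · rintro ⟨h1, h2⟩
    by_cases h : s.reg a < s.reg b
    · obtain ⟨W, t, s', he, hq⟩ := h1 h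
      exact ⟨W, _, _, .ite_true h he, hq⟩
    · obtain ⟨W, t, s', he, hq⟩ := h2 h
      exact ⟨W, _, _, .ite_false h he, hq⟩

/-- The loop rule: `Inv φ s` is an invariant, in which `φ` bounds the remaining time. -/
theorem runs_loop {a b : ℕ} {p : Prog} (Inv : ℕ → State → Prop)
    (hbody : ∀ φ s, Inv φ s → s.reg a < s.reg b →
      Runs p s fun t s' => ∃ φ', Inv φ' s' ∧ t + 1 + φ' ≤ φ) :
    ∀ (φ : ℕ) (s : State), Inv φ s →
      Runs (.loop a b p) s fun t s' => ∃ φ', Inv φ' s' ∧ ¬ s'.reg a < s'.reg b ∧ t + φ' ≤ φ + 1 := by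
  intro φ
  induction φ using Nat.strong_induction_on with
  | _ φ ih =>
  intro s hs
  by_cases h : s.reg a < s.reg b
  · obtain ⟨W, t, s', he, φ', hi, ht⟩ := hbody φ s hs h
    obtain ⟨W', t', s'', he', φ'', hi', hn, ht'⟩ := ih φ' (by omega) s' hi
    exact ⟨max W W', _, _, .loop_true h (he.mono (le_max_left _ _)) (he'.mono (le_max_right _ _)),
      φ'', hi', hn, by omega⟩
  · exact ⟨0, _, _, .loop_false h, φ, hs, h, by omega⟩

/-- The only constants are at most `4`, the only additions are those of register `1`, and register
`1` is never changed. -/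
def Incremental : Prog → Prop
  | .skip => True
  | .assign r e => r ≠ 1 ∧ match e with
    | .const c => c ≤ 4
    | .add _ b => b = 1
    | _ => True
  | .store _ _ _ => True
  | .seq p q => Incremental p ∧ Incremental q
  | .ite _ _ p q => Incremental p ∧ Incremental q
  | .loop _ _ p => Incremental p

/-- All numbers in the state are at most `V`. -/
def State.Bounded (V : ℕ) (s : State) : Prop :=
  s.reg 1 ≤ 1 ∧ (∀ r, s.reg r ≤ V) ∧ ∀ k i, s.mem k i ≤ V

/-- Additions add at most `1` and constants are at most `4`, so a step raises the largest number in
the state by at most one. Running time thus controls word length, and `Runs` may ignore words. -/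
theorem Exec.bounded {W : ℕ} {p : Prog} {s s' : State} {t : ℕ} (h : Exec W p s t s') :
    ∀ {V : ℕ}, Incremental p → 4 ≤ V → s.Bounded V →
      Exec (V + t + 1) p s t s' ∧ s'.Bounded (V + t) := by
  induction h with
  | skip s =>
    exact fun _ _ hs => ⟨.skip s, hs.1, fun r => (hs.2.1 r).trans (by omega),
      fun k i => (hs.2.2 k i).trans (by omega)⟩
  | assign s r e hf =>
    intro V hp hV hs
    have hv : e.value s ≤ V + 1 := by
      have h1 := hs.2.1
      have h2 := hs.2.2
      cases e with
      | const c => have := hp.2; simp only [Rhs.value] at *; omega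
      | copy a => have := h1 a; simp only [Rhs.value]; omega
      | add a b =>
        obtain rfl : b = 1 := hp.2
        have := h1 a; have := hs.1; simp only [Rhs.value]; omega
      | sub a b => have := h1 a; simp only [Rhs.value]; omega
      | load k a => have := h2 k (s.reg a); simp only [Rhs.value]; omega
    refine ⟨.assign s r e (by omega), ?_, fun r' => ?_, fun k i => ?_⟩
    · rw [State.setReg_reg, if_neg (Ne.symm hp.1)]; exact hs.1
    · rw [State.setReg_reg]
      split_ifs
      · exact hv
      · have := hs.2.1 r'; omega
    · have := hs.2.2 k i; simp only [State.setReg_mem]; omega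
  | store s k i a =>
    intro V hp hV hs
    refine ⟨.store s k i a, hs.1, fun r => (hs.2.1 r).trans (by omega), fun k' i' => ?_⟩
    rw [State.setMem_mem]
    have h1 := hs.2.1 a
    split_ifs with h
    · rw [Function.update_apply]
      split_ifs
      · omega
      · have := hs.2.2 k i'; omega
    · have := hs.2.2 k' i'; omega
  | seq h1 h2 ih1 ih2 =>
    intro V hp hV hs
    obtain ⟨e1, b1⟩ := ih1 hp.1 hV hs
    obtain ⟨e2, b2⟩ := ih2 hp.2 (by omega) b1
    rw [← add_assoc]
    exact ⟨.seq (e1.mono (by omega)) e2, b2⟩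
  | ite_true ht h ih =>
    intro V hp hV hs
    obtain ⟨e1, b1⟩ := ih hp.1 hV hs
    exact ⟨.ite_true ht (e1.mono (by omega)), b1.1, fun r => (b1.2.1 r).trans (by omega),
      fun k i => (b1.2.2 k i).trans (by omega)⟩
  | ite_false ht h ih =>
    intro V hp hV hs
    obtain ⟨e1, b1⟩ := ih hp.2 hV hs
    exact ⟨.ite_false ht (e1.mono (by omega)), b1.1, fun r => (b1.2.1 r).trans (by omega),
      fun k i => (b1.2.2 k i).trans (by omega)⟩
  | loop_true ht h1 h2 ih1 ih2 =>
    intro V hp hV hs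
    obtain ⟨e1, b1⟩ := ih1 hp hV hs
    obtain ⟨e2, b2⟩ := ih2 hp (by omega) b1
    exact ⟨.loop_true ht (e1.mono (by omega)) (e2.mono (by omega)), b2.1,
      fun r => (b2.2.1 r).trans (by omega), fun k i => (b2.2.2 k i).trans (by omega)⟩
  | loop_false ht =>
    exact fun _ _ hs => ⟨.loop_false ht, hs.1, fun r => (hs.2.1 r).trans (by omega),
      fun k i => (hs.2.2 k i).trans (by omega)⟩

end RAM

/-! ## Breadth first search -/

section BFS

open Function (update update_self update_of_ne update_apply)

/-- `r` was taken from the list `cand`, when everything reached before had been completed. -/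
structure IsBFSRoot (H : SimpleGraph ℕ) (cand : ℕ → ℕ) (nc : ℕ) (lab side : ℕ → ℕ) (head r : ℕ) :
    Prop where
  adj : ∃ w, H.Adj r w
  lab_ne : lab r ≠ 0
  side_eq : side r = 0
  lab_le : lab r ≤ head
  unique : ∀ w, lab w = lab r → w = r
  closed : ∀ u v, H.Adj u v → lab u ≠ 0 → lab u < lab r → lab v ≠ 0 ∧ lab v < lab r
  first : ∃ i < nc, cand i = r + 1 ∧
    ∀ j < nc, i < j → ∀ v, cand j = v + 1 → lab v ≠ 0 ∧ lab v < lab r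

/-- The invariant of the breadth first search with the queue `q`, whose cells from `1` up to
`head` have been processed and whose cells up to `tail` have been filled. The label of a vertex is
the position in the queue of the first vertex of its layer, and `lb` is the label of the layer that
is being filled. -/
structure Core (H : SimpleGraph ℕ) (cand : ℕ → ℕ) (nc : ℕ) (lab side q : ℕ → ℕ)
    (head tail lb : ℕ) : Prop where
  one_le : 1 ≤ head
  head_le : head ≤ lb
  lb_le : lb ≤ tail
  q_lab : ∀ i, 1 ≤ i → i < tail → lab (q i) ≠ 0
  q_adj : ∀ i, 1 ≤ i → i < tail → ∃ w, H.Adj (q i) w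
  q_inj : ∀ i j, 1 ≤ i → i < tail → 1 ≤ j → j < tail → q i = q j → i = j
  q_surj : ∀ v, lab v ≠ 0 → ∃ i, 1 ≤ i ∧ i < tail ∧ q i = v
  lab_lt : ∀ i j, 1 ≤ i → i < tail → 1 ≤ j → j < tail → (lab (q i) < lab (q j) ↔ i < lab (q j))
  lab_le : ∀ i, 1 ≤ i → i < tail → lab (q i) ≤ lb
  lab_eq : ∀ i, 1 ≤ i → i < tail → (lab (q i) = lb ↔ lb ≤ i)
  cur : ∀ i, 1 ≤ i → i < lb → lab (q i) ≤ head
  done : ∀ i, 1 ≤ i → i < head → ∀ v, H.Adj (q i) v →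
    lab v ≠ 0 ∧ ∀ w, lab (q i) < lab w → lab v ≤ lab w
  parent : ∀ v, lab v ≠ 0 → IsBFSRoot H cand nc lab side head v ∨
    ∃ u, H.Adj u v ∧ lab u ≠ 0 ∧ lab u < lab v ∧ side u + side v = 1

variable {H : SimpleGraph ℕ} {cand : ℕ → ℕ} {nc : ℕ} {lab side q : ℕ → ℕ} {head tail lb : ℕ}

theorem Core.self_le (h : Core H cand nc lab side q head tail lb) {i : ℕ} (h1 : 1 ≤ i)
    (h2 : i < tail) : lab (q i) ≤ i := by
  by_contra h3
  have := (h.lab_lt i i h1 h2 h1 h2).2 (by omega)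
  omega

/-- When the head reaches the first vertex of the layer `lb`, all earlier layers have been
processed. The next layer will begin at the current tail and is still empty. -/
theorem Core.newLayer (h : Core H cand nc lab side q head tail lb) (hl : head = lb) :
    Core H cand nc lab side q head tail tail where
  one_le := h.one_le
  head_le := hl ▸ h.lb_le
  lb_le := le_rfl
  q_lab := h.q_lab
  q_adj := h.q_adj
  q_inj := h.q_inj
  q_surj := h.q_surj
  lab_lt := h.lab_lt
  lab_le := fun i h1 h2 => (h.self_le h1 h2).trans h2.le
  lab_eq := fun i h1 h2 => ⟨fun h3 => by have := h.self_le h1 h2; omega, fun h3 => by omega⟩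
  cur := fun i h1 h2 => hl ▸ h.lab_le i h1 h2
  done := h.done
  parent := h.parent

theorem Core.pop (h : Core H cand nc lab side q head tail lb) (hl : head < lb)
    (hd : ∀ v, H.Adj (q head) v → lab v ≠ 0) :
    Core H cand nc lab side q (head + 1) tail lb where
  one_le := by omega
  head_le := hl
  lb_le := h.lb_le
  q_lab := h.q_lab
  q_adj := h.q_adj
  q_inj := h.q_inj
  q_surj := h.q_surj
  lab_lt := h.lab_lt
  lab_le := h.lab_le
  lab_eq := h.lab_eq
  cur := fun i h1 h2 => (h.cur i h1 h2).trans (by omega)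
  done := fun i h1 h2 v hv => by
    rcases Nat.lt_succ_iff_lt_or_eq.1 h2 with h3 | rfl
    · exact h.done i h1 h3 v hv
    · refine ⟨hd v hv, fun w hw => ?_⟩
      have hlb := h.lb_le
      obtain ⟨j, j1, j2, rfl⟩ := h.q_surj w (by omega)
      obtain ⟨k, k1, k2, rfl⟩ := h.q_surj v (hd v hv)
      -- Queue positions before `lb` carry labels at most `head`, so the only label above that of
      -- the processed vertex is `lb`, the maximum.
      have h4 := (h.lab_lt i j h1 (by omega) j1 j2).1 hw
      have h5 : lb ≤ j := by
        by_contra h5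
        have := h.cur j j1 (by omega)
        omega
      rw [(h.lab_eq j j1 j2).2 h5]
      exact h.lab_le k k1 k2
  parent := fun v hv => (h.parent v hv).imp_left fun hr =>
    ⟨hr.adj, hr.lab_ne, hr.side_eq, hr.lab_le.trans (by omega), hr.unique, hr.closed, hr.first⟩

theorem IsBFSRoot.visit {head r : ℕ} (hr : IsBFSRoot H cand nc lab side head r) {v l s : ℕ}
    (hv : lab v = 0) (hl : head < l) :
    IsBFSRoot H cand nc (update lab v l) (update side v s) head r := by
  have hrv : r ≠ v := fun e => hr.lab_ne (e ▸ hv)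
  have hlr := hr.lab_le
  have e1 : update lab v l r = lab r := update_of_ne hrv ..
  refine ⟨hr.adj, by rw [e1]; exact hr.lab_ne, by rw [update_of_ne hrv]; exact hr.side_eq,
    by rw [e1]; exact hlr, ?_, ?_, ?_⟩ <;> rw [e1]
  · intro w hw
    by_cases hwv : w = v
    · subst hwv; rw [update_self] at hw; omega
    · rw [update_of_ne hwv] at hw; exact hr.unique w hw
  · intro a b hab ha hab'
    by_cases hav : a = v
    · subst hav; rw [update_self] at hab'; omega
    · rw [update_of_ne hav] at ha hab'
      have := hr.closed a b hab ha hab'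
      rw [update_of_ne (show b ≠ v from fun e => this.1 (e ▸ hv))]
      exact this
  · obtain ⟨i, h1, h2, h3⟩ := hr.first
    refine ⟨i, h1, h2, fun j h4 h5 w hw => ?_⟩
    have := h3 j h4 h5 w hw
    rw [update_of_ne (show w ≠ v from fun e => this.1 (e ▸ hv))]
    exact this

/-- The part common to visiting a neighbour and starting at a new root. The two cases differ only in
their reasons for `cur` and `parent`. -/
theorem Core.push_aux (h : Core H cand nc lab side q head tail lb) {v s : ℕ}
    (hv : lab v = 0) (hadj : ∃ w, H.Adj v w)
    (hcur : ∀ i, 1 ≤ i → i < lb → update lab v lb (update q tail v i) ≤ head)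
    (hpar : ∀ x, update lab v lb x ≠ 0 →
      IsBFSRoot H cand nc (update lab v lb) (update side v s) head x ∨
      ∃ u, H.Adj u x ∧ update lab v lb u ≠ 0 ∧ update lab v lb u < update lab v lb x ∧
        update side v s u + update side v s x = 1) :
    Core H cand nc (update lab v lb) (update side v s) (update q tail v) head (tail + 1) lb := by
  have h1 := h.one_le
  have h2 := h.head_le
  have h3 := h.lb_le
  have qo : ∀ i, 1 ≤ i → i < tail → update q tail v i = q i ∧ q i ≠ v := fun i i1 i2 =>
    ⟨update_of_ne (by omega) .., fun e => h.q_lab i i1 i2 (e ▸ hv)⟩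
  have lo : ∀ i, 1 ≤ i → i < tail → update lab v lb (update q tail v i) = lab (q i) :=
    fun i i1 i2 => by rw [(qo i i1 i2).1, update_of_ne (qo i i1 i2).2]
  have lt : update lab v lb (update q tail v tail) = lb := by simp
  refine ⟨h1, h2, by omega, fun i i1 i2 => ?_, fun i i1 i2 => ?_, fun i j i1 i2 j1 j2 hij => ?_,
    fun x hx => ?_, fun i j i1 i2 j1 j2 => ?_, fun i i1 i2 => ?_, fun i i1 i2 => ?_, hcur,
    fun i i1 i2 x hx => ?_, hpar⟩
  · rcases Nat.lt_succ_iff_lt_or_eq.1 i2 with i2 | rfl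
    · rw [lo i i1 i2]; exact h.q_lab i i1 i2
    · rw [lt]; omega
  · rcases Nat.lt_succ_iff_lt_or_eq.1 i2 with i2 | rfl
    · rw [(qo i i1 i2).1]; exact h.q_adj i i1 i2
    · rwa [update_self]
  · rcases Nat.lt_succ_iff_lt_or_eq.1 i2 with i2 | rfl <;>
      rcases Nat.lt_succ_iff_lt_or_eq.1 j2 with j2 | rfl
    · rw [(qo i i1 i2).1, (qo j j1 j2).1] at hij; exact h.q_inj i j i1 i2 j1 j2 hij
    · rw [(qo i i1 i2).1, update_self] at hij; exact absurd hij (qo i i1 i2).2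
    · rw [(qo j j1 j2).1, update_self] at hij; exact absurd hij.symm (qo j j1 j2).2
    · rfl
  · by_cases hxv : x = v
    · subst hxv; exact ⟨tail, by omega, by omega, update_self ..⟩
    · rw [update_of_ne hxv] at hx
      obtain ⟨i, i1, i2, hi⟩ := h.q_surj x hx
      exact ⟨i, i1, by omega, by rw [(qo i i1 i2).1, hi]⟩
  · rcases Nat.lt_succ_iff_lt_or_eq.1 i2 with i2 | rfl <;>
      rcases Nat.lt_succ_iff_lt_or_eq.1 j2 with j2 | rfl
    · rw [lo i i1 i2, lo j j1 j2]; exact h.lab_lt i j i1 i2 j1 j2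
    · rw [lo i i1 i2, lt]
      have := h.lab_eq i i1 i2
      have := h.lab_le i i1 i2
      omega
    · rw [lo j j1 j2, lt]
      have := h.lab_le j j1 j2
      omega
    · rw [lt]; omega
  · rcases Nat.lt_succ_iff_lt_or_eq.1 i2 with i2 | rfl
    · rw [lo i i1 i2]; exact h.lab_le i i1 i2
    · rw [lt]
  · rcases Nat.lt_succ_iff_lt_or_eq.1 i2 with i2 | rfl
    · rw [lo i i1 i2]; exact h.lab_eq i i1 i2
    · rw [lt]; simp [h3]
  · have hit : i < tail := by omega
    rw [(qo i i1 hit).1] at hx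
    have hd := h.done i i1 i2 x hx
    have hxv : x ≠ v := fun e => hd.1 (e ▸ hv)
    rw [update_of_ne hxv, lo i i1 hit]
    refine ⟨hd.1, fun w hw => ?_⟩
    by_cases hwv : w = v
    · subst hwv
      rw [update_self]
      obtain ⟨k, k1, k2, rfl⟩ := h.q_surj x hd.1
      exact h.lab_le k k1 k2
    · rw [update_of_ne hwv] at hw ⊢
      exact hd.2 w hw

theorem Core.push (h : Core H cand nc lab side q head tail lb) (hl : head < lb) {v s : ℕ}
    (hv : lab v = 0) (hadj : H.Adj (q head) v) (hs : side (q head) + s = 1) :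
    Core H cand nc (update lab v lb) (update side v s) (update q tail v) head (tail + 1) lb := by
  have h1 := h.one_le
  have h3 := h.lb_le
  refine h.push_aux hv ⟨_, hadj.symm⟩ (fun i i1 i2 => ?_) (fun x hx => ?_)
  · rw [update_of_ne (show i ≠ tail by omega), update_of_ne]
    · exact h.cur i i1 i2
    · rintro e; exact h.q_lab i i1 (by omega) (e ▸ hv)
  · have hh := h.q_lab head h1 (by omega)
    by_cases hxv : x = v
    · subst hxv
      have hne := hadj.ne
      refine .inr ⟨q head, hadj, ?_⟩
      rw [update_of_ne hne, update_self, update_of_ne hne, update_self]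
      have := h.lab_le head h1 (by omega)
      have := h.lab_eq head h1 (by omega)
      exact ⟨hh, by omega, hs⟩
    · rw [update_of_ne hxv] at hx
      refine (h.parent x hx).imp (fun hr => hr.visit hv hl) fun ⟨u, u1, u2, u3, u4⟩ => ⟨u, u1, ?_⟩
      have huv : u ≠ v := fun e => u2 (e ▸ hv)
      rw [update_of_ne hxv, update_of_ne hxv, update_of_ne huv, update_of_ne huv]
      exact ⟨u2, u3, u4⟩

/-- The queue is exhausted, so the labelled vertices are closed under adjacency and all their labels
are below `head`. The root receives `head` as label and remains alone in its layer, since the next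
layer begins behind it. -/
theorem Core.addRoot (h : Core H cand nc lab side q head head head) {r i : ℕ} (hr : lab r = 0)
    (hadj : ∃ w, H.Adj r w) (hi : i < nc) (hc : cand i = r + 1)
    (hc' : ∀ j < nc, i < j → ∀ v, cand j = v + 1 → lab v ≠ 0) :
    Core H cand nc (update lab r head) (update side r 0) (update q head r) head (head + 1) head := by
  have h1 := h.one_le
  have small : ∀ v, lab v ≠ 0 → v ≠ r ∧ lab v < head := fun v hv => by
    refine ⟨fun e => hv (e ▸ hr), ?_⟩
    obtain ⟨k, k1, k2, rfl⟩ := h.q_surj v hv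
    exact (h.self_le k1 k2).trans_lt k2
  refine h.push_aux hr hadj (fun j j1 j2 => ?_) (fun x hx => ?_)
  · rw [update_of_ne (show j ≠ head by omega), update_of_ne]
    · exact h.cur j j1 j2
    · rintro e; exact h.q_lab j j1 j2 (e ▸ hr)
  · by_cases hxr : x = r
    · subst hxr
      refine .inl ⟨hadj, ?_, ?_, ?_, fun w hw => ?_, fun u v huv hu hlt => ?_,
        i, hi, hc, fun j j1 j2 v hv => ?_⟩
      · rw [update_self]; omega
      · rw [update_self]
      · rw [update_self]
      · by_contra hne
        rw [update_self, update_of_ne hne] at hw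
        have := (small w (by omega)).2
        omega
      · rw [update_self] at hlt ⊢
        have hux : u ≠ x := fun e => by subst e; rw [update_self] at hlt; omega
        rw [update_of_ne hux] at hu
        obtain ⟨k, k1, k2, rfl⟩ := h.q_surj u hu
        have := (h.done k k1 k2 v huv).1
        rw [update_of_ne (small v this).1]
        exact ⟨this, (small v this).2⟩
      · have := hc' j j1 j2 v hv
        rw [update_self, update_of_ne (small v this).1]
        exact ⟨this, (small v this).2⟩
    · rw [update_of_ne hxr] at hx
      refine (h.parent x hx).imp (fun hR => ?_) fun ⟨u, u1, u2, u3, u4⟩ => ⟨u, u1, ?_⟩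
      · have hlx := (small x hx).2
        have e1 : update lab r head x = lab x := update_of_ne hxr ..
        refine ⟨hR.adj, by rwa [e1], by rw [update_of_ne hxr]; exact hR.side_eq,
          by rw [e1]; exact hR.lab_le, fun w hw => ?_, fun u v huv hu hlt => ?_, ?_⟩
        · by_cases hwr : w = r
          · subst hwr; rw [update_self, e1] at hw; omega
          · rw [update_of_ne hwr, e1] at hw; exact hR.unique w hw
        · rw [e1] at hlt ⊢
          have hur : u ≠ r := fun e => by subst e; rw [update_self] at hlt; omega
          rw [update_of_ne hur] at hu hlt
          have := hR.closed u v huv hu hlt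
          rw [update_of_ne (small v this.1).1]
          exact this
        · obtain ⟨k, k1, k2, k3⟩ := hR.first
          refine ⟨k, k1, k2, fun j j1 j2 v hv => ?_⟩
          have := k3 j j1 j2 v hv
          rw [e1, update_of_ne (small v this.1).1]
          exact this
      · rw [update_of_ne hxr, update_of_ne hxr, update_of_ne (small u u2).1,
          update_of_ne (small u u2).1]
        exact ⟨u2, u3, u4⟩

end BFS

/-! ### Adjacency arrays, keys and the potential of the search -/

section Keyed

open Function (update update_self update_of_ne update_apply)

/-- Arrays that hold the adjacency lists of a graph on the vertices below `n`. -/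
structure IsCSR (H : SimpleGraph ℕ) (n : ℕ) (off tgt : ℕ → ℕ) : Prop where
  off_le : ∀ u < n, off u ≤ off (u + 1)
  adj_lt : ∀ {u v}, H.Adj u v → u < n
  adj_iff : ∀ u < n, ∀ v, H.Adj u v ↔ ∃ j, off u ≤ j ∧ j < off (u + 1) ∧ tgt j = v
  inj : ∀ u < n, ∀ i j, off u ≤ i → i < off (u + 1) → off u ≤ j → j < off (u + 1) →
    tgt i = tgt j → i = j

open Classical in
-- The slots of `u` correspond bijectively to its neighbours, so counters in a scan of the slots
-- count neighbours.
theorem IsCSR.card_slots {H : SimpleGraph ℕ} {n : ℕ} {off tgt : ℕ → ℕ} (h : IsCSR H n off tgt)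
    {u : ℕ} (hu : u < n) (P : ℕ → Prop) :
    ((Finset.Ico (off u) (off (u + 1))).filter fun j => P (tgt j)).card =
      ((Finset.range n).filter fun v => H.Adj u v ∧ P v).card := by
  rw [← Finset.card_image_of_injOn (s := Finset.filter _ _) (f := tgt)]
  · congr 1
    ext v
    simp only [Finset.mem_image, Finset.mem_filter, Finset.mem_Ico, Finset.mem_range]
    constructor
    · rintro ⟨j, ⟨⟨h1, h2⟩, h3⟩, rfl⟩
      have := (h.adj_iff u hu (tgt j)).2 ⟨j, h1, h2, rfl⟩
      exact ⟨h.adj_lt this.symm, this, h3⟩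
    · rintro ⟨-, h1, h2⟩
      obtain ⟨j, h3, h4, rfl⟩ := (h.adj_iff u hu v).1 h1
      exact ⟨j, ⟨⟨h3, h4⟩, h2⟩, rfl⟩
  · intro i hi j hj hij
    simp only [Finset.coe_filter, Finset.mem_Ico, Set.mem_ofPred_eq] at hi hj
    exact h.inj u hu i j hi.1.1 hi.1.2 hj.1.1 hj.1.2 hij

open Classical in
/-- The keys of the processed vertices, and the vertices that represent the keys. -/
structure Keyed (H : SimpleGraph ℕ) (n : ℕ) (lab q key rep : ℕ → ℕ) (head tail : ℕ) : Prop where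
  key_eq : ∀ i, 1 ≤ i → i < head → ∃ x, 1 ≤ x ∧ x ≤ tail ∧
    (∀ j, 1 ≤ j → j < tail → (lab (q j) ≤ lab (q i) ↔ j < x)) ∧
    key (q i) = 2 * (lab (q i) + x) +
      ((Finset.range n).filter fun v => H.Adj (q i) v ∧ lab (q i) ≤ lab v).card -
      ((Finset.range n).filter fun v => H.Adj (q i) v ∧ lab v < lab (q i)).card
  rep_spec : ∀ k, rep k ≠ 0 → ∃ i, 1 ≤ i ∧ i < head ∧ rep k = q i + 1 ∧ key (q i) = k
  rep_ne : ∀ i, 1 ≤ i → i < head → rep (key (q i)) ≠ 0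

variable {H : SimpleGraph ℕ} {cand : ℕ → ℕ} {nc n : ℕ} {lab side q key rep : ℕ → ℕ}
  {head tail lb : ℕ}

open Classical in
-- All neighbours of a processed vertex already have labels, and the new vertex belongs to a layer
-- after every processed one. So neither the counts nor the layer ends `x` change.
theorem Keyed.push (h : Core H cand nc lab side q head tail lb)
    (hk : Keyed H n lab q key rep head tail) {v : ℕ} (hv : lab v = 0) :
    Keyed H n (update lab v lb) (update q tail v) key rep head (tail + 1) := by
  have h1 := h.head_le
  have h2 := h.lb_le
  have qo : ∀ i, 1 ≤ i → i < tail → update q tail v i = q i ∧ update lab v lb (q i) = lab (q i) :=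
    fun i i1 i2 => ⟨update_of_ne (by omega) .., update_of_ne (show q i ≠ v from fun e => h.q_lab i i1 i2 (e ▸ hv)) ..⟩
  refine ⟨fun i i1 i2 => ?_, fun k hk' => ?_, fun i i1 i2 => ?_⟩
  · obtain ⟨x, x0, x1, x2, x3⟩ := hk.key_eq i i1 i2
    have hit : i < tail := by omega
    rw [(qo i i1 hit).1, (qo i i1 hit).2]
    refine ⟨x, x0, by omega, fun j j1 j2 => ?_, x3.trans ?_⟩
    · rcases Nat.lt_succ_iff_lt_or_eq.1 j2 with j2 | rfl
      · rw [(qo j j1 j2).1, (qo j j1 j2).2]; exact x2 j j1 j2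
      · rw [update_self, update_self]
        have := h.lab_le i i1 hit
        have := h.lab_eq i i1 hit
        omega
    · have hw : ∀ w, H.Adj (q i) w → update lab v lb w = lab w := fun w hw =>
        update_of_ne (show w ≠ v from fun e => (h.done i i1 i2 w hw).1 (e ▸ hv)) ..
      congr 2
      · congr 1
        apply Finset.filter_congr
        intro w _
        refine and_congr_right fun h3 => ?_
        rw [hw w h3]
      · apply Finset.filter_congr
        intro w _
        refine and_congr_right fun h3 => ?_
        rw [hw w h3]
  · obtain ⟨i, i1, i2, i3, i4⟩ := hk.rep_spec k hk'
    have := (qo i i1 (by omega)).1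
    exact ⟨i, i1, i2, by rw [this, i3], by rw [this, i4]⟩
  · rw [(qo i i1 (by omega)).1]; exact hk.rep_ne i i1 i2

open Classical in
-- The layer of the head ends where the layer being filled begins, so `lb` serves as its `x`.
theorem Keyed.pop (h : Core H cand nc lab side q head tail lb)
    (hk : Keyed H n lab q key rep head tail) (hl : head < lb) {k : ℕ}
    (hkey : k = 2 * (lab (q head) + lb) +
      ((Finset.range n).filter fun v => H.Adj (q head) v ∧ lab (q head) ≤ lab v).card -
      ((Finset.range n).filter fun v => H.Adj (q head) v ∧ lab v < lab (q head)).card) :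
    Keyed H n lab q (update key (q head) k) (update rep k (q head + 1)) (head + 1) tail := by
  have h1 := h.one_le
  have h2 := h.lb_le
  have ko : ∀ i, 1 ≤ i → i < head → update key (q head) k (q i) = key (q i) := fun i i1 i2 =>
    update_of_ne (fun e => by
      have := h.q_inj i head i1 (by omega) h1 (by omega) e
      omega) ..
  refine ⟨fun i i1 i2 => ?_, fun l hl' => ?_, fun i i1 i2 => ?_⟩
  · rcases Nat.lt_succ_iff_lt_or_eq.1 i2 with i2 | rfl
    · rw [ko i i1 i2]; exact hk.key_eq i i1 i2
    · refine ⟨lb, by omega, h2, fun j j1 j2 => ?_, by rw [update_self, hkey]⟩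
      have e1 := h.lab_eq i h1 (by omega)
      have e2 := h.lab_eq j j1 j2
      have e3 := h.lab_le i h1 (by omega)
      have e4 := h.lab_lt i j h1 (by omega) j1 j2
      constructor
      · intro h3; by_contra h4; omega
      · intro h3
        have := h.cur j j1 h3
        by_contra h4
        have := e4.1 (by omega)
        omega
  · by_cases hlk : l = k
    · subst hlk; exact ⟨head, h1, by omega, by rw [update_self], by rw [update_self]⟩
    · rw [update_of_ne hlk] at hl' ⊢
      obtain ⟨i, i1, i2, i3, i4⟩ := hk.rep_spec l hl'
      exact ⟨i, i1, by omega, i3, by rw [ko i i1 i2, i4]⟩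
  · rw [update_apply rep]
    split_ifs with h3
    · omega
    · rcases Nat.lt_succ_iff_lt_or_eq.1 i2 with i2 | rfl
      · rw [ko i i1 i2]; exact hk.rep_ne i i1 i2
      · rw [update_self] at h3; exact absurd rfl h3

/-- A bound for the time that the search needs for the vertices that are not yet processed. -/
def pendingTime (n : ℕ) (off q : ℕ → ℕ) (head : ℕ) : ℕ :=
  ∑ v ∈ Finset.range n \ (Finset.Ico 1 head).image q, (40 + 30 * (off (v + 1) - off v))

theorem pendingTime_update {n : ℕ} {off : ℕ → ℕ} {v : ℕ} (h : head ≤ tail) :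
    pendingTime n off (update q tail v) head = pendingTime n off q head := by
  unfold pendingTime
  congr 2
  apply Finset.image_congr
  intro i hi
  rw [Finset.coe_Ico, Set.mem_Ico] at hi
  exact update_of_ne (by omega) ..

theorem pendingTime_pop {off : ℕ → ℕ} (h : Core H cand nc lab side q head tail lb)
    (hl : head < tail) (hn : q head < n) :
    pendingTime n off q head =
      pendingTime n off q (head + 1) + (40 + 30 * (off (q head + 1) - off (q head))) := by
  unfold pendingTime
  have h1 := h.one_le
  rw [← Finset.insert_Ico_right_eq_Ico_add_one h1, Finset.image_insert,
    Finset.sdiff_insert, Finset.sum_erase_add]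
  simp only [Finset.mem_sdiff, Finset.mem_range, Finset.mem_image, Finset.mem_Ico]
  refine ⟨hn, ?_⟩
  rintro ⟨i, ⟨i1, i2⟩, i3⟩
  have := h.q_inj i head i1 (by omega) h1 hl i3
  omega

theorem card_filter_Ico_succ {a j : ℕ} (h : a ≤ j) (P : ℕ → Prop) [DecidablePred P] :
    ((Finset.Ico a (j + 1)).filter P).card =
      ((Finset.Ico a j).filter P).card + if P j then 1 else 0 := by
  rw [← Finset.insert_Ico_right_eq_Ico_add_one h, Finset.filter_insert]
  split_ifs
  · rw [Finset.card_insert_of_notMem (by simp)]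
  · rfl

end Keyed

/-! ### The scan of one adjacency list -/

section Sweep

open RAM
open Function (update update_self update_of_ne update_apply)

/-- Sequential composition. -/
def RAM.block : List Prog → Prog
  | [] => .skip
  | [p] => p
  | p :: q :: l => .seq p (block (q :: l))

/-- Enter vertex `13` into the queue, unless it has a label already; register `14` holds its label
before and afterwards. -/
def visitProg (o : ℕ) : Prog :=
  .ite 2 14 .skip (block [
    .store (o + 3) 13 7,
    .assign 14 (.copy 7),
    .store (o + 4) 13 16,
    .store (o + 5) 6 13,
    .assign 6 (.add 6 1),
    .assign 8 (.add 8 1),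
    .assign 8 (.add 8 1)])

/-- Look at slot `11` of the adjacency lists. -/
def slotProg (o : ℕ) : Prog := block [
  .assign 13 (.load 1 11),
  .assign 14 (.load (o + 3) 13),
  visitProg o,
  .ite 14 15 (.assign 18 (.add 18 1)) (.assign 17 (.add 17 1)),
  .assign 11 (.add 11 1)]

/-- The part of the state that matters while the vertex in register `10` is processed. Registers
`5`, `6`, `7` hold the head and the tail of the queue and the label of the layer being filled. -/
structure Processing (H : SimpleGraph ℕ) (cand : ℕ → ℕ) (nc n : ℕ) (off tgt : ℕ → ℕ) (o : ℕ)
    (s₀ s : State) : Prop where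
  core : Core H cand nc (s.mem (o + 3)) (s.mem (o + 4)) (s.mem (o + 5)) (s.reg 5) (s.reg 6) (s.reg 7)
  keyed : Keyed H n (s.mem (o + 3)) (s.mem (o + 5)) (s.mem (o + 6)) (s.mem (o + 7)) (s.reg 5) (s.reg 6)
  head_lt : s.reg 5 < s.reg 7
  vertex : s.reg 10 = s.mem (o + 5) (s.reg 5)
  label : s.reg 15 = s.mem (o + 3) (s.reg 10)
  side : s.mem (o + 4) (s.reg 10) + s.reg 16 = 1
  count : s.reg 8 = 2 * (s.reg 5 + s.reg 6)
  base : s.reg 9 = 2 * (s.reg 15 + s.reg 7)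
  pending : pendingTime n off (s.mem (o + 5)) (s.reg 5) =
    pendingTime n off (s₀.mem (o + 5)) (s₀.reg 5)
  mem_zero : s.mem 0 = off
  mem_one : s.mem 1 = tgt
  reg_one : s.reg 1 = 1
  reg_two : s.reg 2 = 0
  keep : ∀ v, s₀.mem (o + 3) v ≠ 0 → s.mem (o + 3) v ≠ 0
  frame_mem : ∀ k, k < o + 3 ∨ o + 7 < k → s.mem k = s₀.mem k
  frame_reg : ∀ r < 5, s.reg r = s₀.reg r

variable {H : SimpleGraph ℕ} {cand : ℕ → ℕ} {nc n : ℕ} {off tgt : ℕ → ℕ} {o : ℕ} {s₀ s : State}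

theorem Processing.setReg (h : Processing H cand nc n off tgt o s₀ s) {r v : ℕ} (h10 : 10 < r)
    (h15 : r ≠ 15) (h16 : r ≠ 16) : Processing H cand nc n off tgt o s₀ (s.setReg r v) := by
  have e : ∀ i, i ≤ 10 ∨ i = 15 ∨ i = 16 → (s.setReg r v).reg i = s.reg i := fun i hi => by
    rw [State.setReg_reg, if_neg (by omega)]
  have e' : ∀ k, (s.setReg r v).mem k = s.mem k := fun k => rfl
  constructor
  all_goals try simp only [e', e 1 (by simp), e 2 (by simp), e 5 (by simp), e 6 (by simp),
    e 7 (by simp), e 8 (by simp), e 9 (by simp), e 10 (by simp), e 15 (by simp), e 16 (by simp)]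
  exacts [h.core, h.keyed, h.head_lt, h.vertex, h.label, h.side, h.count, h.base, h.pending,
    h.mem_zero, h.mem_one, h.reg_one, h.reg_two, h.keep, h.frame_mem,
    fun i hi => (e i (by omega)).trans (h.frame_reg i hi)]

theorem runs_visit (h : Processing H cand nc n off tgt o s₀ s)
    (hadj : H.Adj (s.reg 10) (s.reg 13)) (h14 : s.reg 14 = s.mem (o + 3) (s.reg 13)) :
    Runs (visitProg o) s fun t s' => t ≤ 8 ∧ Processing H cand nc n off tgt o s₀ s' ∧
      s'.mem (o + 3) (s.reg 13) ≠ 0 ∧ s'.reg 14 = s'.mem (o + 3) (s.reg 13) ∧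
      (∀ w, s.mem (o + 3) w ≠ 0 → s'.mem (o + 3) w = s.mem (o + 3) w) ∧
      ∀ r, 8 < r → r ≠ 14 → s'.reg r = s.reg r := by
  simp only [visitProg, block, runs_ite, runs_skip, runs_seq, runs_store, runs_assign, h.reg_two]
  refine ⟨fun h1 => ⟨by omega, h, by omega, h14, by simp, by simp⟩, fun h1 => ?_⟩
  have hv : s.mem (o + 3) (s.reg 13) = 0 := by omega
  have hc := h.core
  have hh1 := h.head_lt
  have hh2 := hc.lb_le
  have hh3 := hc.one_le
  simp only [Rhs.value, State.setReg_reg, State.setReg_mem, State.setMem_reg, State.setMem_mem,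
    h.reg_one]
  refine ⟨by omega, ?_, ?_, ?_, fun w hw => ?_, fun r h8 h14 => ?_⟩
  · have hne : s.reg 10 ≠ s.reg 13 := hadj.ne
    constructor <;> simp only [State.setReg_reg, State.setReg_mem, State.setMem_reg, State.setMem_mem,
      Nat.reduceEqDiff, if_true, if_false, Nat.add_left_cancel_iff]
    · refine hc.push hh1 hv (h.vertex ▸ hadj) ?_
      rw [← h.vertex]; exact h.side
    · exact h.keyed.push hc hv
    · exact hh1
    · rw [update_of_ne (by omega)]; exact h.vertex
    · rw [update_of_ne hne]; exact h.label
    · rw [update_of_ne hne]; exact h.side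
    · rw [h.count]; omega
    · exact h.base
    · rw [pendingTime_update (by omega)]; exact h.pending
    · simpa using h.mem_zero
    · simpa using h.mem_one
    · simpa using h.reg_one
    · simpa using h.reg_two
    · intro w hw
      rw [update_apply]
      split_ifs
      · omega
      · exact h.keep w hw
    · intro k hk
      rw [if_neg (by omega), if_neg (by omega), if_neg (by omega)]
      exact h.frame_mem k hk
    · intro r hr
      rw [if_neg (by omega), if_neg (by omega), if_neg (by omega), if_neg (by omega)]
      exact h.frame_reg r hr
  · simp; omega
  · simp
  · have hwv : w ≠ s.reg 13 := fun e => hw (e ▸ hv)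
    simp [hwv]
  · simp [h14, show r ≠ 6 by omega, show r ≠ 8 by omega]

/-- While the slots of a vertex are being looked at. -/
structure Slots (n : ℕ) (off tgt : ℕ → ℕ) (o : ℕ) (s : State) : Prop where
  le : off (s.reg 10) ≤ s.reg 11
  le_limit : s.reg 11 ≤ s.reg 12
  limit : s.reg 12 = off (s.reg 10 + 1)
  next : s.reg 19 = s.reg 10 + 1
  right : s.reg 17 = s.reg 9 + ((Finset.Ico (off (s.reg 10)) (s.reg 11)).filter
    fun j => s.reg 15 ≤ s.mem (o + 3) (tgt j)).card
  left : s.reg 18 = ((Finset.Ico (off (s.reg 10)) (s.reg 11)).filter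
    fun j => s.mem (o + 3) (tgt j) < s.reg 15).card
  seen : ∀ j, off (s.reg 10) ≤ j → j < s.reg 11 → s.mem (o + 3) (tgt j) ≠ 0

theorem runs_slot (hcsr : IsCSR H n off tgt) (h : Processing H cand nc n off tgt o s₀ s)
    (hu : s.reg 10 < n) (hs : Slots n off tgt o s) (hlt : s.reg 11 < s.reg 12) :
    Runs (slotProg o) s fun t s' => t ≤ 14 ∧ Processing H cand nc n off tgt o s₀ s' ∧
      Slots n off tgt o s' ∧ s'.reg 10 = s.reg 10 ∧ s'.reg 11 = s.reg 11 + 1 ∧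
      s'.reg 12 = s.reg 12 ∧ s'.reg 15 = s.reg 15 := by
  have hadj : H.Adj (s.reg 10) (tgt (s.reg 11)) :=
    (hcsr.adj_iff _ hu _).2 ⟨_, hs.le, hs.limit ▸ hlt, rfl⟩
  simp only [slotProg, block, runs_seq, runs_assign, Rhs.value]
  set s1 := (s.setReg 13 (s.mem 1 (s.reg 11))) with hs1
  set s2 := s1.setReg 14 (s1.mem (o + 3) (s1.reg 13)) with hs2
  have e13 : s2.reg 13 = tgt (s.reg 11) := by simp [hs2, hs1, State.setReg_reg, h.mem_one]
  have e10 : s2.reg 10 = s.reg 10 := by simp [hs2, hs1, State.setReg_reg]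
  have em : s2.mem = s.mem := rfl
  have h2 : Processing H cand nc n off tgt o s₀ s2 :=
    (h.setReg (by omega) (by omega) (by omega)).setReg (by omega) (by omega) (by omega)
  refine (runs_visit h2 (by rw [e10, e13]; exact hadj) (by
    simp [hs2, hs1, State.setReg_reg, State.setReg_mem])).mono ?_
  rintro t s3 ⟨ht, h3, hv, h14, hold, hreg⟩
  have r9 : s3.reg 9 = s.reg 9 := by rw [hreg 9 (by omega) (by omega)]; simp [hs2, hs1, State.setReg_reg]
  have r10 : s3.reg 10 = s.reg 10 := by
    rw [hreg 10 (by omega) (by omega)]; simp [hs2, hs1, State.setReg_reg]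
  have r11 : s3.reg 11 = s.reg 11 := by
    rw [hreg 11 (by omega) (by omega)]; simp [hs2, hs1, State.setReg_reg]
  have r12 : s3.reg 12 = s.reg 12 := by
    rw [hreg 12 (by omega) (by omega)]; simp [hs2, hs1, State.setReg_reg]
  have r15 : s3.reg 15 = s.reg 15 := by
    rw [hreg 15 (by omega) (by omega)]; simp [hs2, hs1, State.setReg_reg]
  have r17 : s3.reg 17 = s.reg 17 := by
    rw [hreg 17 (by omega) (by omega)]; simp [hs2, hs1, State.setReg_reg]
  have r18 : s3.reg 18 = s.reg 18 := by
    rw [hreg 18 (by omega) (by omega)]; simp [hs2, hs1, State.setReg_reg]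
  have r19 : s3.reg 19 = s.reg 19 := by
    rw [hreg 19 (by omega) (by omega)]; simp [hs2, hs1, State.setReg_reg]
  rw [e13] at hv h14
  rw [em] at hold
  -- The visit changes the label of an unlabelled vertex only, so the slots already seen contribute
  -- as before.
  have hR : ((Finset.Ico (off (s.reg 10)) (s.reg 11)).filter
      fun j => s.reg 15 ≤ s3.mem (o + 3) (tgt j)).card = s.reg 17 - s.reg 9 := by
    rw [hs.right, Nat.add_sub_cancel_left]
    congr 1
    refine Finset.filter_congr fun j hj => ?_
    rw [Finset.mem_Ico] at hj
    rw [hold _ (hs.seen j hj.1 hj.2)]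
  have hL : ((Finset.Ico (off (s.reg 10)) (s.reg 11)).filter
      fun j => s3.mem (o + 3) (tgt j) < s.reg 15).card = s.reg 18 := by
    rw [hs.left]
    congr 1
    refine Finset.filter_congr fun j hj => ?_
    rw [Finset.mem_Ico] at hj
    rw [hold _ (hs.seen j hj.1 hj.2)]
  have hseen : ∀ j, off (s.reg 10) ≤ j → j < s.reg 11 + 1 → s3.mem (o + 3) (tgt j) ≠ 0 := by
    intro j j1 j2
    rcases Nat.lt_succ_iff_lt_or_eq.1 j2 with j2 | rfl
    · rw [hold _ (hs.seen j j1 j2)]; exact hs.seen j j1 j2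
    · exact hv
  have h9 := hs.right
  have one := h3.reg_one
  simp only [runs_ite, runs_assign]
  refine ⟨fun htest => ⟨by omega, (h3.setReg (by omega) (by omega) (by omega)).setReg (by omega)
      (by omega) (by omega), ?_, ?_⟩,
    fun htest => ⟨by omega, (h3.setReg (by omega) (by omega) (by omega)).setReg (by omega)
      (by omega) (by omega), ?_, ?_⟩⟩
  · rw [h14, r15] at htest
    constructor <;> simp only [Rhs.value, State.setReg_reg, State.setReg_mem, Nat.reduceEqDiff,
      if_true, if_false, r9, r10, r11, r12, r15, r17, r18, r19, one]
    · have := hs.le; omega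
    · omega
    · exact hs.limit
    · exact hs.next
    · rw [card_filter_Ico_succ hs.le, if_neg (by omega), hR]; omega
    · rw [card_filter_Ico_succ hs.le, if_pos htest, hL]
    · exact hseen
  · simp [Rhs.value, State.setReg_reg, r10, r11, r12, r15, one]
  · rw [h14, r15] at htest
    constructor <;> simp only [Rhs.value, State.setReg_reg, State.setReg_mem, Nat.reduceEqDiff,
      if_true, if_false, r9, r10, r11, r12, r15, r17, r18, r19, one]
    · have := hs.le; omega
    · omega
    · exact hs.limit
    · exact hs.next
    · rw [card_filter_Ico_succ hs.le, if_pos (by omega), hR]; omega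
    · rw [card_filter_Ico_succ hs.le, if_neg htest, hL]; rfl
    · exact hseen
  · simp [Rhs.value, State.setReg_reg, r10, r11, r12, r15, one]

end Sweep

/-! ### Processing one vertex of the queue -/

section Search

open RAM
open Function (update update_self update_of_ne update_apply)

/-- Take the vertex at the head of the queue, and begin a new layer if it is the first of one. -/
def takeProg (o : ℕ) : Prog := block [
  .assign 10 (.load (o + 5) 5),
  .ite 5 7 .skip (block [.assign 9 (.copy 8), .assign 7 (.copy 6)]),
  .assign 15 (.load (o + 3) 10),
  .assign 16 (.load (o + 4) 10),
  .assign 16 (.sub 1 16),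
  .assign 17 (.copy 9),
  .assign 18 (.const 0),
  .assign 19 (.add 10 1),
  .assign 11 (.load 0 10),
  .assign 12 (.load 0 19)]

/-- Compute the key of the vertex at the head of the queue, and remove it. -/
def finishProg (o : ℕ) : Prog := block [
  .assign 17 (.sub 17 18),
  .store (o + 6) 10 17,
  .store (o + 7) 17 19,
  .assign 5 (.add 5 1),
  .assign 8 (.add 8 1),
  .assign 8 (.add 8 1)]

/-- Process the vertex at the head of the queue. -/
def vertexProg (o : ℕ) : Prog :=
  block [takeProg o, .loop 11 12 (slotProg o), finishProg o]

/-- The invariant of the breadth first search between two vertices. -/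
structure Searching (H : SimpleGraph ℕ) (cand : ℕ → ℕ) (nc n : ℕ) (off tgt : ℕ → ℕ) (o : ℕ)
    (s₀ s : State) : Prop where
  core : Core H cand nc (s.mem (o + 3)) (s.mem (o + 4)) (s.mem (o + 5)) (s.reg 5) (s.reg 6) (s.reg 7)
  keyed : Keyed H n (s.mem (o + 3)) (s.mem (o + 5)) (s.mem (o + 6)) (s.mem (o + 7)) (s.reg 5) (s.reg 6)
  count : s.reg 8 = 2 * (s.reg 5 + s.reg 6)
  base : s.reg 5 < s.reg 7 → s.reg 9 = 2 * (s.mem (o + 3) (s.mem (o + 5) (s.reg 5)) + s.reg 7)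
  mem_zero : s.mem 0 = off
  mem_one : s.mem 1 = tgt
  reg_one : s.reg 1 = 1
  reg_two : s.reg 2 = 0
  keep : ∀ v, s₀.mem (o + 3) v ≠ 0 → s.mem (o + 3) v ≠ 0
  frame_mem : ∀ k, k < o + 3 ∨ o + 7 < k → s.mem k = s₀.mem k
  frame_reg : ∀ r < 5, s.reg r = s₀.reg r

variable {H : SimpleGraph ℕ} {cand : ℕ → ℕ} {nc n : ℕ} {off tgt : ℕ → ℕ} {o : ℕ} {s₀ s : State}

theorem Core.side_le {lab side q : ℕ → ℕ} {head tail lb : ℕ}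
    (h : Core H cand nc lab side q head tail lb) {v : ℕ} (hv : lab v ≠ 0) : side v ≤ 1 := by
  rcases h.parent v hv with hr | ⟨u, -, -, -, hu⟩
  · rw [hr.side_eq]; omega
  · omega

theorem runs_take (hcsr : IsCSR H n off tgt) (h : Searching H cand nc n off tgt o s₀ s)
    (hlt : s.reg 5 < s.reg 6) :
    Runs (takeProg o) s fun t s' => t ≤ 12 ∧ Processing H cand nc n off tgt o s s' ∧
      Slots n off tgt o s' ∧ s'.reg 10 < n ∧ s'.reg 11 = off (s'.reg 10) ∧ s'.reg 5 = s.reg 5 ∧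
      s'.mem = s.mem := by
  have h1 := h.core.one_le
  have h2 := h.core.head_le
  have hu := h.core.q_lab _ h1 hlt
  obtain ⟨w, hw⟩ := h.core.q_adj _ h1 hlt
  have hn := hcsr.adj_lt hw
  have hside := h.core.side_le hu
  simp only [takeProg, block, runs_ite, runs_skip, runs_seq, runs_assign]
  -- Both outcomes of the test are treated alike: `l` is the label of the layer to be filled and `B`
  -- the corresponding base of the keys.
  have hfin : ∀ (B l : ℕ) (s' : State),
      (∀ r, r ≠ 7 → r ≤ 8 → s'.reg r = s.reg r) → s'.mem = s.mem → s'.reg 7 = l →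
      s'.reg 9 = B → s'.reg 10 = s.mem (o + 5) (s.reg 5) →
      s'.reg 15 = s.mem (o + 3) (s'.reg 10) →
      s'.reg 16 = 1 - s.mem (o + 4) (s'.reg 10) → s'.reg 17 = B → s'.reg 18 = 0 →
      s'.reg 19 = s'.reg 10 + 1 → s'.reg 11 = off (s'.reg 10) → s'.reg 12 = off (s'.reg 19) →
      Core H cand nc (s.mem (o + 3)) (s.mem (o + 4)) (s.mem (o + 5)) (s.reg 5) (s.reg 6) l →
      s.reg 5 < l → B = 2 * (s.mem (o + 3) (s.mem (o + 5) (s.reg 5)) + l) →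
      Processing H cand nc n off tgt o s s' ∧
      Slots n off tgt o s' ∧ s'.reg 10 < n ∧ s'.reg 11 = off (s'.reg 10) ∧ s'.reg 5 = s.reg 5 ∧
      s'.mem = s.mem := by
    intro B l s' er em e7 e9 e10 e15 e16 e17 e18 e19 e11 e12 hc hl hB
    refine ⟨?_, ?_, by rw [e10]; exact hn, e11, er 5 (by omega) (by omega), em⟩
    · constructor
      · rw [em, er 5 (by omega) (by omega), er 6 (by omega) (by omega), e7]; exact hc
      · rw [em, er 5 (by omega) (by omega), er 6 (by omega) (by omega)]; exact h.keyed
      · rw [er 5 (by omega) (by omega), e7]; exact hl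
      · rw [em, er 5 (by omega) (by omega), e10]
      · rw [em, e15]
      · rw [em, e16, e10]; omega
      · rw [er 5 (by omega) (by omega), er 6 (by omega) (by omega), er 8 (by omega) (by omega)]
        exact h.count
      · rw [e9, e15, e10, e7, hB]
      · rw [em, er 5 (by omega) (by omega)]
      · rw [em]; exact h.mem_zero
      · rw [em]; exact h.mem_one
      · rw [er 1 (by omega) (by omega)]; exact h.reg_one
      · rw [er 2 (by omega) (by omega)]; exact h.reg_two
      · rw [em]; exact fun _ => id
      · intro k _; rw [em]
      · intro r hr; exact er r (by omega) (by omega)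
    · constructor
      · exact e11.ge
      · rw [e11, e12, e19]; exact hcsr.off_le _ (by rw [e10]; exact hn)
      · rw [e12, e19]
      · exact e19
      · rw [e17, e9, e11]; simp
      · rw [e18, e11]; simp
      · intro j j1 j2; omega
  refine ⟨fun htest => ⟨by omega, ?_⟩, fun htest => ⟨by omega, ?_⟩⟩ <;>
    simp only [State.setReg_reg, Nat.reduceEqDiff, if_false] at htest
  · refine hfin (s.reg 9) (s.reg 7) _ ?_ rfl ?_ ?_ ?_ ?_ ?_ ?_ ?_ ?_ ?_ ?_ h.core htest (h.base htest)
    · intro r r7 r8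
      simp [State.setReg_reg, show r ≠ 10 by omega, show r ≠ 11 by omega, show r ≠ 12 by omega,
        show r ≠ 15 by omega, show r ≠ 16 by omega, show r ≠ 17 by omega, show r ≠ 18 by omega,
        show r ≠ 19 by omega]
    all_goals simp [State.setReg_reg, State.setReg_mem, Rhs.value, h.reg_one, h.mem_zero]
  · have hl : s.reg 5 = s.reg 7 := by omega
    refine hfin (s.reg 8) (s.reg 6) _ ?_ rfl ?_ ?_ ?_ ?_ ?_ ?_ ?_ ?_ ?_ ?_ (h.core.newLayer hl) hlt ?_
    · intro r r7 r8
      simp [State.setReg_reg, show r ≠ 10 by omega, show r ≠ 11 by omega, show r ≠ 12 by omega,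
        show r ≠ 15 by omega, show r ≠ 16 by omega, show r ≠ 17 by omega, show r ≠ 18 by omega,
        show r ≠ 19 by omega, show r ≠ 9 by omega, r7]
    all_goals try simp [State.setReg_reg, State.setReg_mem, Rhs.value, h.reg_one, h.mem_zero]
    -- At the beginning of a layer the head is its label and the tail the label of the next one. So
    -- register `8`, kept at twice head plus tail by increments, is the base of the keys of the
    -- layer.
    rw [h.count, (h.core.lab_eq _ h1 hlt).2 hl.ge, hl]

theorem runs_finish (hcsr : IsCSR H n off tgt) (h : Processing H cand nc n off tgt o s₀ s)
    (hs : Slots n off tgt o s) (hu : s.reg 10 < n) (hend : s.reg 11 = s.reg 12) :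
    Runs (finishProg o) s fun t s' => t = 6 ∧ Searching H cand nc n off tgt o s₀ s' ∧
      s'.reg 5 = s.reg 5 + 1 ∧ s'.mem (o + 5) = s.mem (o + 5) := by
  classical
  have h5 := h.head_lt
  have hc := h.core
  have h6 := hc.lb_le
  have h1 := hc.one_le
  have hd : ∀ v, H.Adj (s.mem (o + 5) (s.reg 5)) v → s.mem (o + 3) v ≠ 0 := fun v hv => by
    rw [← h.vertex] at hv
    obtain ⟨j, j1, j2, rfl⟩ := (hcsr.adj_iff _ hu v).1 hv
    exact hs.seen j j1 (by rw [hend, hs.limit]; exact j2)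
  have hp := hc.pop h5 hd
  have hk := h.keyed.pop hc h5 rfl
  have e2 : ((Finset.Ico (off (s.reg 10)) (off (s.reg 10 + 1))).filter
      fun j => s.reg 15 ≤ s.mem (o + 3) (tgt j)).card = ((Finset.range n).filter
      fun v => H.Adj (s.reg 10) v ∧ s.reg 15 ≤ s.mem (o + 3) v).card := by
    convert hcsr.card_slots hu (fun v => s.reg 15 ≤ s.mem (o + 3) v)
  have e3 : ((Finset.Ico (off (s.reg 10)) (off (s.reg 10 + 1))).filter
      fun j => s.mem (o + 3) (tgt j) < s.reg 15).card = ((Finset.range n).filter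
      fun v => H.Adj (s.reg 10) v ∧ s.mem (o + 3) v < s.reg 15).card := by
    convert hcsr.card_slots hu (fun v => s.mem (o + 3) v < s.reg 15)
  have e4 : s.reg 17 - s.reg 18 = 2 * (s.mem (o + 3) (s.mem (o + 5) (s.reg 5)) + s.reg 7) +
      ((Finset.range n).filter fun v => H.Adj (s.mem (o + 5) (s.reg 5)) v ∧
        s.mem (o + 3) (s.mem (o + 5) (s.reg 5)) ≤ s.mem (o + 3) v).card -
      ((Finset.range n).filter fun v => H.Adj (s.mem (o + 5) (s.reg 5)) v ∧
        s.mem (o + 3) v < s.mem (o + 3) (s.mem (o + 5) (s.reg 5))).card := by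
    rw [← h.vertex, ← h.label, ← h.base, ← e2, ← e3, hs.right, hs.left, hend, hs.limit]
  simp only [finishProg, block, runs_seq, runs_store, runs_assign]
  simp only [Rhs.value, State.setReg_reg, State.setReg_mem, State.setMem_reg, State.setMem_mem,
    Nat.reduceEqDiff, if_true, if_false, h.reg_one, OfNat.one_ne_ofNat,
    Nat.add_left_cancel_iff, true_and]
  refine ⟨?_, trivial⟩
  constructor <;> simp only [State.setReg_reg, State.setReg_mem, State.setMem_reg, State.setMem_mem,
    Nat.reduceEqDiff, if_true, if_false, OfNat.one_ne_ofNat, h.reg_one,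
    Nat.add_left_cancel_iff]
  · exact hp
  · rw [← e4] at hk
    rw [hs.next, h.vertex]
    exact hk
  · rw [h.count]; omega
  · intro h7
    -- As the new head is still before `lb`, it lies in the same layer as the old one and the base
    -- remains valid.
    have e5 := hc.lab_lt (s.reg 5) (s.reg 5 + 1) h1 (by omega) (by omega) (by omega)
    have e6 := hc.lab_lt (s.reg 5 + 1) (s.reg 5) (by omega) (by omega) h1 (by omega)
    have e7 := hc.cur (s.reg 5 + 1) (by omega) h7
    have e8 := hc.self_le h1 (by omega)
    have e9 : s.mem (o + 3) (s.mem (o + 5) (s.reg 5 + 1)) = s.mem (o + 3) (s.mem (o + 5) (s.reg 5)) := by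
      omega
    rw [h.base, e9, h.label, h.vertex]
  · simpa using h.mem_zero
  · simpa using h.mem_one
  · exact h.reg_two
  · exact h.keep
  · intro k hk
    rw [if_neg (by omega), if_neg (by omega)]
    exact h.frame_mem k hk
  · intro r hr
    rw [if_neg (by omega), if_neg (by omega), if_neg (by omega), if_neg (by omega)]
    exact h.frame_reg r hr

theorem runs_slots (hcsr : IsCSR H n off tgt) (h : Processing H cand nc n off tgt o s₀ s)
    (hs : Slots n off tgt o s) (hu : s.reg 10 < n) :
    Runs (.loop 11 12 (slotProg o)) s fun t s' => t ≤ 15 * (s.reg 12 - s.reg 11) + 1 ∧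
      Processing H cand nc n off tgt o s₀ s' ∧ Slots n off tgt o s' ∧ s'.reg 10 = s.reg 10 ∧
      s'.reg 11 = s'.reg 12 := by
  refine (runs_loop (fun φ s' => Processing H cand nc n off tgt o s₀ s' ∧ Slots n off tgt o s' ∧
    s'.reg 10 = s.reg 10 ∧ φ = 15 * (s'.reg 12 - s'.reg 11)) ?_ _ s ⟨h, hs, rfl, rfl⟩).mono ?_
  · rintro φ s' ⟨h', hs', hu', rfl⟩ hlt
    refine (runs_slot hcsr h' (hu' ▸ hu) hs' hlt).mono ?_
    rintro t s'' ⟨ht, h1, h2, h3, h4, h5, -⟩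
    exact ⟨_, ⟨h1, h2, h3.trans hu', rfl⟩, by omega⟩
  · rintro t s' ⟨φ, ⟨h1, h2, h3, rfl⟩, hn, ht⟩
    have := h2.le_limit
    exact ⟨by omega, h1, h2, h3, by omega⟩

theorem runs_vertex (hcsr : IsCSR H n off tgt) (h : Searching H cand nc n off tgt o s₀ s)
    (hlt : s.reg 5 < s.reg 6) :
    Runs (vertexProg o) s fun t s' => Searching H cand nc n off tgt o s₀ s' ∧
      t + 1 + pendingTime n off (s'.mem (o + 5)) (s'.reg 5) ≤
        pendingTime n off (s.mem (o + 5)) (s.reg 5) := by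
  simp only [vertexProg, block, runs_seq]
  refine (runs_take hcsr h hlt).mono ?_
  rintro t1 s1 ⟨ht1, p1, sl1, hn1, h11, h5, hm⟩
  refine (runs_slots hcsr p1 sl1 hn1).mono ?_
  rintro t2 s2 ⟨ht2, p2, sl2, h10, hend⟩
  refine (runs_finish hcsr p2 sl2 (by omega) hend).mono ?_
  rintro t3 s3 ⟨rfl, h3, e5, em⟩
  constructor
  · constructor
    exacts [h3.core, h3.keyed, h3.count, h3.base, h3.mem_zero, h3.mem_one, h3.reg_one, h3.reg_two,
      fun v hv => h3.keep v (h.keep v hv), fun k hk => (h3.frame_mem k hk).trans (h.frame_mem k hk),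
      fun r hr => (h3.frame_reg r hr).trans (h.frame_reg r hr)]
  · have h7 := p2.head_lt
    have h8 := p2.core.lb_le
    have hv := p2.vertex
    -- Removing a vertex of degree `d` frees `40 + 30 d` units; at most `12 + (15 d + 1) + 6` steps
    -- and one loop test are to be paid.
    have hp := pendingTime_pop p2.core (off := off) (n := n) (by omega) (by rw [← hv]; omega)
    rw [em, e5, ← p2.pending, hp, ← hv, h10]
    rw [sl1.limit, h11] at ht2
    omega

end Search

/-! ### Breadth first search of all components -/

section SweepRuns

open RAM
open Function (update update_self update_of_ne update_apply)

/-- Take the next candidate, and search from it unless it has been reached. -/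
def rootProg (o : ℕ) : Prog := block [
  .assign 4 (.sub 4 1),
  .assign 10 (.load (o + 2) 4),
  .ite 2 10
    (block [
      .assign 10 (.sub 10 1),
      .assign 14 (.load (o + 3) 10),
      .ite 2 14 .skip
        (block [
          .store (o + 3) 10 7,
          .store (o + 4) 10 2,
          .store (o + 5) 6 10,
          .assign 6 (.add 6 1),
          .assign 8 (.add 8 1),
          .assign 8 (.add 8 1),
          .loop 5 6 (vertexProg o)])])
    .skip]

/-- A breadth first search of the whole graph. Register `4` holds the number of candidates for
roots, which are in array `o + 2` and are tried from the last to the first. The labels, sides and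
keys of the vertices come into the arrays `o + 3`, `o + 4` and `o + 6`, and array `o + 7` gives a
vertex for each key. -/
def sweepProg (o : ℕ) : Prog := block [
  .assign 5 (.const 1),
  .assign 6 (.const 1),
  .assign 7 (.const 1),
  .assign 8 (.const 4),
  .loop 2 4 (rootProg o)]

variable {H : SimpleGraph ℕ} {cand : ℕ → ℕ} {nc n : ℕ} {off tgt : ℕ → ℕ} {o : ℕ} {s₀ s : State}

theorem runs_bfs (hcsr : IsCSR H n off tgt) (h : Searching H cand nc n off tgt o s s) :
    Runs (.loop 5 6 (vertexProg o)) s fun t s' => Searching H cand nc n off tgt o s s' ∧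
      s'.reg 5 = s'.reg 6 ∧ t + pendingTime n off (s'.mem (o + 5)) (s'.reg 5) ≤
        pendingTime n off (s.mem (o + 5)) (s.reg 5) + 1 := by
  refine (runs_loop (fun φ s' => Searching H cand nc n off tgt o s s' ∧
    φ = pendingTime n off (s'.mem (o + 5)) (s'.reg 5)) ?_ _ s ⟨h, rfl⟩).mono ?_
  · rintro φ s' ⟨h', rfl⟩ hlt
    exact (runs_vertex hcsr h' hlt).mono fun t s'' ⟨h1, h2⟩ => ⟨_, ⟨h1, rfl⟩, h2⟩
  · rintro t s' ⟨φ, ⟨h1, rfl⟩, hn, ht⟩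
    have h2 := h1.core.head_le
    have h3 := h1.core.lb_le
    exact ⟨h1, by omega, ht⟩

/-- The invariant of the loop over the candidates. -/
structure Sweeping (H : SimpleGraph ℕ) (cand : ℕ → ℕ) (nc n : ℕ) (off tgt : ℕ → ℕ) (o : ℕ)
    (s₀ s : State) : Prop where
  search : Searching H cand nc n off tgt o s s
  idle : s.reg 5 = s.reg 6
  cand_eq : s.mem (o + 2) = cand
  le : s.reg 4 ≤ nc
  reached : ∀ i < nc, s.reg 4 ≤ i → ∀ v, cand i = v + 1 → s.mem (o + 3) v ≠ 0
  frame_mem : ∀ k, k < o + 3 ∨ o + 7 < k → s.mem k = s₀.mem k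
  frame_reg : ∀ r < 4, s.reg r = s₀.reg r

theorem runs_root (hcsr : IsCSR H n off tgt)
    (hcand : ∀ i < nc, ∀ v, cand i = v + 1 → ∃ w, H.Adj v w)
    (h : Sweeping H cand nc n off tgt o s₀ s) (hpos : 0 < s.reg 4) :
    Runs (rootProg o) s fun t s' => Sweeping H cand nc n off tgt o s₀ s' ∧
      t + 1 + (pendingTime n off (s'.mem (o + 5)) (s'.reg 5) + 25 * s'.reg 4) ≤
        pendingTime n off (s.mem (o + 5)) (s.reg 5) + 25 * s.reg 4 := by
  have hS := h.search
  have hc := hS.core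
  have hle := h.le
  have e7 : s.reg 7 = s.reg 5 := by
    have := hc.head_le; have := hc.lb_le; have := h.idle; omega
  have hi : s.reg 4 - 1 < nc := by omega
  simp only [rootProg, block, runs_seq, runs_assign, runs_ite, runs_skip, runs_store]
  simp only [Rhs.value, State.setReg_reg, State.setReg_mem, State.setMem_reg,
    Nat.reduceEqDiff, if_true, if_false, OfNat.one_ne_ofNat, hS.reg_one, hS.reg_two, h.cand_eq]
  -- the state differs from `s` only in the registers `4`, `10`, `14`
  have skipped : ∀ s' : State, s'.mem = s.mem → (∀ r, r ≠ 4 → r < 10 → s'.reg r = s.reg r) →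
      s'.reg 4 = s.reg 4 - 1 → (∀ v, cand (s.reg 4 - 1) = v + 1 → s.mem (o + 3) v ≠ 0) →
      Sweeping H cand nc n off tgt o s₀ s' := by
    intro s' em er e4 hv
    refine ⟨⟨?_, ?_, ?_, ?_, ?_, ?_, ?_, ?_, fun _ => id, fun _ _ => rfl, fun _ _ => rfl⟩, ?_, ?_, ?_, ?_, ?_, ?_⟩
    · rw [em, er 5 (by omega) (by omega), er 6 (by omega) (by omega), er 7 (by omega) (by omega)]
      exact hc
    · rw [em, er 5 (by omega) (by omega), er 6 (by omega) (by omega)]; exact hS.keyed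
    · rw [er 5 (by omega) (by omega), er 6 (by omega) (by omega), er 8 (by omega) (by omega)]
      exact hS.count
    · rw [em, er 5 (by omega) (by omega), er 7 (by omega) (by omega), er 9 (by omega) (by omega)]
      exact hS.base
    · rw [em]; exact hS.mem_zero
    · rw [em]; exact hS.mem_one
    · rw [er 1 (by omega) (by omega)]; exact hS.reg_one
    · rw [er 2 (by omega) (by omega)]; exact hS.reg_two
    · rw [er 5 (by omega) (by omega), er 6 (by omega) (by omega)]; exact h.idle
    · rw [em]; exact h.cand_eq
    · omega
    · intro i i1 i2 v hiv
      rw [em]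
      by_cases e : i = s.reg 4 - 1
      · subst e; exact hv v hiv
      · exact h.reached i i1 (by omega) v hiv
    · intro k hk; rw [em]; exact h.frame_mem k hk
    · intro r hr; rw [er r (by omega) (by omega)]; exact h.frame_reg r hr
  refine ⟨fun hc0 => ⟨fun hl => ?_, fun hl => ?_⟩, fun hc0 => ?_⟩
  · refine ⟨skipped _ rfl (fun r r4 r10 => ?_) ?_ fun v hv => ?_, by omega⟩
    · simp [State.setReg_reg, r4, show r ≠ 10 by omega, show r ≠ 14 by omega]
    · simp [State.setReg_reg]
    · rw [hv] at hl; simp at hl; omega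
  · have hl0 : s.mem (o + 3) (cand (s.reg 4 - 1) - 1) = 0 := by omega
    set r := cand (s.reg 4 - 1) - 1 with hr
    have hcr : cand (s.reg 4 - 1) = r + 1 := by omega
    have hadj := hcand _ hi r hcr
    have hc' : Core H cand nc (s.mem (o + 3)) (s.mem (o + 4)) (s.mem (o + 5)) (s.reg 5) (s.reg 5)
        (s.reg 5) := by
      have := hc
      rwa [e7, ← h.idle] at this
    -- Candidates of larger index were tried earlier and have labels; this becomes the field `first`
    -- of the new root.
    have hA := hc'.addRoot hl0 hadj hi hcr (fun j j1 j2 v hv => h.reached j j1 (by omega) v hv)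
    have hK := hS.keyed.push hc hl0
    rw [e7] at hK
    rw [← h.idle] at hK
    refine (runs_bfs (H := H) (cand := cand) (nc := nc) (tgt := tgt) hcsr ?_).mono ?_
    · constructor <;> simp only [State.setReg_reg, State.setReg_mem, State.setMem_reg,
        State.setMem_mem, Nat.reduceEqDiff, if_true, if_false, OfNat.one_ne_ofNat,
        Nat.add_left_cancel_iff, hS.reg_one, hS.reg_two, e7, ← h.idle]
      · exact hA
      · exact hK
      · rw [hS.count, ← h.idle]; omega
      · simp
      · simpa using hS.mem_zero
      · simpa using hS.mem_one
      · exact fun _ => id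
      · exact fun _ _ => trivial
      · exact fun _ _ => trivial
    · rintro t s' ⟨h1, h2, h3⟩
      have k4 := h1.frame_reg 4 (by omega)
      have km := h1.frame_mem
      have kr := h1.frame_reg
      have kk := h1.keep
      simp only [State.setReg_reg, State.setReg_mem, State.setMem_reg,
        State.setMem_mem, Nat.reduceEqDiff, if_true, if_false, 
        Nat.add_left_cancel_iff] at h3 k4 kk
      rw [pendingTime_update h.idle.le] at h3
      refine ⟨⟨⟨h1.core, h1.keyed, h1.count, h1.base, h1.mem_zero, h1.mem_one, h1.reg_one,
        h1.reg_two, fun _ => id, fun _ _ => rfl, fun _ _ => rfl⟩, h2, ?_, by omega, ?_, ?_, ?_⟩, ?_⟩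
      · rw [km _ (by omega)]
        simpa [State.setMem_mem, State.setReg_mem] using h.cand_eq
      · intro i i1 i2 v hv
        apply kk
        rw [update_apply]
        split_ifs with hvr
        · have := hc.one_le; omega
        · refine h.reached i i1 ?_ v hv
          by_contra h4
          obtain rfl : i = s.reg 4 - 1 := by omega
          omega
      · intro k hk
        rw [km k hk, ← h.frame_mem k hk]
        simp [State.setMem_mem, State.setReg_mem, show k ≠ o + 3 by omega, show k ≠ o + 4 by omega,
          show k ≠ o + 5 by omega]
      · intro i hi
        rw [kr i (by omega), ← h.frame_reg i hi]
        simp [State.setReg_reg, State.setMem_reg, show i ≠ 8 by omega, show i ≠ 6 by omega,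
          show i ≠ 14 by omega, show i ≠ 10 by omega, show i ≠ 4 by omega]
      · omega
  · refine ⟨skipped _ rfl (fun r r4 r10 => ?_) ?_ fun v hv => ?_, by omega⟩
    · simp [State.setReg_reg, r4, show r ≠ 10 by omega]
    · simp [State.setReg_reg]
    · omega

theorem core_init {lab side q : ℕ → ℕ} (h : ∀ v, lab v = 0) : Core H cand nc lab side q 1 1 1 := by
  constructor <;> first | omega | (intros; omega) | (intro v hv; exact absurd (h v) hv)

theorem keyed_init {lab q key rep : ℕ → ℕ} (h : ∀ k, rep k = 0) : Keyed H n lab q key rep 1 1 := by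
  constructor <;> first | omega | (intros; omega) | (intro v hv; exact absurd (h v) hv)

/-- What a breadth first search achieves. -/
structure Swept (H : SimpleGraph ℕ) (cand : ℕ → ℕ) (nc n : ℕ) (lab side key rep : ℕ → ℕ) : Prop where
  exists_queue : ∃ q T, Core H cand nc lab side q T T T ∧ Keyed H n lab q key rep T T
  reached : ∀ i < nc, ∀ v, cand i = v + 1 → lab v ≠ 0

theorem runs_sweep (hcsr : IsCSR H n off tgt)
    (hcand : ∀ i < s.reg 4, ∀ v, s.mem (o + 2) i = v + 1 → ∃ w, H.Adj v w)
    (h0 : s.mem 0 = off) (h1 : s.mem 1 = tgt) (hr1 : s.reg 1 = 1) (hr2 : s.reg 2 = 0)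
    (hlab : ∀ v, s.mem (o + 3) v = 0) (hrep : ∀ v, s.mem (o + 7) v = 0) :
    Runs (sweepProg o) s fun t s' =>
      Swept H (s.mem (o + 2)) (s.reg 4) n (s'.mem (o + 3)) (s'.mem (o + 4)) (s'.mem (o + 6))
        (s'.mem (o + 7)) ∧
      (∀ k, k < o + 3 ∨ o + 7 < k → s'.mem k = s.mem k) ∧ (∀ r < 4, s'.reg r = s.reg r) ∧
      t ≤ (∑ v ∈ Finset.range n, (40 + 30 * (off (v + 1) - off v))) + 25 * s.reg 4 + 5 := by
  simp only [sweepProg, block, runs_seq, runs_assign, Rhs.value]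
  refine (runs_loop (fun φ s' => Sweeping H (s.mem (o + 2)) (s.reg 4) n off tgt o s s' ∧
    φ = pendingTime n off (s'.mem (o + 5)) (s'.reg 5) + 25 * s'.reg 4) ?_ _ _ ⟨?_, rfl⟩).mono ?_
  · rintro φ s' ⟨h', rfl⟩ hlt
    have := h'.search.reg_two
    exact (runs_root hcsr hcand h' (by omega)).mono fun t s'' ⟨h1, h2⟩ => ⟨_, ⟨h1, rfl⟩, h2⟩
  · refine ⟨⟨?_, ?_, ?_, ?_, ?_, ?_, ?_, ?_, fun _ => id, fun _ _ => rfl, fun _ _ => rfl⟩, ?_, ?_, ?_,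
      ?_, ?_, ?_⟩ <;> simp only [State.setReg_reg, State.setReg_mem, Nat.reduceEqDiff, if_true,
        if_false, OfNat.one_ne_ofNat]
    · exact core_init hlab
    · exact keyed_init hrep
    · omega
    · exact h0
    · exact h1
    · exact hr1
    · exact hr2
    · exact le_rfl
    · intros; omega
    · exact fun _ _ => trivial
    · intro r hr
      rw [if_neg (by omega), if_neg (by omega), if_neg (by omega), if_neg (by omega)]
  · rintro t s' ⟨φ, ⟨h2, rfl⟩, hn, ht⟩
    have hS := h2.search
    have e7 : s'.reg 7 = s'.reg 5 := by
      have := hS.core.head_le; have := hS.core.lb_le; have := h2.idle; omega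
    have e4 : s'.reg 4 = 0 := by have := hS.reg_two; omega
    refine ⟨⟨⟨s'.mem (o + 5), s'.reg 5, ?_, ?_⟩, fun i hi v hv => h2.reached i hi (by omega) v hv⟩, h2.frame_mem,
      h2.frame_reg, ?_⟩
    · have := hS.core
      rwa [e7, ← h2.idle] at this
    · have := hS.keyed
      rwa [← h2.idle] at this
    · simp only [State.setReg_reg, State.setReg_mem, Nat.reduceEqDiff, if_true, if_false,
        pendingTime, Finset.Ico_self, Finset.image_empty, Finset.sdiff_empty] at ht
      omega

end SweepRuns

/-! ### Two searches yield a strong order -/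

section SweptFacts

variable {H : SimpleGraph ℕ} {cand : ℕ → ℕ} {nc n : ℕ} {lab side key rep : ℕ → ℕ}
  {c : ℕ → Bool} {p : ℕ → ℤ}

/-- The starting points of a breadth first search. -/
def BFSRoot (H : SimpleGraph ℕ) (cand : ℕ → ℕ) (nc : ℕ) (lab side : ℕ → ℕ) (r : ℕ) : Prop :=
  ∃ T, IsBFSRoot H cand nc lab side T r

/-- Every component contains a candidate. -/
def Covers (H : SimpleGraph ℕ) (cand : ℕ → ℕ) (nc : ℕ) : Prop :=
  ∀ v w, H.Adj v w → ∃ i < nc, ∃ u, cand i = u + 1 ∧ H.Reachable u v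

namespace Swept

theorem done (h : Swept H cand nc n lab side key rep) {u v : ℕ} (hu : lab u ≠ 0) (hv : H.Adj u v) :
    lab v ≠ 0 ∧ ∀ w, lab u < lab w → lab v ≤ lab w := by
  obtain ⟨⟨q, T, hc, -⟩, -⟩ := h
  obtain ⟨i, i1, i2, rfl⟩ := hc.q_surj u hu
  exact hc.done i i1 i2 v hv

theorem lab_ne (h : Swept H cand nc n lab side key rep) (hcov : Covers H cand nc) {v w : ℕ}
    (hv : H.Adj v w) : lab v ≠ 0 := by
  obtain ⟨i, hi, u, hu, ⟨q⟩⟩ := hcov v w hv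
  have hlu := h.reached i hi u hu
  clear hv hu
  induction q with
  | nil => exact hlu
  | cons e _ ih => exact ih (h.done hlu e).1

theorem layering (h : Swept H cand nc n lab side key rep) (hcov : Covers H cand nc) :
    Layering H lab (BFSRoot H cand nc lab side) where
  next := fun huv _ h2 => (h.done (h.lab_ne hcov huv) huv).2 _ h2
  parent := fun {v w} hv => by
    obtain ⟨⟨q, T, hc, -⟩, -⟩ := id h
    rcases hc.parent v (h.lab_ne hcov hv) with hr | ⟨u, h1, h2, h3, -⟩
    · exact .inl ⟨T, hr⟩
    · exact .inr ⟨u, h1, h3⟩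
  root_closed := fun ⟨_, hr⟩ huv hlt => (hr.closed _ _ huv (h.lab_ne hcov huv) hlt).2
  root_unique := fun ⟨_, hr⟩ hw => hr.unique _ hw

theorem parent_side (h : Swept H cand nc n lab side key rep) (hcov : Covers H cand nc) {v w : ℕ}
    (hv : H.Adj v w) : BFSRoot H cand nc lab side v ∨
      ∃ u, H.Adj u v ∧ lab u < lab v ∧ side u + side v = 1 := by
  obtain ⟨⟨q, T, hc, -⟩, -⟩ := id h
  rcases hc.parent v (h.lab_ne hcov hv) with hr | ⟨u, h1, h2, h3, h4⟩
  · exact .inl ⟨T, hr⟩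
  · exact .inr ⟨u, h1, h3, h4⟩

/-- Sides start with `0` at a root and alternate from parent to child, so they record the colour
relative to the root. -/
theorem side_spec (h : Swept H cand nc n lab side key rep) (hcov : Covers H cand nc)
    (hs : StrongOrder H c p) {v w : ℕ} (hv : H.Adj v w) :
    ∃ r, BFSRoot H cand nc lab side r ∧ H.Reachable r v ∧ side v ≤ 1 ∧ (side v = 0 ↔ c v = c r) := by
  induction hk : lab v using Nat.strong_induction_on generalizing v w with
  | _ k ih =>
  rcases h.parent_side hcov hv with hr | ⟨u, hu, huv, hsd⟩
  · obtain ⟨T, hr'⟩ := id hr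
    exact ⟨v, hr, .refl _, by rw [hr'.side_eq]; omega, by simp [hr'.side_eq]⟩
  · obtain ⟨r, hr, hru, h1, h2⟩ := ih _ (by omega) hu rfl
    refine ⟨r, hr, hru.trans hu.reachable, by omega, ?_⟩
    have hcol := hs.color hu
    rw [show side v = 0 ↔ ¬ side u = 0 by omega, h2]
    cases h3 : c u <;> cases h4 : c v <;> cases h5 : c r <;> simp_all

theorem side_eq_iff (h : Swept H cand nc n lab side key rep) (hcov : Covers H cand nc)
    (hs : StrongOrder H c p) {u v u' v' : ℕ} (hu : H.Adj u u') (hv : H.Adj v v')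
    (hre : H.Reachable u v) : side u = side v ↔ c u = c v := by
  obtain ⟨r, hr, hru, h1, h2⟩ := h.side_spec hcov hs hu
  obtain ⟨r', hr', hrv, h3, h4⟩ := h.side_spec hcov hs hv
  obtain rfl := (h.layering hcov).root_eq hr hr' (hru.trans (hre.trans hrv.symm))
  rw [show side u = side v ↔ (side u = 0 ↔ side v = 0) by omega, h2, h4]
  cases h5 : c u <;> cases h6 : c v <;> cases h7 : c r <;> simp

theorem side_add (h : Swept H cand nc n lab side key rep) (hcov : Covers H cand nc)
    (hs : StrongOrder H c p) {u v : ℕ} (hu : H.Adj u v) : side u + side v = 1 := by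
  obtain ⟨r, hr, hru, h1, h2⟩ := h.side_spec hcov hs hu
  obtain ⟨r', hr', hrv, h3, h4⟩ := h.side_spec hcov hs hu.symm
  have := (h.side_eq_iff hcov hs hu hu.symm hu.reachable).not.2 (hs.color hu)
  omega

/-- The queue enumerates the labelled vertices bijectively, so counting labelled vertices amounts to
counting queue positions. -/
theorem card_visited {q : ℕ → ℕ} {T : ℕ} (hc : Core H cand nc lab side q T T T)
    (hlt : ∀ {u v}, H.Adj u v → u < n) {x : ℕ} (h2 : x ≤ T) (P : ℕ → Prop)
    [DecidablePred P] (hP : ∀ j, 1 ≤ j → j < T → (P (q j) ↔ j < x)) :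
    ((Finset.range n).filter fun w => lab w ≠ 0 ∧ P w).card = x - 1 := by
  rw [← Nat.card_Ico 1 x, ← Finset.card_image_of_injOn (s := Finset.Ico 1 x) (f := q)]
  · congr 1
    ext w
    simp only [Finset.mem_filter, Finset.mem_range, Finset.mem_image, Finset.mem_Ico]
    constructor
    · rintro ⟨-, h3, h4⟩
      obtain ⟨i, i1, i2, rfl⟩ := hc.q_surj w h3
      exact ⟨i, ⟨i1, (hP i i1 i2).1 h4⟩, rfl⟩
    · rintro ⟨i, ⟨i1, i2⟩, rfl⟩
      obtain ⟨w, hw⟩ := hc.q_adj i i1 (by omega)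
      exact ⟨hlt hw, hc.q_lab i i1 (by omega), (hP i i1 (by omega)).2 i2⟩
  · intro i hi j hj hij
    simp only [Finset.coe_Ico, Set.mem_Ico] at hi hj
    exact hc.q_inj i j hi.1 (by omega) hj.1 (by omega) hij

open Classical in
theorem layerKey (h : Swept H cand nc n lab side key rep) (hcov : Covers H cand nc)
    (hlt : ∀ {u v}, H.Adj u v → u < n) (hs : StrongOrder H c p) :
    LayerKey H (Finset.range n) lab key := by
  have hl := h.layering hcov
  have hne := fun {v w} => h.lab_ne (v := v) (w := w) hcov
  obtain ⟨⟨q, T, hc, hk⟩, -⟩ := h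
  refine ⟨fun hu => Finset.mem_range.2 (hlt hu), hne, fun {u v} hu => ?_, fun {u v} hu => ?_⟩
  · obtain ⟨i, i1, i2, rfl⟩ := hc.q_surj u (hne hu)
    have := hc.self_le i1 i2
    have := hne hu
    rw [card_visited hc hlt (x := lab (q i)) (by omega) (fun w => lab w < lab (q i))
      (fun j j1 j2 => hc.lab_lt j i j1 j2 i1 i2)]
    omega
  · obtain ⟨i, i1, i2, rfl⟩ := hc.q_surj u (hne hu)
    obtain ⟨x, x0, x1, x2, x3⟩ := hk.key_eq i i1 i2
    rw [card_visited hc hlt x1 (fun w => lab w ≤ lab (q i)) x2, x3, Nat.add_sub_cancel' x0]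
    -- The program counts neighbours with label at least that of the vertex; adjacent vertices never
    -- share a label, so `≤` and `<` count the same.
    congr 3
    apply Finset.filter_congr
    intro w _
    refine and_congr_right fun hw => ?_
    have := hl.lab_ne hs hw
    omega

/-- Labels are at most `n`, layer ends at most `n + 1` and degrees at most `n`, so keys are at most
`5 n + 2`. This keeps the array of representatives, which sorts the keys, of linear size. -/
theorem key_lt (h : Swept H cand nc n lab side key rep) (hcov : Covers H cand nc)
    (hlt : ∀ {u v}, H.Adj u v → u < n) {u v : ℕ} (hu : H.Adj u v) : key u < 6 * n + 6 := by
  classical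
  have hne := h.lab_ne hcov hu
  obtain ⟨⟨q, T, hc, hk⟩, -⟩ := h
  obtain ⟨i, i1, i2, rfl⟩ := hc.q_surj u hne
  obtain ⟨x, x0, x1, x2, x3⟩ := hk.key_eq i i1 i2
  have h1 := card_visited hc hlt (le_refl T) (fun _ => True) (fun j j1 j2 => by simp [j2])
  have h2 := Finset.card_filter_le (Finset.range n) (fun w => lab w ≠ 0 ∧ True)
  have h3 := Finset.card_filter_le (Finset.range n)
    (fun v => H.Adj (q i) v ∧ lab (q i) ≤ lab v)
  rw [Finset.card_range] at h2 h3
  have h4 := hc.self_le i1 i2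
  rw [x3]
  omega

theorem rep_spec (h : Swept H cand nc n lab side key rep) {k : ℕ} (hk : rep k ≠ 0) :
    ∃ u, (∃ w, H.Adj u w) ∧ rep k = u + 1 ∧ key u = k := by
  obtain ⟨⟨q, T, hc, hk'⟩, -⟩ := h
  obtain ⟨i, i1, i2, i3, i4⟩ := hk'.rep_spec k hk
  exact ⟨_, hc.q_adj i i1 i2, i3, i4⟩

theorem rep_ne (h : Swept H cand nc n lab side key rep) (hcov : Covers H cand nc) {u v : ℕ}
    (hu : H.Adj u v) : rep (key u) ≠ 0 := by
  have hne := h.lab_ne hcov hu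
  obtain ⟨⟨q, T, hc, hk⟩, -⟩ := h
  obtain ⟨i, i1, i2, rfl⟩ := hc.q_surj u hne
  exact hk.rep_ne i i1 i2

variable {nc' : ℕ} {lab' side' key' rep' : ℕ → ℕ}

theorem exists_rep (h : Swept H cand nc n lab side key rep) (hcov : Covers H cand nc)
    (hlt : ∀ {u v}, H.Adj u v → u < n) (hs : StrongOrder H c p) {v w : ℕ} (hv : H.Adj v w) :
    ∃ u, rep (key v) = u + 1 ∧ (∃ x, H.Adj u x) ∧ H.Reachable u v ∧ key u = key v := by
  obtain ⟨u, ⟨x, hx⟩, h1, h2⟩ := h.rep_spec (h.rep_ne hcov hv)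
  have hl := h.layering hcov
  exact ⟨u, h1, ⟨x, hx⟩, (hl.same_layer hs _ rfl hx hv
    (hl.lab_eq_of_key_eq (h.layerKey hcov hlt hs) hx hv h2)).1, h2⟩

theorem covers_rep (h : Swept H cand nc n lab side key rep) (hcov : Covers H cand nc)
    (hlt : ∀ {u v}, H.Adj u v → u < n) (hs : StrongOrder H c p) : Covers H rep (6 * n + 6) := by
  intro v w hv
  obtain ⟨u, h1, -, h2, -⟩ := h.exists_rep hcov hlt hs hv
  exact ⟨key v, h.key_lt hcov hlt hv, u, h1, h2⟩

/-- A second search, whose candidates are the vertices in the order of the first one, starts at end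
vertices only. -/
theorem isEnd_of_rep (h : Swept H cand nc n lab side key rep) (hcov : Covers H cand nc)
    (hlt : ∀ {u v}, H.Adj u v → u < n) (hs : StrongOrder H c p) (hinj : p.Injective)
    (h' : Swept H rep (6 * n + 6) n lab' side' key' rep') {r : ℕ}
    (hr : BFSRoot H rep (6 * n + 6) lab' side' r) :
    IsEnd H c p r ∨ IsEnd H c (fun v => - p v) r := by
  have hl := h.layering hcov
  have hl' := h'.layering (h.covers_rep hcov hlt hs)
  have hk := h.layerKey hcov hlt hs
  obtain ⟨T, hr'⟩ := id hr
  obtain ⟨r', hadj⟩ := hr'.adj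
  obtain ⟨i, i1, i2, i3⟩ := hr'.first
  obtain ⟨r'', -, h1, h2⟩ := h.rep_spec (k := i) (by omega)
  obtain rfl : r'' = r := by omega
  refine hl.isEnd_or_isEnd_neg hk hs hinj hadj fun {u u'} hu hru => ?_
  by_contra hcon
  obtain ⟨v, hv, -, hvu, -⟩ := h.exists_rep hcov hlt hs hu
  -- A vertex of larger first key in the component would have its representative tried before `r`,
  -- so it would carry a smaller label than the root of its component.
  have := (i3 (key u) (h.key_lt hcov hlt hu) (by omega) v hv).2
  have := hl'.root_le hr (hru.trans hvu.symm)
  omega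

/-- The keys of the second search are a strong order of the whole graph. -/
theorem keyOrder (h : Swept H cand nc n lab side key rep) (hcov : Covers H cand nc)
    (hlt : ∀ {u v}, H.Adj u v → u < n) (hs : StrongOrder H c p) (hinj : p.Injective)
    (h' : Swept H rep (6 * n + 6) n lab' side' key' rep') :
    KeyOrder H side' key' ∧
      ∀ {u v u' v'}, H.Adj u v → H.Adj u' v' → key' u = key' u' → side' u = side' u' := by
  have hcov' := h.covers_rep hcov hlt hs
  have hl' := h'.layering hcov'
  have hk' := h'.layerKey hcov' hlt hs
  -- Each root is an end of the order or of its reverse; reversing the order in some components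
  -- makes all of them ends at once.
  obtain ⟨p', hs', he⟩ := hs.exists_isEnd hl'
    fun r hr => h.isEnd_of_rep hcov hlt hs hinj h' hr
  refine ⟨⟨fun huv => h'.side_add hcov' hs huv, fun {u u' v v'} hsd hu hv h1 h2 =>
    hl'.cross_key hk' hs' he (fun hre => ?_) hu hv h1 h2⟩, fun {u v u' v'} h1 h2 h3 => ?_⟩
  · exact (h'.side_eq_iff hcov' hs h1 h2 hre).1 hsd
  · have := hl'.same_layer hs _ rfl h1 h2 (hl'.lab_eq_of_key_eq hk' h1 h2 h3)
    exact (h'.side_eq_iff hcov' hs h1 h2 this.1).2 this.2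

end Swept

end SweptFacts

/-! ### The graph of keys and its tables -/

section Scan

open Function (update update_self update_of_ne update_apply)

/-- Vertices of one side with equal keys may be placed in either order, so uncrossing applies both
ways and makes them twins. -/
theorem KeyOrder.adj_of_key_eq {V : Type*} {H : SimpleGraph V} {side key : V → ℕ}
    (h : KeyOrder H side key) {u v u' v' : V} (hu : H.Adj u v) (hu' : H.Adj u' v')
    (hs : side u = side u') (hk : key u = key u') : H.Adj u v' := by
  rcases le_total (key v) (key v') with hle | hle
  · exact (h.cross hs.symm hk.ge hle hu' hu).2
  · exact (h.cross hs hk.le hle hu hu').1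

/-- The graph on the keys of the vertices. -/
def keyGraph (H : SimpleGraph ℕ) (key : ℕ → ℕ) : SimpleGraph ℕ where
  Adj k l := k ≠ l ∧ ∃ u v, H.Adj u v ∧ key u = k ∧ key v = l
  symm := ⟨fun _ _ ⟨hne, u, v, h, hu, hv⟩ => ⟨hne.symm, v, u, h.symm, hv, hu⟩⟩
  loopless := ⟨fun _ h => h.1 rfl⟩

/-- The keys below `K` are ordered, vertices of the same key have the same neighbours, and `rep`
finds a vertex for each key. -/
structure Reps (H : SimpleGraph ℕ) (side key rep : ℕ → ℕ) (K : ℕ) : Prop where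
  order : KeyOrder H side key
  side_eq : ∀ {u v u' v'}, H.Adj u v → H.Adj u' v' → key u = key u' → side u = side u'
  key_lt : ∀ {u v}, H.Adj u v → key u < K
  rep_spec : ∀ {k}, rep k ≠ 0 → ∃ u, (∃ w, H.Adj u w) ∧ rep k = u + 1 ∧ key u = k
  rep_ne : ∀ {u v}, H.Adj u v → rep (key u) ≠ 0

namespace Reps

variable {H : SimpleGraph ℕ} {side key rep : ℕ → ℕ} {K : ℕ}

theorem adj_key (h : Reps H side key rep K) {u v : ℕ} (hu : H.Adj u v) : (keyGraph H key).Adj (key u) (key v) := by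
  refine ⟨fun he => ?_, u, v, hu, rfl, rfl⟩
  have := h.order.side_add hu
  have := h.side_eq hu hu.symm he
  omega

theorem lt (h : Reps H side key rep K) {k l : ℕ} (hk : (keyGraph H key).Adj k l) : k < K := by
  obtain ⟨-, u, v, hu, rfl, rfl⟩ := hk
  exact h.key_lt hu

theorem exists_rep (h : Reps H side key rep K) {k l : ℕ} (hk : (keyGraph H key).Adj k l) :
    ∃ u, rep k = u + 1 ∧ key u = k ∧ ∃ w, H.Adj u w := by
  obtain ⟨-, u, v, hu, rfl, rfl⟩ := hk
  obtain ⟨w, h1, h2, h3⟩ := h.rep_spec (h.rep_ne hu)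
  exact ⟨w, h2, h3, h1⟩

/-- The adjacency list of a single vertex thus shows all neighbours of its key, and the scan may
read representatives only. -/
theorem adj_iff (h : Reps H side key rep K) {u w : ℕ} (hu : H.Adj u w) (l : ℕ) :
    (keyGraph H key).Adj (key u) l ↔ ∃ v, H.Adj u v ∧ key v = l := by
  constructor
  · rintro ⟨-, u', v, huv, he, rfl⟩
    exact ⟨v, h.order.adj_of_key_eq hu huv (h.side_eq hu huv he.symm) he.symm, rfl⟩
  · rintro ⟨v, hv, rfl⟩
    exact h.adj_key hv

theorem side_rep (h : Reps H side key rep K) {u v : ℕ} (hu : H.Adj u v) : side (rep (key u) - 1) = side u := by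
  obtain ⟨w, ⟨x, h1⟩, h2, h3⟩ := h.rep_spec (h.rep_ne hu)
  rw [h2, Nat.add_sub_cancel]
  exact h.side_eq h1 hu h3

theorem keyOrder (h : Reps H side key rep K) : KeyOrder (keyGraph H key) (fun k => side (rep k - 1)) id where
  side_add := by
    rintro _ _ ⟨-, u, v, hu, rfl, rfl⟩
    simp only [h.side_rep hu, h.side_rep hu.symm]
    exact h.order.side_add hu
  cross := by
    rintro _ _ _ _ hs h1 h2 ⟨-, u, v, hu, rfl, rfl⟩ ⟨-, u', v', hu', rfl, rfl⟩
    simp only [h.side_rep hu, h.side_rep hu'] at hs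
    have := h.order.cross hs h1 h2 hu hu'
    exact ⟨h.adj_key this.1, h.adj_key this.2⟩

open Classical in
/-- Distinct keys have distinct representatives. -/
theorem sum_rep_le (h : Reps H side key rep K) {n : ℕ} (hlt : ∀ {u v}, H.Adj u v → u < n) (f : ℕ → ℕ) (K' : ℕ) :
    (∑ k ∈ Finset.range K', if rep k = 0 then 0 else f (rep k - 1)) ≤
      ∑ v ∈ Finset.range n, f v := by
  simp only [← ite_not (rep _ = 0)]
  rw [← Finset.sum_filter, ← Finset.sum_image (f := f) (g := fun k => rep k - 1)]
  · refine Finset.sum_le_sum_of_subset fun v hv => ?_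
    simp only [Finset.mem_image, Finset.mem_filter, Finset.mem_range] at hv ⊢
    obtain ⟨k, ⟨-, hk⟩, rfl⟩ := hv
    obtain ⟨u, ⟨w, h1⟩, h2, -⟩ := h.rep_spec hk
    rw [h2]
    exact hlt h1
  · intro k hk l hl hkl
    simp only [Finset.coe_filter, Set.mem_ofPred_eq] at hk hl
    obtain ⟨u, -, h2, rfl⟩ := h.rep_spec hk.2
    obtain ⟨u', -, h2', rfl⟩ := h.rep_spec hl.2
    simp only [h2, h2', Nat.add_sub_cancel] at hkl
    rw [hkl]

end Reps

/-- The tables for the keys from `m` on; `cur c` is the least such key on side `c`. -/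
structure TablesFrom (E : SimpleGraph ℕ) (sd : ℕ → ℕ) (K m : ℕ) (hi lo suc nw : ℕ → ℕ)
    (cur : ℕ → ℕ) : Prop where
  hi_adj : ∀ {k l}, m ≤ k → E.Adj k l → E.Adj k (hi k)
  le_hi : ∀ {k l}, m ≤ k → E.Adj k l → l ≤ hi k
  lo_adj : ∀ {k l}, m ≤ k → E.Adj k l → E.Adj k (lo k)
  lo_le : ∀ {k l}, m ≤ k → E.Adj k l → lo k ≤ l
  suc_cases : ∀ {k l}, m ≤ k → E.Adj k l →
    suc k = K ∨ k < suc k ∧ sd (suc k) = sd k ∧ ∃ l', E.Adj (suc k) l'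
  suc_le : ∀ {k l k' l'}, m ≤ k → E.Adj k l → E.Adj k' l' → sd k' = sd k → k < k' → suc k ≤ k'
  nw_cases : ∀ {k l}, m ≤ k → E.Adj k l →
    nw k = K ∨ k < nw k ∧ sd (nw k) = sd k ∧ hi k < hi (nw k) ∧ ∃ l', E.Adj (nw k) l'
  nw_le : ∀ {k l k' l'}, m ≤ k → E.Adj k l → E.Adj k' l' → sd k' = sd k → k < k' →
    hi k < hi k' → nw k ≤ k'
  hi_top : hi K = K
  lo_top : lo K = K
  cur_cases : ∀ c ≤ 1, cur c = K ∨ m ≤ cur c ∧ sd (cur c) = c ∧ ∃ l, E.Adj (cur c) l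
  cur_le : ∀ {k l}, m ≤ k → E.Adj k l → cur (sd k) ≤ k

namespace TablesFrom

variable {E : SimpleGraph ℕ} {sd : ℕ → ℕ} {K m : ℕ} {hi lo suc nw cur : ℕ → ℕ}

theorem init (hlt : ∀ {k l}, E.Adj k l → k < K) (hhi : hi K = K) (hlo : lo K = K)
    (hcur : ∀ c ≤ 1, cur c = K) : TablesFrom E sd K K hi lo suc nw cur := by
  constructor
  case hi_top => exact hhi
  case lo_top => exact hlo
  case cur_cases => exact fun c hc => .inl (hcur c hc)
  all_goals
    intro k l
    first
    | intro h1 h2; have := hlt h2; omega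
    | intro _ _ h1 h2; have := hlt h2; omega

theorem skip (h : TablesFrom E sd K (m + 1) hi lo suc nw cur) (hm : ∀ l, ¬ E.Adj m l) :
    TablesFrom E sd K m hi lo suc nw cur := by
  have hne : ∀ {k l}, m ≤ k → E.Adj k l → m + 1 ≤ k := fun {k l} h1 h2 => by
    rcases h1.eq_or_lt with rfl | h1
    · exact absurd h2 (hm l)
    · exact h1
  exact {
    hi_adj := fun h1 h2 => h.hi_adj (hne h1 h2) h2
    le_hi := fun h1 h2 => h.le_hi (hne h1 h2) h2
    lo_adj := fun h1 h2 => h.lo_adj (hne h1 h2) h2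
    lo_le := fun h1 h2 => h.lo_le (hne h1 h2) h2
    suc_cases := fun h1 h2 => h.suc_cases (hne h1 h2) h2
    suc_le := fun h1 h2 => h.suc_le (hne h1 h2) h2
    nw_cases := fun h1 h2 => h.nw_cases (hne h1 h2) h2
    nw_le := fun h1 h2 => h.nw_le (hne h1 h2) h2
    hi_top := h.hi_top
    lo_top := h.lo_top
    cur_cases := fun c hc => (h.cur_cases c hc).imp_right fun h1 => ⟨by omega, h1.2⟩
    cur_le := fun h1 h2 => h.cur_le (hne h1 h2) h2 }

/-- By monotonicity of `hi`, the next key `cur (sd m)` of the side satisfies `x ≤ hi`. If the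
inequality is strict, it is the entry `nw m`; in case of equality the entry of that key can be
copied. -/
theorem step (h : TablesFrom E sd K (m + 1) hi lo suc nw cur) (ho : KeyOrder E sd id)
    (hlt : ∀ {k l}, E.Adj k l → k < K) {x y : ℕ} (hx : E.Adj m x) (hx' : ∀ l, E.Adj m l → l ≤ x)
    (hy : E.Adj m y) (hy' : ∀ l, E.Adj m l → y ≤ l) :
    TablesFrom E sd K m (update hi m x) (update lo m y) (update suc m (cur (sd m)))
      (update nw m (if x < hi (cur (sd m)) then cur (sd m) else nw (cur (sd m))))
      (update cur (sd m) m) := by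
  have hmK := hlt hx
  have hsd : sd m ≤ 1 := by have := ho.side_add hx; omega
  have hc := h.cur_cases _ hsd
  have hcm : m < cur (sd m) := by
    rcases hc with h1 | h1 <;> omega
  have up : ∀ {k} (f : ℕ → ℕ) (v : ℕ), m < k → update f m v k = f k :=
    fun f v hk => update_of_ne hk.ne' ..
  have split : ∀ {k}, m ≤ k → k = m ∨ m + 1 ≤ k := fun hk => by omega
  have key : ∀ {k l}, m < k → E.Adj k l → sd k = sd m → x ≤ hi k := fun {k l} hk h1 h2 => by
    by_contra h3
    have := (ho.cross h2.symm hk.le (by simp only [id]; omega : id (hi k) ≤ id x) hx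
      (h.hi_adj hk h1)).2
    have := h.le_hi hk this
    omega
  refine ⟨?_, ?_, ?_, ?_, ?_, ?_, ?_, ?_, ?_, ?_, ?_, ?_⟩
  · intro k l h1 h2
    rcases split h1 with rfl | h3
    · rw [update_self]; exact hx
    · rw [up _ _ h3]; exact h.hi_adj h3 h2
  · intro k l h1 h2
    rcases split h1 with rfl | h3
    · rw [update_self]; exact hx' l h2
    · rw [up _ _ h3]; exact h.le_hi h3 h2
  · intro k l h1 h2
    rcases split h1 with rfl | h3
    · rw [update_self]; exact hy
    · rw [up _ _ h3]; exact h.lo_adj h3 h2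
  · intro k l h1 h2
    rcases split h1 with rfl | h3
    · rw [update_self]; exact hy' l h2
    · rw [up _ _ h3]; exact h.lo_le h3 h2
  · intro k l h1 h2
    rcases split h1 with rfl | h3
    · rw [update_self]; exact hc.imp_right fun h3 => ⟨hcm, h3.2⟩
    · rw [up _ _ h3]; exact h.suc_cases h3 h2
  · intro k l k' l' h1 h2 h4 h5 h6
    rcases split h1 with rfl | h3
    · rw [update_self, ← h5]; exact h.cur_le h6 h4
    · rw [up _ _ h3]; exact h.suc_le h3 h2 h4 h5 h6
  · intro k l h1 h2
    rcases split h1 with rfl | h3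
    · rw [update_self, update_self]
      split_ifs with h4
      · rcases hc with h5 | ⟨h5, h6, h7⟩
        · exact .inl h5
        · exact .inr ⟨hcm, h6, by rw [up _ _ hcm]; exact h4, h7⟩
      · rcases hc with h5 | ⟨h5, h6, l', h7⟩
        -- `hi K = K` exceeds every key, so without a next key the test succeeds and the entry
        -- becomes `K`.
        · rw [h5, h.hi_top] at h4; exact absurd (hlt hx.symm) h4
        · rcases h.nw_cases h5 h7 with h8 | ⟨h8, h9, h10, h11⟩
          · exact .inl h8
          · have := key hcm h7 h6
            exact .inr ⟨by omega, h9.trans h6, by rw [up _ _ (by omega)]; omega, h11⟩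
    · rw [up _ _ h3, up _ _ h3]
      refine (h.nw_cases h3 h2).imp_right fun h4 => ?_
      rw [up _ _ (by omega)]
      exact h4
  · intro k l k' l' h1 h2 h4 h5 h6 h7
    rw [up hi x (show m < k' by omega)] at h7
    rcases split h1 with rfl | h3
    · rw [update_self] at h7 ⊢
      have hle := h.cur_le h6 h4
      rw [h5] at hle
      split_ifs with h8
      · exact hle
      · rcases hc with h9 | ⟨h9, h10, l'', h11⟩
        · have := hlt h4; omega
        · have hne : cur (sd k) ≠ k' := fun e => h8 (e ▸ h7)
          exact h.nw_le h9 h11 h4 (h5.trans h10.symm) (by omega) (by omega)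
    · rw [up _ _ h3] at h7 ⊢
      exact h.nw_le h3 h2 h4 h5 h6 h7
  · rw [up _ _ hmK, h.hi_top]
  · rw [up _ _ hmK, h.lo_top]
  · intro c hc
    rw [update_apply]
    split_ifs with h1
    · exact .inr ⟨le_rfl, h1.symm, x, hx⟩
    · exact (h.cur_cases c hc).imp_right fun h2 => ⟨by omega, h2.2⟩
  · intro k l h1 h2
    rw [update_apply]
    split_ifs with h3
    · exact h1
    · rcases split h1 with rfl | h4
      · exact absurd rfl h3
      · exact h.cur_le h4 h2

theorem tables (h : TablesFrom E sd K 0 hi lo suc nw cur) (ho : KeyOrder E sd id)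
    (hlt : ∀ {k l}, E.Adj k l → k < K) : Tables E sd K hi lo suc nw where
  order := ho
  lt := hlt
  hi_adj := h.hi_adj (Nat.zero_le _)
  le_hi := h.le_hi (Nat.zero_le _)
  lo_adj := h.lo_adj (Nat.zero_le _)
  lo_le := h.lo_le (Nat.zero_le _)
  suc_cases := h.suc_cases (Nat.zero_le _)
  suc_le := h.suc_le (Nat.zero_le _)
  nw_cases := h.nw_cases (Nat.zero_le _)
  nw_le := h.nw_le (Nat.zero_le _)
  lo_top := h.lo_top

theorem isLeastEdge (h : TablesFrom E sd K 0 hi lo suc nw cur) (ho : KeyOrder E sd id)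
    (hlt : ∀ {k l}, E.Adj k l → k < K) : Tables.IsLeastEdge E sd K (cur 0) (cur 1) := by
  have hle : ∀ {x y}, E.Adj x y → sd x = 0 → cur 0 ≤ x ∧ cur 1 ≤ y := fun {x y} h1 h2 => by
    have h3 := ho.side_add h1
    have h4 := h.cur_le (Nat.zero_le _) h1
    have h5 := h.cur_le (Nat.zero_le _) h1.symm
    rw [h2] at h4
    rw [show sd y = 1 by omega] at h5
    exact ⟨h4, h5⟩
  refine ⟨?_, hle⟩
  rcases h.cur_cases 0 (by omega) with h0 | ⟨-, h0, y, h0'⟩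
  · rcases h.cur_cases 1 le_rfl with h1 | ⟨-, h1, x, h1'⟩
    · exact .inl ⟨h0, h1⟩
    · have := ho.side_add h1'
      have := (hle h1'.symm (by omega)).1
      have := hlt h1'.symm
      omega
  · rcases h.cur_cases 1 le_rfl with h1 | ⟨-, h1, x, h1'⟩
    · have := (hle h0' h0).2
      have := hlt h0'.symm
      omega
    · have := ho.side_add h1'
      -- The least keys of the two sides are adjacent: edges at them cross or coincide, and
      -- uncrossing joins the two.
      exact .inr ⟨(ho.cross (by omega : sd (cur 0) = sd x) (hle h1'.symm (by omega)).1
        (hle h0' h0).2 h0' h1'.symm).1, h0⟩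

end TablesFrom

end Scan

/-! ### Initialization and extreme neighbours -/

section ScanProgram

open RAM
open Function (update update_self update_of_ne update_apply)

/-- Register `3` gets the value `6 n + 6`, and array `2` lists the vertices with a neighbour. -/
def initProg : Prog := block [
  .assign 3 (.add 3 1), .assign 3 (.add 3 1), .assign 3 (.add 3 1),
  .assign 3 (.add 3 1), .assign 3 (.add 3 1), .assign 3 (.add 3 1),
  .loop 4 0 (block [
    .assign 5 (.load 0 4),
    .assign 6 (.add 4 1),
    .assign 7 (.load 0 6),
    .ite 5 7 (.store 2 4 6) .skip,
    .assign 4 (.copy 6),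
    .assign 3 (.add 3 1), .assign 3 (.add 3 1), .assign 3 (.add 3 1),
    .assign 3 (.add 3 1), .assign 3 (.add 3 1), .assign 3 (.add 3 1)])]

/-- Cells of array `2` hold a vertex plus one, so that `0` marks a vertex without neighbours.
Register `3` reaches `6 n + 6` by six increments per vertex. -/
structure Initializing (off : ℕ → ℕ) (s₀ s : State) : Prop where
  le : s.reg 4 ≤ s₀.reg 0
  three : s.reg 3 = 6 * s.reg 4 + 6
  reg_zero : s.reg 0 = s₀.reg 0
  reg_one : s.reg 1 = 1
  reg_two : s.reg 2 = 0
  cand : ∀ i, s.mem 2 i = if i < s.reg 4 ∧ off i < off (i + 1) then i + 1 else 0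
  mem_zero : s.mem 0 = off
  frame : ∀ k, k ≠ 2 → s.mem k = s₀.mem k

theorem runs_init {off : ℕ → ℕ} {s : State} (h0 : s.mem 0 = off) (h2 : ∀ i, s.mem 2 i = 0)
    (hr1 : s.reg 1 = 1) (hr2 : s.reg 2 = 0) (hr3 : s.reg 3 = 0) (hr4 : s.reg 4 = 0) :
    Runs initProg s fun t s' => Initializing off s s' ∧ s'.reg 4 = s.reg 0 ∧
      t ≤ 20 * s.reg 0 + 10 := by
  simp only [initProg, block, runs_seq, runs_assign, Rhs.value, State.setReg_reg,
    if_true, if_false, OfNat.one_ne_ofNat, hr1, hr3]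
  set s1 := ((((((s.setReg 3 (0 + 1)).setReg 3 (0 + 1 + 1)).setReg 3 (0 + 1 + 1 + 1)).setReg 3
    (0 + 1 + 1 + 1 + 1)).setReg 3 (0 + 1 + 1 + 1 + 1 + 1)).setReg 3 (0 + 1 + 1 + 1 + 1 + 1 + 1)) with hs1
  refine (runs_loop (fun φ s' => Initializing off s s' ∧ φ = 20 * (s.reg 0 - s'.reg 4)) ?_ _ s1
    ⟨?_, rfl⟩).mono ?_
  · rintro φ s' ⟨h, rfl⟩ hlt
    have := h.reg_zero
    simp only [runs_seq, runs_assign, runs_ite, runs_store, runs_skip, Rhs.value, State.setReg_reg,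
      State.setReg_mem, State.setMem_reg, Nat.reduceEqDiff, if_true, if_false,
      OfNat.one_ne_ofNat, h.reg_one, h.mem_zero]
    refine ⟨fun h1 => ⟨_, ⟨⟨?_, ?_, ?_, ?_, ?_, fun i => ?_, ?_, fun k hk => ?_⟩, rfl⟩, ?_⟩,
      fun h1 => ⟨_, ⟨⟨?_, ?_, ?_, ?_, ?_, fun i => ?_, ?_, fun k hk => ?_⟩, rfl⟩, ?_⟩⟩
    all_goals simp [State.setReg_reg, State.setReg_mem, State.setMem_reg, State.setMem_mem,
      h.reg_zero, h.reg_one, h.reg_two, h.three, h.mem_zero]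
    all_goals try omega
    · rw [update_apply, h.cand]
      have := h.cand i
      split_ifs <;> first | omega | (subst_vars; omega)
    · simp [hk, h.frame k hk]
    · rw [h.cand]
      split_ifs with h3 h4 h4 <;> try omega
      obtain rfl : i = s'.reg 4 := by omega
      omega
    · exact h.frame k hk
  · constructor
    all_goals simp [hs1, State.setReg_reg, State.setReg_mem, h0, h2, hr1, hr2, hr4]
  · rintro t s' ⟨φ, ⟨h, rfl⟩, hlt, ht⟩
    have := h.reg_zero
    have := h.le
    have h4 : s1.reg 4 = 0 := by simp [hs1, State.setReg_reg, hr4]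
    rw [h4] at ht
    exact ⟨h, by omega, by omega⟩

/-- The extreme keys among the neighbours in the slots from register `11` to register `12`. -/
def extremeProg : Prog := .loop 11 12 (block [
  .assign 15 (.load 1 11),
  .assign 16 (.load 11 15),
  .ite 13 16 (.assign 13 (.copy 16)) .skip,
  .ite 16 14 (.assign 14 (.copy 16)) .skip,
  .assign 11 (.add 11 1)])

/-- Here `a` is the first slot, and `0` and `K` are the starting values of the maximum and of the
minimum. -/
structure Extreme (f : ℕ → ℕ) (K a : ℕ) (s₀ s : State) : Prop where
  le : a ≤ s.reg 11
  le_limit : s.reg 11 ≤ s.reg 12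
  mem_eq : s.mem = s₀.mem
  reg_eq : ∀ r, r ≠ 11 → r ≠ 13 → r ≠ 14 → r ≠ 15 → r ≠ 16 → s.reg r = s₀.reg r
  le_hi : ∀ j, a ≤ j → j < s.reg 11 → f j ≤ s.reg 13
  lo_le : ∀ j, a ≤ j → j < s.reg 11 → s.reg 14 ≤ f j
  hi_cases : s.reg 13 = 0 ∨ ∃ j, a ≤ j ∧ j < s.reg 11 ∧ f j = s.reg 13
  lo_cases : s.reg 14 = K ∨ ∃ j, a ≤ j ∧ j < s.reg 11 ∧ f j = s.reg 14

theorem runs_extreme {s : State} (hle : s.reg 11 ≤ s.reg 12) (hr1 : s.reg 1 = 1)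
    (h13 : s.reg 13 = 0) :
    Runs extremeProg s fun t s' =>
      Extreme (fun j => s.mem 11 (s.mem 1 j)) (s.reg 14) (s.reg 11) s s' ∧ s'.reg 11 = s.reg 12 ∧
      t ≤ 10 * (s.reg 12 - s.reg 11) + 1 := by
  refine (runs_loop (fun φ s' => Extreme (fun j => s.mem 11 (s.mem 1 j)) (s.reg 14) (s.reg 11) s s' ∧
    φ = 10 * (s'.reg 12 - s'.reg 11)) ?_ _ s ⟨?_, rfl⟩).mono ?_
  · rintro φ s' ⟨h, rfl⟩ hlt
    have e1 := h.reg_eq 1 (by simp) (by simp) (by simp) (by simp) (by simp)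
    rw [hr1] at e1
    obtain ⟨i1, i2, i3, i4, i5, i6, i7, i8⟩ := h
    simp only [block, runs_seq, runs_assign, runs_ite, runs_skip, Rhs.value, State.setReg_reg,
      State.setReg_mem, Nat.reduceEqDiff, if_true, if_false, OfNat.one_ne_ofNat, e1, i3]
    have key : ∀ (s'' : State) (t : ℕ), s''.mem = s'.mem → s''.reg 11 = s'.reg 11 + 1 →
        (∀ r, r ≠ 11 → r ≠ 13 → r ≠ 14 → r ≠ 15 → r ≠ 16 → s''.reg r = s'.reg r) →
        s''.reg 13 = max (s'.reg 13) (s.mem 11 (s.mem 1 (s'.reg 11))) →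
        s''.reg 14 = min (s'.reg 14) (s.mem 11 (s.mem 1 (s'.reg 11))) → t ≤ 9 →
        ∃ φ', (Extreme (fun j => s.mem 11 (s.mem 1 j)) (s.reg 14) (s.reg 11) s s'' ∧
          φ' = 10 * (s''.reg 12 - s''.reg 11)) ∧ t + 1 + φ' ≤ 10 * (s'.reg 12 - s'.reg 11) := by
      intro s'' t k1 k2 k3 k4 k5 ht
      have e12 := k3 12 (by simp) (by simp) (by simp) (by simp) (by simp)
      refine ⟨_, ⟨⟨by omega, by omega, k1.trans i3, fun r a b c d e =>
        (k3 r a b c d e).trans (i4 r a b c d e), fun j j1 j2 => ?_, fun j j1 j2 => ?_, ?_, ?_⟩, rfl⟩,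
        by omega⟩
      · rw [k2] at j2
        rcases Nat.lt_succ_iff_lt_or_eq.1 j2 with j2 | rfl
        · have := i5 j j1 j2
          omega
        · omega
      · rw [k2] at j2
        rcases Nat.lt_succ_iff_lt_or_eq.1 j2 with j2 | rfl
        · have := i6 j j1 j2
          omega
        · omega
      · rcases le_total (s'.reg 13) (s.mem 11 (s.mem 1 (s'.reg 11))) with h1 | h1
        · exact .inr ⟨s'.reg 11, by omega, by omega, by omega⟩
        · rcases i7 with h2 | ⟨j, j1, j2, j3⟩
          · left; omega
          · exact .inr ⟨j, j1, by omega, by omega⟩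
      · rcases le_total (s'.reg 14) (s.mem 11 (s.mem 1 (s'.reg 11))) with h1 | h1
        · rcases i8 with h2 | ⟨j, j1, j2, j3⟩
          · left; omega
          · exact .inr ⟨j, j1, by omega, by omega⟩
        · exact .inr ⟨s'.reg 11, by omega, by omega, by omega⟩
    refine ⟨fun h1 => ⟨fun h2 => key _ _ rfl ?_ ?_ ?_ ?_ (by omega), fun h2 =>
      key _ _ rfl ?_ ?_ ?_ ?_ (by omega)⟩, fun h1 => ⟨fun h2 => key _ _ rfl ?_ ?_ ?_ ?_ (by omega),
      fun h2 => key _ _ rfl ?_ ?_ ?_ ?_ (by omega)⟩⟩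
    all_goals simp +contextual [State.setReg_reg]
    all_goals omega
  · exact ⟨le_rfl, hle, rfl, fun _ _ _ _ _ _ => rfl, by intros; omega, by intros; omega, .inl h13,
      .inl rfl⟩
  · rintro t s' ⟨φ, ⟨h, rfl⟩, hlt, ht⟩
    have := h.le_limit
    have e12 := h.reg_eq 12 (by simp) (by simp) (by simp) (by simp) (by simp)
    exact ⟨h, by omega, by omega⟩

end ScanProgram

/-! ### Filling the tables from the last key to the first -/

section ScanProgram

open RAM
open Function (update update_self update_of_ne update_apply)

/-- Enter key `4`, which is represented by the vertex in register `10`, into the tables. Registers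
`13` and `14` hold its extreme neighbours. -/
def enterProg : Prog := block [
  .store 13 4 13,
  .store 14 4 14,
  .assign 17 (.load 9 10),
  .ite 2 17 (.assign 18 (.copy 6)) (.assign 18 (.copy 5)),
  .store 15 4 18,
  .assign 20 (.load 13 18),
  .ite 13 20 .skip (.assign 18 (.load 16 18)),
  .store 16 4 18,
  .ite 2 17 (.assign 6 (.copy 4)) (.assign 5 (.copy 4))]

/-- Compute the tables, from the last key to the first. -/
def scanProg : Prog := block [
  .store 13 3 3,
  .store 14 3 3,
  .assign 4 (.copy 3),
  .assign 5 (.copy 3),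
  .assign 6 (.copy 3),
  .loop 2 4 (block [
    .assign 4 (.sub 4 1),
    .assign 7 (.load 12 4),
    .ite 2 7 (block [
      .assign 10 (.sub 7 1),
      .assign 11 (.load 0 10),
      .assign 12 (.load 0 7),
      .assign 13 (.const 0),
      .assign 14 (.copy 3),
      extremeProg,
      enterProg]) .skip])]

variable {E : SimpleGraph ℕ} {sd : ℕ → ℕ} {K : ℕ}

theorem runs_enter {s : State} (hr2 : s.reg 2 = 0) (hsd : sd (s.reg 4) = s.mem 9 (s.reg 10))
    (h : TablesFrom E sd K (s.reg 4 + 1) (s.mem 13) (s.mem 14) (s.mem 15) (s.mem 16)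
      fun c => s.reg (5 + c))
    (ho : KeyOrder E sd id) (hlt : ∀ {k l}, E.Adj k l → k < K) (h13 : E.Adj (s.reg 4) (s.reg 13))
    (h13' : ∀ l, E.Adj (s.reg 4) l → l ≤ s.reg 13) (h14 : E.Adj (s.reg 4) (s.reg 14))
    (h14' : ∀ l, E.Adj (s.reg 4) l → s.reg 14 ≤ l) :
    Runs enterProg s fun t s' =>
      TablesFrom E sd K (s'.reg 4) (s'.mem 13) (s'.mem 14) (s'.mem 15) (s'.mem 16)
        (fun c => s'.reg (5 + c)) ∧ (∀ k, k < 13 ∨ 16 < k → s'.mem k = s.mem k) ∧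
      (∀ r < 5, s'.reg r = s.reg r) ∧ t ≤ 12 := by
  have hstep := h.step ho hlt h13 h13' h14 h14'
  have hs1 := ho.side_add h13
  have hm := hlt h13
  have hcur : sd (s.reg 4) ≤ 1 := by omega
  have hcm : s.reg (5 + sd (s.reg 4)) ≠ s.reg 4 := by
    rcases h.cur_cases _ hcur with h1 | h1 <;> omega
  -- Symbolic execution is separated from the mathematics. Registers `5` and `6` hold the least key
  -- so far on side `0` and on side `1`, hence the index `5 + c`.
  have key : ∀ Q : ℕ → State → Prop, (∀ (s' : State) (t : ℕ), s'.reg 4 = s.reg 4 →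
      s'.mem 13 = update (s.mem 13) (s.reg 4) (s.reg 13) →
      s'.mem 14 = update (s.mem 14) (s.reg 4) (s.reg 14) →
      s'.mem 15 = update (s.mem 15) (s.reg 4) (s.reg (5 + sd (s.reg 4))) →
      s'.mem 16 = update (s.mem 16) (s.reg 4) (if s.reg 13 < s.mem 13 (s.reg (5 + sd (s.reg 4)))
        then s.reg (5 + sd (s.reg 4)) else s.mem 16 (s.reg (5 + sd (s.reg 4)))) →
      (∀ c ≤ 1, s'.reg (5 + c) = if c = sd (s.reg 4) then s.reg 4 else s.reg (5 + c)) →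
      (∀ k, k < 13 ∨ 16 < k → s'.mem k = s.mem k) → (∀ r < 5, s'.reg r = s.reg r) → t ≤ 12 → Q t s') →
      Runs enterProg s Q := by
    intro Q key
    simp only [enterProg, block, runs_seq, runs_assign, runs_ite, runs_store, runs_skip, Rhs.value,
      State.setReg_reg, State.setReg_mem, State.setMem_mem, State.setMem_reg, Nat.reduceEqDiff,
      if_true, if_false, hr2]
    refine ⟨fun h1 => ⟨fun h2 => ⟨fun h3 => ?_, fun h3 => ?_⟩, fun h2 => ⟨fun h3 => ?_, fun h3 => ?_⟩⟩,
      fun h1 => ⟨fun h2 => ⟨fun h3 => ?_, fun h3 => ?_⟩, fun h2 => ⟨fun h3 => ?_, fun h3 => ?_⟩⟩⟩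
    all_goals
      rw [← hsd] at h1 h3
      first
      | exact absurd h1 h3
      | exact absurd h3 h1
      | skip
    all_goals
      obtain ⟨c, hc, hc'⟩ : ∃ c ≤ 1, sd (s.reg 4) = c := ⟨_, hcur, rfl⟩
      interval_cases c
    all_goals
      rw [hc'] at hcm key h1
    all_goals
      first
      | omega
      | (rw [update_of_ne hcm] at h2
         refine key _ _ ?_ ?_ ?_ ?_ ?_ (fun c hc => ?_) (fun k hk => ?_) (fun r hr => ?_) (by omega))
    all_goals
      simp only [State.setReg_reg, State.setReg_mem, State.setMem_reg, State.setMem_mem,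
        Nat.reduceEqDiff, if_true, if_false]
    all_goals first
      | done
      | rw [if_pos h2]
      | rw [if_neg h2]
      | (interval_cases c <;> simp)
      | rw [if_neg (by omega), if_neg (by omega), if_neg (by omega), if_neg (by omega),
          if_neg (by omega)]
      | rw [if_neg (by omega), if_neg (by omega), if_neg (by omega), if_neg (by omega)]
  refine key _ fun s' t e4 e13 e14 e15 e16 ec em er ht => ?_
  refine ⟨?_, em, er, ht⟩
  rw [e4, e13, e14, e15, e16]
  exact { hstep with
    cur_cases := fun c hc => by
      have := hstep.cur_cases c hc
      rw [update_apply] at this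
      rwa [ec c hc]
    cur_le := fun {k l} h1 h2 => by
      have h3 := hstep.cur_le h1 h2
      have := ho.side_add h2
      rw [update_apply] at h3
      rwa [ec _ (by omega)] }

/-- Time for the keys below `k`. -/
def scanTime (off rep : ℕ → ℕ) (k : ℕ) : ℕ :=
  ∑ l ∈ Finset.range k, if rep l = 0 then 0 else 10 * (off (rep l - 1 + 1) - off (rep l - 1))

structure Scanning (E : SimpleGraph ℕ) (sd : ℕ → ℕ) (K : ℕ) (s₀ s : State) : Prop where
  le : s.reg 4 ≤ K
  tables : TablesFrom E sd K (s.reg 4) (s.mem 13) (s.mem 14) (s.mem 15) (s.mem 16)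
    fun c => s.reg (5 + c)
  frame_mem : ∀ k, k < 13 ∨ 16 < k → s.mem k = s₀.mem k
  frame_reg : ∀ r < 4, s.reg r = s₀.reg r

theorem runs_scan {H : SimpleGraph ℕ} {n : ℕ} {s : State} (hcsr : IsCSR H n (s.mem 0) (s.mem 1))
    (h : Reps H (s.mem 9) (s.mem 11) (s.mem 12) (s.reg 3)) (hr1 : s.reg 1 = 1)
    (hr2 : s.reg 2 = 0) :
    Runs scanProg s fun t s' => ∃ cur : ℕ → ℕ, cur 0 = s'.reg 5 ∧ cur 1 = s'.reg 6 ∧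
      TablesFrom (keyGraph H (s.mem 11)) (fun k => s.mem 9 (s.mem 12 k - 1)) (s.reg 3) 0
        (s'.mem 13) (s'.mem 14) (s'.mem 15) (s'.mem 16) cur ∧
      (∀ k, k < 13 ∨ 16 < k → s'.mem k = s.mem k) ∧ (∀ r < 4, s'.reg r = s.reg r) ∧
      t ≤ scanTime (s.mem 0) (s.mem 12) (s.reg 3) + 40 * s.reg 3 + 10 := by
  simp only [scanProg, block, runs_seq, runs_assign, runs_store, Rhs.value, State.setReg_reg,
    State.setMem_reg, Nat.reduceEqDiff, if_false]
  refine (runs_loop (fun φ s' => Scanning (keyGraph H (s.mem 11))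
    (fun k => s.mem 9 (s.mem 12 k - 1)) (s.reg 3) s s' ∧
    φ = scanTime (s.mem 0) (s.mem 12) (s'.reg 4) + 40 * s'.reg 4) ?_ _ _ ⟨?_, rfl⟩).mono ?_
  · rintro φ s' ⟨h', rfl⟩ hlt
    have e1 := h'.frame_reg 1 (by simp)
    have e2 := h'.frame_reg 2 (by simp)
    have e3 := h'.frame_reg 3 (by simp)
    have m0 := h'.frame_mem 0 (by simp)
    have m1 := h'.frame_mem 1 (by simp)
    have m9 := h'.frame_mem 9 (by simp)
    have m11 := h'.frame_mem 11 (by simp)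
    have m12 := h'.frame_mem 12 (by simp)
    rw [hr1] at e1
    rw [hr2] at e2
    rw [e2] at hlt
    obtain ⟨m, hm⟩ : ∃ m, s'.reg 4 = m + 1 := ⟨s'.reg 4 - 1, by omega⟩
    have hle := h'.le
    have htab := h'.tables
    rw [hm] at htab
    have htime : scanTime (s.mem 0) (s.mem 12) (m + 1) = scanTime (s.mem 0) (s.mem 12) m +
        if s.mem 12 m = 0 then 0 else
          10 * (s.mem 0 (s.mem 12 m - 1 + 1) - s.mem 0 (s.mem 12 m - 1)) := Finset.sum_range_succ ..
    simp only [runs_seq, runs_assign, runs_ite, runs_skip, Rhs.value, State.setReg_reg,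
      State.setReg_mem, Nat.reduceEqDiff, if_true, if_false, OfNat.one_ne_ofNat, e1, e2, e3, hm,
      Nat.add_sub_cancel, m0, m12]
    refine ⟨fun h1 => ?_, fun h1 => ?_⟩
    · set s1 := ((((((s'.setReg 4 m).setReg 7 (s.mem 12 m)).setReg 10 (s.mem 12 m - 1)).setReg 11
        (s.mem 0 (s.mem 12 m - 1))).setReg 12 (s.mem 0 (s.mem 12 m))).setReg 13 0).setReg 14
        (s.reg 3) with hs1
      obtain ⟨u, ⟨w, hu⟩, hu1, hu2⟩ := h.rep_spec h1.ne'
      have r4 : s1.reg 4 = m := by simp [hs1, State.setReg_reg]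
      have r10 : s1.reg 10 = u := by simp [hs1, State.setReg_reg, hu1]
      have r11 : s1.reg 11 = s.mem 0 u := by simp [hs1, State.setReg_reg, hu1]
      have r12 : s1.reg 12 = s.mem 0 (u + 1) := by simp [hs1, State.setReg_reg, hu1]
      have r14 : s1.reg 14 = s.reg 3 := by simp [hs1, State.setReg_reg]
      have hun := hcsr.adj_lt hu
      have hoff := hcsr.off_le u hun
      have hmem : s1.mem = s'.mem := rfl
      have hadj := fun l => h.adj_iff hu l
      rw [hu2] at hadj
      refine (runs_extreme (s := s1) (by rw [r11, r12]; exact hoff)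
        (by simp [hs1, State.setReg_reg, e1]) (by simp [hs1, State.setReg_reg])).mono ?_
      rintro t s2 ⟨hex, h11, ht⟩
      rw [hmem, m1, m11, r14, r11] at hex
      rw [r11, r12] at ht
      have hsame : ∀ r < 11, s2.reg r = s1.reg r := fun r hr =>
        hex.reg_eq r (by omega) (by omega) (by omega) (by omega) (by omega)
      have hmem2 : s2.mem = s'.mem := hex.mem_eq
      have all : ∀ {l}, (keyGraph H (s.mem 11)).Adj m l → ∃ j, s.mem 0 u ≤ j ∧ j < s2.reg 11 ∧
          s.mem 11 (s.mem 1 j) = l := fun {l} hl => by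
        obtain ⟨v, hv, rfl⟩ := (hadj l).1 hl
        obtain ⟨j, j1, j2, rfl⟩ := (hcsr.adj_iff u hun v).1 hv
        exact ⟨j, j1, by rw [h11, r12]; exact j2, rfl⟩
      have all' : ∀ {j}, s.mem 0 u ≤ j → j < s2.reg 11 →
          (keyGraph H (s.mem 11)).Adj m (s.mem 11 (s.mem 1 j)) := fun {j} j1 j2 =>
        (hadj _).2 ⟨_, (hcsr.adj_iff u hun _).2 ⟨j, j1, by rwa [h11, r12] at j2, rfl⟩, rfl⟩
      have hmw := (hadj _).2 ⟨w, hu, rfl⟩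
      obtain ⟨j₀, j1, j2, j3⟩ := all hmw
      have le13 : ∀ l, (keyGraph H (s.mem 11)).Adj m l → l ≤ s2.reg 13 := fun l hl => by
        obtain ⟨j, j1, j2, rfl⟩ := all hl
        exact hex.le_hi j j1 j2
      have le14 : ∀ l, (keyGraph H (s.mem 11)).Adj m l → s2.reg 14 ≤ l := fun l hl => by
        obtain ⟨j, j1, j2, rfl⟩ := all hl
        exact hex.lo_le j j1 j2
      have ad13 : (keyGraph H (s.mem 11)).Adj m (s2.reg 13) := by
        -- If the starting value `0` survived, then every neighbouring key is `0`, so `0` is still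
        -- the true maximum. The starting value `K` of the minimum cannot survive, because keys are
        -- below `K`.
        rcases hex.hi_cases with h2 | ⟨j, j1, j2, j3⟩
        · have := le13 _ hmw
          rw [show s2.reg 13 = s.mem 11 w by omega]
          exact hmw
        · rw [← j3]; exact all' j1 j2
      have ad14 : (keyGraph H (s.mem 11)).Adj m (s2.reg 14) := by
        rcases hex.lo_cases with h2 | ⟨j, j1, j2, j3⟩
        · have := le14 _ hmw
          have := h.lt hmw.symm
          omega
        · rw [← j3]; exact all' j1 j2
      have e4 : s2.reg 4 = m := (hsame 4 (by omega)).trans r4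
      refine (runs_enter (E := keyGraph H (s.mem 11)) (K := s.reg 3)
        (sd := fun k => s.mem 9 (s.mem 12 k - 1)) (s := s2) ?_ ?_ ?_ h.keyOrder h.lt ?_ ?_ ?_ ?_).mono ?_
      · rw [hsame 2 (by omega)]; simp [hs1, State.setReg_reg, e2]
      · rw [hmem2, e4, hsame 10 (by omega), r10, m9, hu1, Nat.add_sub_cancel]
      · rw [hmem2, e4]
        exact { htab with
          cur_cases := fun c hc => by
            rw [hsame _ (by omega)]
            have := htab.cur_cases c hc
            simpa [hs1, State.setReg_reg, show 5 + c ≠ 7 by omega, show 5 + c ≠ 10 by omega,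
              show 5 + c ≠ 11 by omega, show 5 + c ≠ 12 by omega, show 5 + c ≠ 13 by omega,
              show 5 + c ≠ 14 by omega, show 5 + c ≠ 4 by omega] using this
          cur_le := fun {k l} k1 k2 => by
            have := htab.cur_le k1 k2
            have := h.keyOrder.side_add k2
            set c := s.mem 9 (s.mem 12 k - 1)
            rw [hsame _ (by omega)]
            simpa [hs1, State.setReg_reg, show 5 + c ≠ 7 by omega, show 5 + c ≠ 10 by omega,
              show 5 + c ≠ 11 by omega, show 5 + c ≠ 12 by omega, show 5 + c ≠ 13 by omega,
              show 5 + c ≠ 14 by omega, show 5 + c ≠ 4 by omega] using htab.cur_le k1 k2 }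
      · rw [e4]; exact ad13
      · rw [e4]; exact le13
      · rw [e4]; exact ad14
      · rw [e4]; exact le14
      · rintro t' s3 ⟨g1, g2, g3, g4⟩
        have e4' : s3.reg 4 = m := (g3 4 (by omega)).trans e4
        refine ⟨_, ⟨⟨by omega, g1, fun k hk => ?_, fun r hr => ?_⟩, rfl⟩, ?_⟩
        · rw [g2 k hk, hmem2, h'.frame_mem k hk]
        · rw [g3 r (by omega), hsame r (by omega), ← h'.frame_reg r hr]
          simp [hs1, State.setReg_reg, show r ≠ 4 by omega, show r ≠ 7 by omega,
            show r ≠ 10 by omega, show r ≠ 11 by omega, show r ≠ 12 by omega, show r ≠ 13 by omega,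
            show r ≠ 14 by omega]
        · rw [e4', htime, if_neg h1.ne', hu1, Nat.add_sub_cancel]
          omega
    · refine ⟨_, ⟨⟨?_, ?_, fun k hk => ?_, fun r hr => ?_⟩, rfl⟩, ?_⟩
      · simp [State.setReg_reg]; omega
      · simp only [State.setReg_reg, State.setReg_mem, Nat.reduceEqDiff, if_true, if_false]
        have hno : ∀ l, ¬ (keyGraph H (s.mem 11)).Adj m l := fun l hl => by
          obtain ⟨u, hu, -⟩ := h.exists_rep hl
          omega
        have := htab.skip hno
        exact { this with
          cur_cases := fun c hc => by
            simpa [show 5 + c ≠ 7 by omega, show 5 + c ≠ 4 by omega] using this.cur_cases c hc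
          cur_le := fun {k l} k1 k2 => by
            have h3 := h.keyOrder.side_add k2
            set c := s.mem 9 (s.mem 12 k - 1)
            simpa [show 5 + c ≠ 7 by omega, show 5 + c ≠ 4 by omega] using this.cur_le k1 k2 }
      · exact h'.frame_mem k hk
      · rw [← h'.frame_reg r hr]
        simp [State.setReg_reg, show r ≠ 4 by omega, show r ≠ 7 by omega]
      · omega
  · refine ⟨by simp [State.setReg_reg], ?_, fun k hk => ?_, fun r hr => ?_⟩
    · simp only [State.setReg_reg, State.setReg_mem, State.setMem_mem, State.setMem_reg,
        Nat.reduceEqDiff, if_true, if_false]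
      refine TablesFrom.init h.lt (update_self ..) (update_self ..) fun c hc => ?_
      split_ifs <;> first | rfl | omega
    · simp [State.setReg_mem, State.setMem_mem, show k ≠ 13 by omega, show k ≠ 14 by omega]
    · simp [State.setReg_reg, State.setMem_reg, show r ≠ 4 by omega, show r ≠ 5 by omega,
        show r ≠ 6 by omega]
  · rintro t s' ⟨φ, ⟨h', rfl⟩, hn, ht⟩
    have e2 := h'.frame_reg 2 (by simp)
    rw [hr2] at e2
    have e4 : s'.reg 4 = 0 := by omega
    have htab := h'.tables
    rw [e4] at htab
    refine ⟨_, rfl, rfl, htab, h'.frame_mem, h'.frame_reg, ?_⟩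
    simp only [State.setReg_reg, Nat.reduceEqDiff, if_true, if_false] at ht
    omega

end ScanProgram

/-! ### Computing the candidates for all lengths -/

section ChainProgram

open RAM
open Function (update update_self update_of_ne update_apply)

/-- One new first end is `nw s.al`. The other exceeds `hi s.be`, and this is at least `s.al`,
because `s.be` is adjacent to the first end of its candidate. Hence there are at most `K` levels. -/
theorem Tables.al_lt_next {E : SimpleGraph ℕ} {sd : ℕ → ℕ} {K : ℕ} {hi lo suc nw : ℕ → ℕ}
    (h : Tables E sd K hi lo suc nw) {s : Front}
    (hp : (s.pa = K ∧ s.pb = K) ∨ E.Adj s.pa s.pb ∧ sd s.pa = 0)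
    (hq : (s.qa = K ∧ s.qb = K) ∨ E.Adj s.qa s.qb ∧ sd s.qa = 0) (hs : s.al < K) :
    s.al < (s.next nw (partner hi lo suc nw)).al := by
  obtain ⟨⟨y, hy⟩, ⟨x, hx⟩, s1, s2⟩ := h.classes_of_lt hp hq hs
  have hxK := h.lt hx
  have hal : s.al ≤ hi s.be := by
    rcases min_choice s.pb s.qb with e | e
    · rcases hp with hp | hp
      · simp only [Front.be] at hxK
        omega
      · refine (min_le_left _ _).trans ?_
        rw [Front.be, e]
        exact h.le_hi hp.1.symm
    · rcases hq with hq | hq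
      · simp only [Front.be] at hxK
        omega
      · refine (min_le_right _ _).trans ?_
        rw [Front.be, e]
        exact h.le_hi hq.1.symm
  refine lt_min ?_ ?_
  · change _ < nw s.al
    rcases h.partner_cases hy with h1 | h1
    · omega
    · exact h1.2.2.1
  · change _ < partner hi lo suc nw s.be
    rcases h.partner_cases hx with h1 | h1
    · omega
    · exact hal.trans_lt h1.2.2.2

/-- Registers `17` and `18` get the entry of register `16` in the last table and its partner. -/
def partnerProg : Prog := block [
  .assign 17 (.load 16 16),
  .assign 18 (.load 14 17),
  .assign 19 (.load 13 16),
  .ite 19 18 .skip (.assign 18 (.load 15 19))]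

theorem runs_partner {s : State} {Q : ℕ → State → Prop} : Runs partnerProg s Q ↔
    Q 5 (((s.setReg 17 (s.mem 16 (s.reg 16))).setReg 19 (s.mem 13 (s.reg 16))).setReg 18
      (partner (s.mem 13) (s.mem 14) (s.mem 15) (s.mem 16) (s.reg 16))) := by
  simp only [partnerProg, block, runs_seq, runs_assign, runs_ite, runs_skip, Rhs.value,
    State.setReg_reg, State.setReg_mem, Nat.reduceEqDiff, if_true, if_false]
  by_cases h1 : s.mem 13 (s.reg 16) < s.mem 14 (s.mem 16 (s.reg 16))
  · simp only [h1, true_implies, not_true_eq_false, false_implies, and_true, partner, if_true]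
    apply iff_of_eq
    congr 1
    ext r
    · simp only [State.setReg_reg]
      split_ifs <;> first | rfl | omega
    · rfl
  · simp only [h1, true_implies, not_false_eq_true, false_implies, true_and, partner, if_false]
    apply iff_of_eq
    congr 1
    ext r
    · simp only [State.setReg_reg]
      split_ifs <;> rfl
    · rfl

/-- Register `d` gets the minimum of the registers `a` and `b`. -/
def minProg (d a b : ℕ) : Prog := block [
  .assign d (.copy a),
  .ite b d (.assign d (.copy b)) .skip]

theorem runs_min {d a b : ℕ} (hb : b ≠ d) {s : State} {Q : ℕ → State → Prop} :
    Runs (minProg d a b) s Q ↔ Q 3 (s.setReg d (min (s.reg a) (s.reg b))) := by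
  simp only [minProg, block, runs_seq, runs_assign, runs_ite, runs_skip, Rhs.value,
    State.setReg_reg, if_true, hb, if_false]
  by_cases h1 : s.reg b < s.reg a
  · simp only [h1, true_implies, not_true_eq_false, false_implies, and_true, min_eq_right h1.le]
    apply iff_of_eq
    congr 1
    ext r
    · simp only [State.setReg_reg]
      split_ifs <;> rfl
    · rfl
  · simp only [h1, true_implies, not_false_eq_true, false_implies, true_and,
      min_eq_left (not_lt.1 h1)]

/-- Store the current candidates and compute the next ones. -/
def levelProg : Prog := block [
  .store 17 4 10, .store 18 4 11, .store 19 4 12, .store 20 4 13,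
  minProg 15 11 13,
  .assign 16 (.copy 14),
  partnerProg,
  .assign 10 (.copy 17),
  .assign 11 (.copy 18),
  .assign 16 (.copy 15),
  partnerProg,
  .assign 12 (.copy 18),
  .assign 13 (.copy 17),
  minProg 14 10 12,
  .assign 4 (.add 4 1)]

/-- Store the candidates for chains with `1`, `2`, … edges in the arrays from `17` to `20`. -/
def frontProg : Prog := block [
  .assign 4 (.const 0),
  .assign 10 (.copy 5),
  .assign 11 (.copy 6),
  .assign 12 (.copy 5),
  .assign 13 (.copy 6),
  .assign 14 (.copy 5),
  .loop 14 3 levelProg]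

theorem runs_level {s : State} {F : Front} {Q : ℕ → State → Prop} (hpa : s.reg 10 = F.pa)
    (hpb : s.reg 11 = F.pb) (hqa : s.reg 12 = F.qa) (hqb : s.reg 13 = F.qb) (hal : s.reg 14 = F.al)
    (hr1 : s.reg 1 = 1)
    (h : ∀ (s' : State) (t : ℕ), s'.reg 4 = s.reg 4 + 1 →
      s'.reg 10 = (F.next (s.mem 16) (partner (s.mem 13) (s.mem 14) (s.mem 15) (s.mem 16))).pa →
      s'.reg 11 = (F.next (s.mem 16) (partner (s.mem 13) (s.mem 14) (s.mem 15) (s.mem 16))).pb →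
      s'.reg 12 = (F.next (s.mem 16) (partner (s.mem 13) (s.mem 14) (s.mem 15) (s.mem 16))).qa →
      s'.reg 13 = (F.next (s.mem 16) (partner (s.mem 13) (s.mem 14) (s.mem 15) (s.mem 16))).qb →
      s'.reg 14 = (F.next (s.mem 16) (partner (s.mem 13) (s.mem 14) (s.mem 15) (s.mem 16))).al →
      s'.mem 17 = update (s.mem 17) (s.reg 4) F.pa → s'.mem 18 = update (s.mem 18) (s.reg 4) F.pb →
      s'.mem 19 = update (s.mem 19) (s.reg 4) F.qa → s'.mem 20 = update (s.mem 20) (s.reg 4) F.qb →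
      (∀ k < 17, s'.mem k = s.mem k) → (∀ r < 4, s'.reg r = s.reg r) → t ≤ 30 → Q t s') :
    Runs levelProg s Q := by
  have hbe : F.be = min F.pb F.qb := rfl
  have hal' : (F.next (s.mem 16) (partner (s.mem 13) (s.mem 14) (s.mem 15) (s.mem 16))).al =
    min (s.mem 16 F.al) (partner (s.mem 13) (s.mem 14) (s.mem 15) (s.mem 16) F.be) := rfl
  simp only [levelProg, block, runs_seq, runs_assign, runs_store, runs_partner,
    runs_min (show 13 ≠ 15 by simp), runs_min (show 12 ≠ 14 by simp),
    Rhs.value, State.setReg_reg, State.setReg_mem, State.setMem_mem, State.setMem_reg,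
    Nat.reduceEqDiff, if_true, if_false, OfNat.one_ne_ofNat, hr1, hpa, hpb, hqa, hqb, hal, ← hbe]
  refine h _ _ ?_ ?_ ?_ ?_ ?_ ?_ ?_ ?_ ?_ ?_ (fun k hk => ?_) (fun r hr => ?_) (by omega)
  all_goals try rw [hal']
  all_goals
    simp only [State.setReg_reg, State.setReg_mem, State.setMem_reg, State.setMem_mem,
      Nat.reduceEqDiff, if_true, if_false, Front.next]
  · simp (discharger := omega) only [if_neg]
  · simp (discharger := omega) only [if_neg]

/-- The field `le` says that the level number never overtakes the growing `al`; this bounds the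
length of the chain by `K`. -/
structure Fronting (F : ℕ → Front) (K : ℕ) (s₀ s : State) : Prop where
  pa : s.reg 10 = (F (s.reg 4)).pa
  pb : s.reg 11 = (F (s.reg 4)).pb
  qa : s.reg 12 = (F (s.reg 4)).qa
  qb : s.reg 13 = (F (s.reg 4)).qb
  al : s.reg 14 = (F (s.reg 4)).al
  stored : ∀ i < s.reg 4,
    (⟨s.mem 17 i, s.mem 18 i, s.mem 19 i, s.mem 20 i⟩ : Front) = F i ∧ (F i).al < K
  le : s.reg 4 ≤ K ∧ s.reg 4 ≤ s.reg 14
  frame_mem : ∀ k < 17, s.mem k = s₀.mem k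
  frame_reg : ∀ r < 4, s.reg r = s₀.reg r

theorem runs_front {E : SimpleGraph ℕ} {sd : ℕ → ℕ} {s : State}
    (h : Tables E sd (s.reg 3) (s.mem 13) (s.mem 14) (s.mem 15) (s.mem 16))
    (h0 : Tables.IsLeastEdge E sd (s.reg 3) (s.reg 5) (s.reg 6)) (hr1 : s.reg 1 = 1) :
    Runs frontProg s fun t s' => Fronting (front (s.mem 16) (partner (s.mem 13) (s.mem 14)
      (s.mem 15) (s.mem 16)) (s.reg 5) (s.reg 6)) (s.reg 3) s s' ∧ s.reg 3 ≤ s'.reg 14 ∧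
      t ≤ 40 * s.reg 3 + 10 := by
  have hal := fun t ht hK => h.al_lt_next (h.front_cases h0 t ht).1 (h.front_cases h0 t ht).2 hK
  set F := front (s.mem 16) (partner (s.mem 13) (s.mem 14) (s.mem 15) (s.mem 16)) (s.reg 5)
    (s.reg 6) with hF
  simp only [frontProg, block, runs_seq, runs_assign, Rhs.value, State.setReg_reg, Nat.reduceEqDiff,
    if_false]
  refine (runs_loop (fun φ s' => Fronting F (s.reg 3) s s' ∧
    φ = 40 * (s.reg 3 - s'.reg 14)) ?_ _ _ ⟨?_, rfl⟩).mono ?_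
  · rintro φ s' ⟨h', rfl⟩ hlt
    have e1 := h'.frame_reg 1 (by simp)
    have e3 := h'.frame_reg 3 (by simp)
    rw [hr1] at e1
    have m13 := h'.frame_mem 13 (by simp)
    have m14 := h'.frame_mem 14 (by simp)
    have m15 := h'.frame_mem 15 (by simp)
    have m16 := h'.frame_mem 16 (by simp)
    have hK : (F (s'.reg 4)).al < s.reg 3 := by rw [← h'.al, ← e3]; exact hlt
    have hlt' := hal (s'.reg 4) (fun i hi => (h'.stored i hi).2) hK
    have hnext : F (s'.reg 4 + 1) = (F (s'.reg 4)).next (s.mem 16) (partner (s.mem 13) (s.mem 14)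
      (s.mem 15) (s.mem 16)) := rfl
    refine runs_level h'.pa h'.pb h'.qa h'.qb h'.al e1 fun s'' t e4 e10 e11 e12 e13 e14 m17 m18 m19 m20 em er ht => ?_
    rw [m13, m14, m15, m16, ← hnext] at e10 e11 e12 e13 e14
    refine ⟨_, ⟨⟨?_, ?_, ?_, ?_, ?_, fun i hi => ?_, ?_, fun k hk => (em k hk).trans (h'.frame_mem k hk),
      fun r hr => (er r hr).trans (h'.frame_reg r hr)⟩, rfl⟩, ?_⟩
    · rw [e4, e10]
    · rw [e4, e11]
    · rw [e4, e12]
    · rw [e4, e13]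
    · rw [e4, e14]
    · rw [e4] at hi
      rw [m17, m18, m19, m20]
      rcases Nat.lt_succ_iff_lt_or_eq.1 hi with hi | rfl
      · simp only [update_of_ne hi.ne]
        exact h'.stored i hi
      · simp only [update_self]
        exact ⟨trivial, hK⟩
    · have hle := h'.le
      rw [h'.al] at hle
      rw [e4, e14, hnext]
      omega
    · rw [e14, h'.al, hnext]
      omega
  · constructor
    all_goals simp +contextual [State.setReg_reg, State.setReg_mem, hF, front, Front.al]
    intro r hr
    split_ifs <;> first | rfl | omega
  · rintro t s' ⟨φ, ⟨h', rfl⟩, hn, ht⟩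
    have e3 := h'.frame_reg 3 (by simp)
    refine ⟨h', by omega, ?_⟩
    omega

end ChainProgram

/-! ### Backtracking and writing the output -/

section ChainProgram

open RAM
open Function (update update_self update_of_ne update_apply)

theorem Front.pick_eq (s : Front) (f : ℕ) :
    s.pick f = if s.turn f = 0 then (s.pa, s.pb) else (s.qa, s.qb) := by
  simp only [Front.pick, Front.turn]
  split_ifs <;> first | rfl | simp_all

/-- Decide between the candidates in the registers from `10` to `13`. -/
def turnProg : Prog :=
  .ite 2 6 (.ite 11 13 (.assign 6 (.const 0)) (.assign 6 (.const 1)))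
    (.ite 12 10 (.assign 6 (.const 1)) (.assign 6 (.const 0)))

theorem runs_turn {s : State} (h2 : s.reg 2 = 0) {Q : ℕ → State → Prop} : Runs turnProg s Q ↔
    Q 3 (s.setReg 6 ((⟨s.reg 10, s.reg 11, s.reg 12, s.reg 13⟩ : Front).turn (s.reg 6))) := by
  simp only [turnProg, runs_assign, runs_ite, Rhs.value, Front.turn, h2]
  by_cases h6 : s.reg 6 = 0
  · by_cases h : s.reg 12 < s.reg 10 <;> simp [h6, h]
  · have h6' : 0 < s.reg 6 := by omega
    by_cases h : s.reg 11 < s.reg 13 <;> simp [h6, h6', h]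

/-- Move the chosen candidate to the registers `15` and `16`. -/
def chooseProg : Prog :=
  .ite 2 6 (block [.assign 15 (.copy 12), .assign 16 (.copy 13)])
    (block [.assign 15 (.copy 10), .assign 16 (.copy 11)])

theorem runs_choose {s : State} (h2 : s.reg 2 = 0) {Q : ℕ → State → Prop} : Runs chooseProg s Q ↔
    Q 3 ((s.setReg 15 (if s.reg 6 = 0 then s.reg 10 else s.reg 12)).setReg 16
      (if s.reg 6 = 0 then s.reg 11 else s.reg 13)) := by
  simp only [chooseProg, block, runs_seq, runs_assign, runs_ite, Rhs.value, h2, State.setReg_reg]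
  by_cases h6 : s.reg 6 = 0
  · simp [h6]
  · have h6' : 0 < s.reg 6 := by omega
    simp [h6, h6']

/-- Write the `7`-th edge of the output. -/
def writeProg : Prog := block [
  .assign 5 (.sub 5 1),
  .assign 10 (.load 17 5),
  .assign 11 (.load 18 5),
  .assign 12 (.load 19 5),
  .assign 13 (.load 20 5),
  turnProg,
  chooseProg,
  .assign 17 (.load 12 15),
  .assign 17 (.sub 17 1),
  .store 0 7 17,
  .assign 18 (.load 12 16),
  .assign 18 (.sub 18 1),
  .store 1 7 18,
  .assign 7 (.add 7 1)]

theorem runs_write {s : State} {m : ℕ} {F : Front} {Q : ℕ → State → Prop} (hr1 : s.reg 1 = 1)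
    (hr2 : s.reg 2 = 0) (hm : s.reg 5 = m + 1)
    (hF : (⟨s.mem 17 m, s.mem 18 m, s.mem 19 m, s.mem 20 m⟩ : Front) = F)
    (h : ∀ (s' : State) (t : ℕ), s'.reg 4 = s.reg 4 → s'.reg 1 = 1 → s'.reg 2 = 0 →
      s'.reg 5 = m → s'.reg 6 = F.turn (s.reg 6) → s'.reg 7 = s.reg 7 + 1 →
      s'.mem 0 = update (s.mem 0) (s.reg 7) (s.mem 12 (F.pick (s.reg 6)).1 - 1) →
      s'.mem 1 = update (s.mem 1) (s.reg 7) (s.mem 12 (F.pick (s.reg 6)).2 - 1) →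
      (∀ k, 2 ≤ k → s'.mem k = s.mem k) → t ≤ 29 → Q t s') : Runs writeProg s Q := by
  have epa : s.mem 17 m = F.pa := by rw [← hF]
  have epb : s.mem 18 m = F.pb := by rw [← hF]
  have eqa : s.mem 19 m = F.qa := by rw [← hF]
  have eqb : s.mem 20 m = F.qb := by rw [← hF]
  have e2 : ∀ a b c d e, (((((s.setReg 5 a).setReg 10 b).setReg 11 c).setReg 12 d).setReg 13 e).reg 2
    = 0 := fun a b c d e => by simp [State.setReg_reg, hr2]
  have e2' : ∀ a b c d e f, ((((((s.setReg 5 a).setReg 10 b).setReg 11 c).setReg 12 d).setReg 13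
    e).setReg 6 f).reg 2 = 0 := fun a b c d e f => by simp [State.setReg_reg, hr2]
  simp only [writeProg, block, runs_seq, runs_assign, runs_store, runs_turn (e2 ..),
    runs_choose (e2' ..), Rhs.value,
    State.setReg_reg, State.setReg_mem, State.setMem_mem, State.setMem_reg,
    Nat.reduceEqDiff, if_true, if_false, OfNat.one_ne_ofNat, hr1, hm, Nat.add_sub_cancel,
    epa, epb, eqa, eqb]
  refine h _ _ ?_ ?_ ?_ ?_ ?_ ?_ ?_ ?_ (fun k hk => ?_) (by omega)
  all_goals
    simp only [State.setReg_reg, State.setReg_mem, State.setMem_reg, State.setMem_mem,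
      Nat.reduceEqDiff, if_true, if_false, Front.pick_eq, OfNat.one_ne_ofNat, zero_ne_one, hr1, hr2]
  · congr 2
    split_ifs <;> rfl
  · congr 2
    split_ifs <;> rfl
  · rw [if_neg (by omega), if_neg (by omega)]

/-- Follow the candidates backwards, and write the edges that are found as the output. -/
def outputProg : Prog := block [
  .assign 5 (.copy 4),
  .assign 6 (.const 0),
  .assign 7 (.const 0),
  .loop 2 5 writeProg,
  .assign 0 (.copy 4)]

/-- In `written`, `L` is the part of the chain already written; registers `5` and `6` determine what
is left. -/
structure Writing (F : ℕ → Front) (s₀ s : State) : Prop where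
  four : s.reg 4 = s₀.reg 4
  le : s.reg 5 ≤ s₀.reg 4
  reg_one : s.reg 1 = 1
  reg_two : s.reg 2 = 0
  written : ∃ L, backtrack F (s₀.reg 4) 0 = L ++ backtrack F (s.reg 5) (s.reg 6) ∧
    L.length = s.reg 7 ∧
    ∀ (i : ℕ) (hi : i < L.length), s.mem 0 i = s₀.mem 12 L[i].1 - 1 ∧ s.mem 1 i = s₀.mem 12 L[i].2 - 1
  frame : ∀ k, 2 ≤ k → s.mem k = s₀.mem k

theorem runs_output {F : ℕ → Front} {s : State} (hr1 : s.reg 1 = 1) (hr2 : s.reg 2 = 0)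
    (hF : ∀ i < s.reg 4, (⟨s.mem 17 i, s.mem 18 i, s.mem 19 i, s.mem 20 i⟩ : Front) = F i) :
    Runs outputProg s fun t s' => s'.reg 0 = s.reg 4 ∧
      (∀ (i : ℕ) (hi : i < (backtrack F (s.reg 4) 0).length),
        s'.mem 0 i = s.mem 12 (backtrack F (s.reg 4) 0)[i].1 - 1 ∧
        s'.mem 1 i = s.mem 12 (backtrack F (s.reg 4) 0)[i].2 - 1) ∧
      t ≤ 30 * s.reg 4 + 10 := by
  simp only [outputProg, block, runs_seq, runs_assign, Rhs.value, State.setReg_reg]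
  refine (runs_loop (fun φ s' => Writing F s s' ∧ φ = 30 * s'.reg 5) ?_ _ _ ⟨?_, rfl⟩).mono ?_
  · rintro φ s' ⟨h, rfl⟩ hlt
    rw [h.reg_two] at hlt
    obtain ⟨m, hm⟩ : ∃ m, s'.reg 5 = m + 1 := ⟨s'.reg 5 - 1, by omega⟩
    have hle := h.le
    have hFm := hF m (by omega)
    obtain ⟨L, hL, hl, hLi⟩ := h.written
    rw [hm, backtrack] at hL
    have m12 := h.frame 12 (by simp)
    have m17 := h.frame 17 (by simp)
    have m18 := h.frame 18 (by simp)
    have m19 := h.frame 19 (by simp)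
    have m20 := h.frame 20 (by simp)
    refine runs_write h.reg_one h.reg_two hm (by rw [m17, m18, m19, m20, hFm])
      fun s'' t e4 e1 e2 e5 e6 e7 m0 m1 hf ht => ?_
    rw [m12] at m0 m1
    refine ⟨_, ⟨⟨e4.trans h.four, by omega, e1, e2, ⟨L ++ [(F m).pick (s'.reg 6)], ?_, ?_,
      fun i hi => ?_⟩, fun k hk => (hf k hk).trans (h.frame k hk)⟩, rfl⟩, by omega⟩
    · rw [e5, e6, List.append_assoc, List.singleton_append]
      exact hL
    · simp [hl, e7]
    · rw [m0, m1]
      rw [List.length_append, List.length_singleton] at hi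
      rcases Nat.lt_succ_iff_lt_or_eq.1 hi with hi | rfl
      · rw [update_of_ne (by omega), update_of_ne (by omega), List.getElem_append_left hi]
        exact hLi i hi
      · rw [← hl, update_self, update_self]
        simp
  · refine ⟨?_, ?_, ?_, ?_, ⟨[], ?_, ?_, ?_⟩, ?_⟩
    all_goals simp [State.setReg_reg, State.setReg_mem, hr1, hr2]
  · rintro t s' ⟨φ, ⟨h, rfl⟩, hn, ht⟩
    have e5 : s'.reg 5 = 0 := by have := h.reg_two; omega
    obtain ⟨L, hL, hl, hLi⟩ := h.written
    rw [e5, backtrack, List.append_nil] at hL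
    rw [hL]
    refine ⟨h.four, hLi, ?_⟩
    simp only [State.setReg_reg, Nat.reduceEqDiff, if_true, if_false] at ht
    omega

end ChainProgram

/-! ### The whole computation -/

section Computation

open RAM
open Function (update update_self update_of_ne update_apply)

namespace Reps

variable {H : SimpleGraph ℕ} {side key rep : ℕ → ℕ} {K : ℕ}

/-- Vertices with the same key are twins, so an edge between two keys joins any two non-isolated
vertices that carry them. -/
theorem adj_of_adj_key (h : Reps H side key rep K) {u v w x : ℕ} (hu : H.Adj u w) (hv : H.Adj v x)
    (huv : (keyGraph H key).Adj (key u) (key v)) : H.Adj u v := by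
  obtain ⟨z, hz, he⟩ := (h.adj_iff hu _).1 huv
  exact (h.order.adj_of_key_eq hv hz.symm (h.side_eq hv hz.symm he.symm) he.symm).symm

theorem adj_rep (h : Reps H side key rep K) {k l : ℕ} (hkl : (keyGraph H key).Adj k l) :
    H.Adj (rep k - 1) (rep l - 1) ∧ key (rep k - 1) = k ∧ key (rep l - 1) = l := by
  obtain ⟨u, hu, rfl, w, hw⟩ := h.exists_rep hkl
  obtain ⟨v, hv, rfl, x, hx⟩ := h.exists_rep hkl.symm
  rw [hu, hv, Nat.add_sub_cancel, Nat.add_sub_cancel]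
  exact ⟨h.adj_of_adj_key hw hx hkl, rfl, rfl⟩

theorem precedes_iff (h : Reps H side key rep K) {e f : ℕ × ℕ} (he : H.Adj e.1 e.2)
    (hf : H.Adj f.1 f.2) : Precedes (keyGraph H key) id (key e.1, key e.2) (key f.1, key f.2) ↔
      Precedes H key e f := by
  have h1 : (keyGraph H key).Adj (key e.1) (key f.2) ↔ H.Adj e.1 f.2 :=
    ⟨h.adj_of_adj_key he hf.symm, h.adj_key⟩
  have h2 : (keyGraph H key).Adj (key f.1) (key e.2) ↔ H.Adj f.1 e.2 :=
    ⟨h.adj_of_adj_key hf he.symm, h.adj_key⟩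
  simp only [Precedes, id, h1, h2]

end Reps

/-- The list `L` is a longest chain of edges, last edge first. -/
structure IsLongestChain (H : SimpleGraph ℕ) (side key : ℕ → ℕ) (L : List (ℕ × ℕ)) : Prop where
  order : KeyOrder H side key
  adj : ∀ e ∈ L, H.Adj e.1 e.2 ∧ side e.1 = 0
  chain : L.Pairwise fun e f => Precedes H key f e
  card_le : ∀ T : Finset (ℕ × ℕ), (∀ e ∈ T, H.Adj e.1 e.2 ∧ side e.1 = 0) →
    (∀ e ∈ T, ∀ f ∈ T, e ≠ f → Precedes H key e f ∨ Precedes H key f e) → T.card ≤ L.length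

/-- Replacing keys by representatives, and vertices by keys, preserves adjacency and precedence. So
longest chains of the key graph and of `H` have the same length. -/
theorem isLongestChain_backtrack {H : SimpleGraph ℕ} {side key rep : ℕ → ℕ} {K : ℕ}
    {hi lo suc nw : ℕ → ℕ} {a b N : ℕ} (h : Reps H side key rep K)
    (ht : Tables (keyGraph H key) (fun k => side (rep k - 1)) K hi lo suc nw)
    (h0 : Tables.IsLeastEdge (keyGraph H key) (fun k => side (rep k - 1)) K a b)
    (hN : ∀ i < N, (front nw (partner hi lo suc nw) a b i).al < K)
    (hN' : K ≤ (front nw (partner hi lo suc nw) a b N).al) :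
    IsLongestChain H side key ((backtrack (front nw (partner hi lo suc nw) a b) N 0).map
      fun e => (rep e.1 - 1, rep e.2 - 1)) := by
  obtain ⟨h1, h2⟩ := ht.backtrack_spec h0 N 0 hN
  refine ⟨h.order, ?_, ?_, fun T hT hC => ?_⟩
  · simp only [List.mem_map, forall_exists_index, and_imp]
    rintro _ e he rfl
    exact ⟨(h.adj_rep (h1 e he).1).1, (h1 e he).2⟩
  · rw [List.pairwise_map]
    refine h2.imp_of_mem fun {e f} he hf hp => ?_
    obtain ⟨e1, e2, e3⟩ := h.adj_rep (h1 e he).1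
    obtain ⟨f1, f2, f3⟩ := h.adj_rep (h1 f hf).1
    refine (h.precedes_iff f1 e1).1 ?_
    simp only [e2, e3, f2, f3]
    exact hp
  · rw [List.length_map, length_backtrack]
    rcases Nat.eq_zero_or_pos T.card with h3 | h3
    · omega
    -- Comparable edges have different keys at their first ends, so no edge of a chain is lost in
    -- the key graph.
    have hinj : Set.InjOn (fun e : ℕ × ℕ => (key e.1, key e.2)) T := fun e he f hf hef => by
      by_contra hne
      simp only [Prod.mk.injEq] at hef
      rcases hC e he f hf hne with hp | hp
      · exact absurd hp.1 (by omega)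
      · exact absurd hp.1 (by omega)
    have := (ht.card_le h0 hN hN' (T.card - 1) (T.image fun e => (key e.1, key e.2))
      (by rw [Finset.card_image_of_injOn hinj]; omega) ?_ ?_).1
    · omega
    · simp only [Finset.mem_image, forall_exists_index, and_imp]
      rintro _ e he rfl
      obtain ⟨e1, e2⟩ := hT e he
      exact ⟨h.adj_key e1, (h.side_rep e1).trans e2⟩
    · simp only [Finset.mem_image, forall_exists_index, and_imp]
      rintro _ e he rfl _ f hf rfl hne
      rw [h.precedes_iff (hT e he).1 (hT f hf).1, h.precedes_iff (hT f hf).1 (hT e he).1]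
      exact hC e he f hf fun h => hne (by rw [h])

/-- Compute a longest chain of edges. -/
def chainProg : Prog := block [
  initProg,
  sweepProg 0,
  .assign 4 (.copy 3),
  sweepProg 5,
  scanProg,
  frontProg,
  outputProg]

theorem incremental_chainProg : Incremental chainProg := by
  simp [chainProg, Incremental, block, initProg, sweepProg, rootProg, vertexProg, takeProg,
    slotProg, visitProg, finishProg, scanProg, extremeProg, enterProg, frontProg, levelProg, minProg,
    partnerProg, outputProg, writeProg, turnProg, chooseProg]

theorem sum_diff_eq {off : ℕ → ℕ} (n : ℕ) (h : ∀ u < n, off u ≤ off (u + 1)) :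
    (∑ v ∈ Finset.range n, (off (v + 1) - off v)) + off 0 = off n := by
  induction n with
  | zero => simp
  | succ n ih =>
    have := ih fun u hu => h u (by omega)
    have := h n (by omega)
    rw [Finset.sum_range_succ]
    omega

/-- The order `p` is known to exist but is not available to the program; it enters only the analysis
of the two searches. -/
theorem runs_chain {H : SimpleGraph ℕ} {n : ℕ} {off tgt : ℕ → ℕ} (hcsr : IsCSR H n off tgt)
    {c : ℕ → Bool} {p : ℕ → ℤ} (hs : StrongOrder H c p) (hp : p.Injective) {s : State}
    (h0 : s.mem 0 = off) (h1 : s.mem 1 = tgt) (hmem : ∀ k, 2 ≤ k → ∀ i, s.mem k i = 0)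
    (hr0 : s.reg 0 = n) (hr1 : s.reg 1 = 1) (hreg : ∀ r, 2 ≤ r → s.reg r = 0) :
    Runs chainProg s fun t s' => (∃ side key L, IsLongestChain H side key L ∧ s'.reg 0 = L.length ∧
      ∀ (i : ℕ) (hi : i < L.length), s'.mem 0 i = L[i].1 ∧ s'.mem 1 i = L[i].2) ∧
      t ≤ 2000 * (n + off n + 1) := by
  have hlt : ∀ {u v}, H.Adj u v → u < n := hcsr.adj_lt
  have hsum := sum_diff_eq n hcsr.off_le
  have hsum' : ∑ v ∈ Finset.range n, (40 + 30 * (off (v + 1) - off v)) =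
      40 * n + 30 * ∑ v ∈ Finset.range n, (off (v + 1) - off v) := by
    rw [Finset.sum_add_distrib, Finset.mul_sum]
    simp [mul_comm]
  simp only [chainProg, block, runs_seq, runs_assign, Rhs.value]
  refine (runs_init h0 (hmem 2 le_rfl) hr1 (hreg 2 le_rfl) (hreg 3 (by simp))
    (hreg 4 (by simp))).mono ?_
  rintro t1 s1 ⟨i1, i2, ht1⟩
  have hcand := i1.cand
  rw [i2, hr0] at hcand
  -- For the first search every vertex with a neighbour is a candidate, in the arbitrary order of
  -- the input.
  have hcov : Covers H (s1.mem 2) n := fun v w hv => by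
    have hv' := hlt hv
    obtain ⟨j, j1, j2, -⟩ := (hcsr.adj_iff v hv' w).1 hv
    exact ⟨v, hv', v, by rw [hcand, if_pos ⟨hv', by omega⟩], .refl _⟩
  refine (runs_sweep (H := H) (n := n) (off := off) (tgt := tgt) (o := 0) hcsr (fun i hi v hv => ?_)
    i1.mem_zero (by rw [i1.frame 1 (by simp), h1]) i1.reg_one i1.reg_two
    (fun v => by rw [i1.frame _ (by simp)]; exact hmem _ (by simp) _)
    (fun v => by rw [i1.frame _ (by simp)]; exact hmem _ (by simp) _)).mono ?_
  · rw [hcand] at hv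
    split_ifs at hv with h3
    obtain rfl : i = v := by omega
    exact ⟨_, (hcsr.adj_iff i h3.1 _).2 ⟨_, le_rfl, h3.2, rfl⟩⟩
  rintro t2 s2 ⟨hsw, m2, r2, ht2⟩
  simp only [Nat.zero_add] at hsw m2
  rw [i2, hr0] at hsw
  have e3 : s2.reg 3 = 6 * n + 6 := by rw [r2 3 (by simp), i1.three, i2, hr0]
  have mem2 : ∀ k, k < 2 ∨ 7 < k → s2.mem k = s.mem k := fun k hk => by
    rw [m2 k (by omega), i1.frame k (by omega)]
  -- With offset `5` the candidates are read from array `7`, the representatives of the first search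
  -- indexed by key. As the last candidate comes first, large keys are tried first.
  refine (runs_sweep (H := H) (n := n) (off := off) (tgt := tgt) (o := 5) hcsr (fun i hi v hv => ?_)
    ?_ ?_ ?_ ?_ ?_ ?_).mono ?_
  · obtain ⟨u, hu, hu', -⟩ := hsw.rep_spec (k := i) (by
      simp only [State.setReg_mem, Nat.reduceAdd] at hv; omega)
    simp only [State.setReg_mem, Nat.reduceAdd] at hv
    obtain rfl : v = u := by omega
    exact hu
  · rw [State.setReg_mem, mem2 0 (by simp), h0]
  · rw [State.setReg_mem, mem2 1 (by simp), h1]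
  · simp [State.setReg_reg, r2 1, i1.reg_one]
  · simp [State.setReg_reg, r2 2, i1.reg_two]
  · intro v; rw [State.setReg_mem, mem2 _ (by simp)]; exact hmem _ (by simp) _
  · intro v; rw [State.setReg_mem, mem2 _ (by simp)]; exact hmem _ (by simp) _
  rintro t3 s3 ⟨hsw', m3, r3, ht3⟩
  simp only [Nat.reduceAdd, State.setReg_mem, State.setReg_reg, if_true, e3] at hsw' m3 ht3
  have e3' : s3.reg 3 = 6 * n + 6 := by
    rw [r3 3 (by simp)]; simp [State.setReg_reg, e3]
  have e1' : s3.reg 1 = 1 := by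
    rw [r3 1 (by simp)]; simp [State.setReg_reg, r2 1, i1.reg_one]
  have e2' : s3.reg 2 = 0 := by
    rw [r3 2 (by simp)]; simp [State.setReg_reg, r2 2, i1.reg_two]
  have mem3 : ∀ k, k < 2 → s3.mem k = s.mem k := fun k hk => by
    rw [m3 k (by omega), mem2 k (by omega)]
  have hko := hsw.keyOrder hcov hlt hs hp hsw'
  have hcov' := hsw.covers_rep hcov hlt hs
  have hreps : Reps H (s3.mem 9) (s3.mem 11) (s3.mem 12) (s3.reg 3) :=
    ⟨hko.1, hko.2, fun hu => e3' ▸ hsw'.key_lt hcov' hlt hu, hsw'.rep_spec, hsw'.rep_ne hcov'⟩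
  refine (runs_scan (n := n) (by rw [mem3 0 (by simp), mem3 1 (by simp), h0, h1]; exact hcsr) hreps
    e1' e2').mono ?_
  rintro t4 s4 ⟨cur, hcur0, hcur1, htab, m4, r4, ht4⟩
  rw [mem3 0 (by simp), h0] at ht4
  have e3'' : s4.reg 3 = s3.reg 3 := r4 3 (by simp)
  have hT := htab.tables hreps.keyOrder hreps.lt
  have hL := htab.isLeastEdge hreps.keyOrder hreps.lt
  rw [hcur0, hcur1, ← e3''] at hL
  rw [← e3''] at hT
  refine (runs_front hT hL (by rw [r4 1 (by simp), e1'])).mono ?_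
  rintro t5 s5 ⟨hf, hal, ht5⟩
  have m12 : s5.mem 12 = s3.mem 12 := by rw [hf.frame_mem 12 (by simp), m4 12 (by simp)]
  refine (runs_output (by rw [hf.frame_reg 1 (by simp), r4 1 (by simp), e1'])
    (by rw [hf.frame_reg 2 (by simp), r4 2 (by simp), e2'])
    (fun i hi => (hf.stored i hi).1)).mono ?_
  rintro t6 s6 ⟨hN, hout, ht6⟩
  rw [e3''] at hT hL hal hf ht5
  rw [hf.al] at hal
  have hlong := isLongestChain_backtrack hreps hT hL (fun i hi => (hf.stored i hi).2) hal
  have hNK : s5.reg 4 ≤ s3.reg 3 := hf.le.1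
  refine ⟨⟨_, _, _, hlong, ?_, fun i hi => ?_⟩, ?_⟩
  · rw [hN, List.length_map, length_backtrack]
  · rw [List.length_map] at hi
    simp only [List.getElem_map]
    simp only [m12] at hout
    exact hout i hi
  · have htime : scanTime off (s3.mem 12) (s3.reg 3) ≤
        ∑ v ∈ Finset.range n, 10 * (off (v + 1) - off v) :=
      hreps.sum_rep_le hlt (fun v => 10 * (off (v + 1) - off v)) _
    rw [← Finset.mul_sum] at htime
    rw [hr0] at ht1
    rw [i2, hr0] at ht2
    omega

end Computation

/-! ### The input as adjacency arrays -/

section Input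

variable {n : ℕ} {G : SimpleGraph (Fin n)} {adj : Fin n → List (Fin n)}

theorem concatLists_succ (adj : Fin n → List (Fin n)) {i : ℕ} (hi : i < n) :
    concatLists adj (i + 1) = concatLists adj i ++ adj ⟨i, hi⟩ := by
  have h : i < (List.finRange n).length := by simpa using hi
  rw [concatLists, concatLists, List.take_succ_eq_append_getElem h, List.flatMap_append]
  simp

theorem exists_concatLists_append (adj : Fin n → List (Fin n)) (i : ℕ) :
    ∃ R, concatLists adj n = concatLists adj i ++ R := by
  refine ⟨((List.finRange n).drop i).flatMap adj, ?_⟩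
  rw [concatLists, concatLists, ← List.flatMap_append, List.take_append_drop,
    List.take_of_length_le (by simp)]

theorem natGraph_adj_coe {u v : Fin n} : (natGraph G).Adj u v ↔ G.Adj u v :=
  ⟨fun ⟨_, _, h⟩ => h, fun h => ⟨u.2, v.2, h⟩⟩

theorem inputState_mem_zero {i : ℕ} (hi : i ≤ n) :
    (inputState adj).mem 0 i = (concatLists adj i).length := by
  simp [inputState, hi]

theorem inputState_mem_zero_succ {u : ℕ} (hu : u < n) :
    (inputState adj).mem 0 (u + 1) = (inputState adj).mem 0 u + (adj ⟨u, hu⟩).length := by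
  rw [inputState_mem_zero hu, inputState_mem_zero hu.le, concatLists_succ adj hu, List.length_append]

theorem inputState_mem_one {u j : ℕ} (hu : u < n) (hj : j < (adj ⟨u, hu⟩).length) :
    (inputState adj).mem 1 ((inputState adj).mem 0 u + j) = (adj ⟨u, hu⟩)[j] := by
  rw [inputState_mem_zero hu.le]
  obtain ⟨R, hR⟩ := exists_concatLists_append adj (u + 1)
  rw [concatLists_succ adj hu] at hR
  simp [inputState, hR, List.getD_eq_getElem?_getD, List.getElem?_append_right,
    List.getElem?_append_left (l₁ := List.map Fin.val (adj ⟨u, hu⟩)) (by simpa using hj), hj]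

theorem isCSR_inputState (hadj : IsAdjacencyList G adj) :
    IsCSR (natGraph G) n ((inputState adj).mem 0) ((inputState adj).mem 1) where
  off_le u hu := by rw [inputState_mem_zero_succ hu]; omega
  adj_lt := fun ⟨hu, _⟩ => hu
  adj_iff u hu v := by
    rw [inputState_mem_zero_succ hu]
    constructor
    · rintro ⟨_, hv, h⟩
      obtain ⟨j, hj, he⟩ := List.getElem_of_mem (((hadj _).2 _).2 h)
      exact ⟨_, Nat.le_add_right _ j, by omega, by rw [inputState_mem_one hu hj, he]⟩
    · rintro ⟨j, h1, h2, rfl⟩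
      obtain ⟨j, rfl⟩ := Nat.exists_eq_add_of_le h1
      have hj : j < (adj ⟨u, hu⟩).length := by omega
      rw [inputState_mem_one hu hj]
      exact ⟨hu, Fin.isLt _, ((hadj _).2 _).1 (List.getElem_mem hj)⟩
  inj u hu i j h1 h2 h3 h4 he := by
    rw [inputState_mem_zero_succ hu] at h2 h4
    obtain ⟨i, rfl⟩ := Nat.exists_eq_add_of_le h1
    obtain ⟨j, rfl⟩ := Nat.exists_eq_add_of_le h3
    have hi : i < (adj ⟨u, hu⟩).length := by omega
    have hj : j < (adj ⟨u, hu⟩).length := by omega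
    rw [inputState_mem_one hu hi, inputState_mem_one hu hj] at he
    have := ((hadj ⟨u, hu⟩).1.getElem_inj_iff).1 (Fin.ext he)
    omega

/-- The lengths of the lists are the degrees, so handshaking turns the length of the input into the
number of edges. -/
theorem inputState_mem_zero_last (hadj : IsAdjacencyList G adj) :
    (inputState adj).mem 0 n = 2 * G.edgeSet.ncard := by
  classical
  have h := sum_diff_eq n (isCSR_inputState hadj).off_le
  rw [inputState_mem_zero (Nat.zero_le _), concatLists, List.take_zero, List.flatMap_nil,
    List.length_nil, add_zero] at h
  rw [← h, Finset.sum_range, Set.ncard_eq_toFinset_card', ← SimpleGraph.edgeFinset,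
    ← SimpleGraph.sum_degrees_eq_twice_card_edges]
  refine Finset.sum_congr rfl fun u _ => ?_
  rw [inputState_mem_zero_succ u.2, Nat.add_sub_cancel_left, ← SimpleGraph.card_neighborFinset_eq_degree,
    ← List.toFinset_card_of_nodup (hadj _).1]
  congr 1
  ext v
  simp [(hadj _).2]

/-- Starting point for `Exec.bounded`; the summand `4` makes room for the constants of the program.
-/
theorem inputState_bounded (hadj : IsAdjacencyList G adj) :
    ((inputState adj).setReg 1 1).Bounded (n + 2 * G.edgeSet.ncard + 4) := by
  refine ⟨by simp [RAM.State.setReg_reg], fun r => ?_, fun k i => ?_⟩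
  · simp only [RAM.State.setReg_reg, inputState]
    split_ifs <;> omega
  · rw [RAM.State.setReg_mem]
    by_cases h0 : k = 0
    · subst h0
      by_cases hi : i ≤ n
      · obtain ⟨R, hR⟩ := exists_concatLists_append adj i
        have h1 := inputState_mem_zero_last hadj
        rw [inputState_mem_zero le_rfl, hR, List.length_append] at h1
        rw [inputState_mem_zero hi]
        omega
      · simp [inputState, hi]
    · by_cases h1 : k = 1
      · subst h1
        simp only [inputState, one_ne_zero, if_false, if_true]
        rcases lt_or_ge i ((concatLists adj n).map Fin.val).length with h | h
        · rw [List.getD_eq_getElem _ _ h, List.getElem_map]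
          omega
        · rw [List.getD_eq_default _ _ h]
          omega
      · simp [inputState, h0, h1]

end Input

/-! ### From a longest chain to a maximum matching -/

section Output

variable {n : ℕ} {G : SimpleGraph (Fin n)} {side key : ℕ → ℕ}

theorem precedes_natGraph {e f : Fin n × Fin n} :
    Precedes (natGraph G) key (e.1, e.2) (f.1, f.2) ↔ Precedes G (fun u => key u) e f := by
  simp only [Precedes, natGraph_adj_coe]

theorem KeyOrder.of_natGraph (h : KeyOrder (natGraph G) side key) :
    KeyOrder G (fun u => side u) (fun u => key u) where
  side_add huv := h.side_add (natGraph_adj_coe.2 huv)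
  cross hs h1 h2 h3 h4 := by
    have := h.cross hs h1 h2 (natGraph_adj_coe.2 h3) (natGraph_adj_coe.2 h4)
    simpa only [natGraph_adj_coe] using this

/-- The edges of a longest chain form a maximum uniquely restricted matching. -/
theorem exists_isMaximumUniquelyRestricted {L : List (ℕ × ℕ)} {s : RAM.State}
    (h : IsLongestChain (natGraph G) side key L) (h0 : s.reg 0 = L.length)
    (hL : ∀ (i : ℕ) (hi : i < L.length), s.mem 0 i = L[i].1 ∧ s.mem 1 i = L[i].2) :
    ∃ M : G.Subgraph, IsMaximumUniquelyRestricted M ∧ OutputsMatching s M := by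
  classical
  obtain ⟨L, rfl⟩ : ∃ L' : List (Fin n × Fin n), L'.map (fun e => ((e.1 : ℕ), (e.2 : ℕ))) = L := by
    have : L ∈ Set.range (List.map fun e : Fin n × Fin n => ((e.1 : ℕ), (e.2 : ℕ))) := by
      rw [Set.range_list_map]
      intro e he
      obtain ⟨h1, h2, -⟩ := (h.adj e he).1
      exact ⟨(⟨e.1, h1⟩, ⟨e.2, h2⟩), rfl⟩
    exact this
  have hk := h.order.of_natGraph
  have hS : ∀ e ∈ {e | e ∈ L}, G.Adj e.1 e.2 := fun e he =>
    natGraph_adj_coe.1 (h.adj _ (List.mem_map_of_mem he)).1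
  have hs : ∀ e ∈ {e | e ∈ L}, side e.1 = 0 := fun e he => (h.adj _ (List.mem_map_of_mem he)).2
  have hp : L.Pairwise fun e f => Precedes G (fun u => key u) f e := by
    have := h.chain
    rw [List.pairwise_map] at this
    exact this.imp precedes_natGraph.1
  have hc : ∀ e ∈ {e | e ∈ L}, ∀ f ∈ {e | e ∈ L}, e ≠ f →
      Precedes G (fun u => key u) e f ∨ Precedes G (fun u => key u) f e := by
    have : Std.Symm fun e f : Fin n × Fin n => Precedes G (fun u => key u) e f ∨
      Precedes G (fun u => key u) f e := ⟨fun _ _ h => h.symm⟩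
    exact fun e he f hf hne => (hp.imp fun h => .inr h :
      L.Pairwise fun e f => Precedes G (fun u => key u) e f ∨ Precedes G (fun u => key u) f e).forall
        he hf hne
  have hnodup : (L.map fun e => s(e.1, e.2)).Nodup := by
    rw [List.Nodup, List.pairwise_map]
    refine hp.imp_of_mem fun {e f} he hf hef heq => ?_
    rcases Sym2.eq_iff.1 heq with ⟨h1, -⟩ | ⟨h1, -⟩
    · exact absurd hef.1 (by rw [h1]; exact lt_irrefl _)
    · have := hk.side_add (hS f hf)
      have h2 := hs e he
      have h3 := hs f hf
      rw [h1] at h2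
      simp only [h2, h3] at this
      omega
  have hmem : ∀ e : Sym2 (Fin n), e ∈ (edgeSubgraph G {e | e ∈ L} hS).edgeSet ↔
      e ∈ L.map fun e => s(e.1, e.2) := by
    intro e
    induction e using Sym2.ind with
    | _ x y =>
    simp only [SimpleGraph.Subgraph.mem_edgeSet, edgeSubgraph, List.mem_map, Prod.exists,
      Sym2.eq_iff, Set.mem_ofPred_eq]
    constructor
    · rintro (h1 | h1)
      · exact ⟨x, y, h1, .inl ⟨rfl, rfl⟩⟩
      · exact ⟨y, x, h1, .inr ⟨rfl, rfl⟩⟩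
    · rintro ⟨a, b, h1, ⟨rfl, rfl⟩ | ⟨rfl, rfl⟩⟩
      · exact .inl h1
      · exact .inr h1
  have hcard : (edgeSubgraph G {e | e ∈ L} hS).edgeSet.ncard = L.length := by
    rw [show (edgeSubgraph G {e | e ∈ L} hS).edgeSet = (L.map fun e => s(e.1, e.2)).toFinset by
      ext e; simp only [hmem, List.coe_toFinset, Set.mem_ofPred_eq], Set.ncard_coe_finset,
      List.toFinset_card_of_nodup hnodup, List.length_map]
  refine ⟨edgeSubgraph G {e | e ∈ L} hS, ⟨edgeSubgraph_isUniquelyRestricted hS hk hs hc,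
    fun M' hM' => ?_⟩, L, hnodup, hmem, by simpa using h0, fun i hi => ?_⟩
  -- Directed from side `0` to side `1`, the edges of a competing uniquely restricted matching are
  -- pairwise comparable, so `card_le` bounds their number.
  · set T : Finset (Fin n × Fin n) := Finset.univ.filter fun e => M'.Adj e.1 e.2 ∧ side e.1 = 0
      with hT
    have h1 : M'.edgeSet.ncard ≤ T.card := by
      refine le_trans (Set.ncard_le_ncard (t := (T.image fun e => s(e.1, e.2) : Finset _)) ?_
        (Finset.finite_toSet _)) ((Set.ncard_coe_finset _).trans_le Finset.card_image_le)
      intro e he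
      induction e using Sym2.ind with
      | _ x y =>
      rw [SimpleGraph.Subgraph.mem_edgeSet] at he
      have := hk.side_add he.adj_sub
      simp only [hT, Finset.coe_image, Finset.coe_filter, Finset.mem_univ, true_and, Set.mem_image,
        Set.mem_ofPred_eq]
      by_cases hx : side x = 0
      · exact ⟨(x, y), ⟨he, hx⟩, rfl⟩
      · exact ⟨(y, x), ⟨he.symm, by simp only at this ⊢; omega⟩, Sym2.eq_swap⟩
    have h2 := h.card_le (T.image fun e => ((e.1 : ℕ), (e.2 : ℕ))) ?_ ?_
    · rw [Finset.card_image_of_injective _ fun e f hef => by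
        simp only [Prod.mk.injEq, Fin.val_inj] at hef
        exact Prod.ext hef.1 hef.2, List.length_map] at h2
      omega
    · simp only [hT, Finset.mem_image, Finset.mem_filter, Finset.mem_univ, true_and,
        forall_exists_index, and_imp]
      rintro _ e h3 h4 rfl
      exact ⟨natGraph_adj_coe.2 h3.adj_sub, h4⟩
    · simp only [hT, Finset.mem_image, Finset.mem_filter, Finset.mem_univ, true_and,
        forall_exists_index, and_imp]
      rintro _ e h3 h4 rfl _ f h5 h6 rfl hne
      rw [precedes_natGraph, precedes_natGraph]
      exact hM'.precedes hk h3 h5 h4 h6 fun he => hne (by rw [he])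
  · have := hL i (by simpa using hi)
    rwa [List.getElem_map] at this

end Output

/-- One program and one constant `C` work for all inputs: on every adjacency-list representation of
a bipartite permutation graph with `n` vertices and `m` edges, using only numbers below
`C * (n + m + 1)`, it halts after at most `C * (n + m + 1)` steps with a maximum cardinality
uniquely restricted matching as its output. -/
theorem mainTheorem5 :
    ∃ (P : RAM.Prog) (C : ℕ),
      ∀ (n : ℕ) (G : SimpleGraph (Fin n)) (adj : Fin n → List (Fin n)),
        IsBipartitePermutationGraph G → IsAdjacencyList G adj →
        ∃ (t : ℕ) (s : RAM.State),
          RAM.Exec (C * (n + G.edgeSet.ncard + 1)) P (inputState adj) t s ∧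
          t ≤ C * (n + G.edgeSet.ncard + 1) ∧
          ∃ M : G.Subgraph, IsMaximumUniquelyRestricted M ∧ OutputsMatching s M := by
  -- Register `1` is set to the increment `1` first. The time is at most `2000 (n + 2 m + 1) + 1`,
  -- and numbers exceed the initial bound `n + 2 m + 4` by at most the time; `5000` covers both.
  refine ⟨.seq (.assign 1 (.const 1)) chainProg, 5000, fun n G adj hG hadj => ?_⟩
  obtain ⟨c, p, hs, hp⟩ := exists_strongOrder hG
  obtain ⟨W, t, s, he, ⟨side, key, L, h1, h2, h3⟩, ht⟩ := runs_chain
    (s := (inputState adj).setReg 1 1) (isCSR_inputState hadj) hs hp rfl rfl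
    (fun k hk i => by
      simp [RAM.State.setReg_mem, inputState, show k ≠ 0 by omega, show k ≠ 1 by omega])
    (by simp [RAM.State.setReg_reg, inputState]) (by simp [RAM.State.setReg_reg])
    (fun r hr => by
      simp [RAM.State.setReg_reg, inputState, show r ≠ 0 by omega, show r ≠ 1 by omega])
  rw [inputState_mem_zero_last hadj] at ht
  have hb := (he.bounded incremental_chainProg (by omega) (inputState_bounded hadj)).1
  exact ⟨1 + t, s, .seq (.assign _ _ _ (by simp only [RAM.Rhs.value]; omega)) (hb.mono (by omega)),
    by omega, exists_isMaximumUniquelyRestricted h1 h2 h3⟩
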